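/- **Setting.** Let $d\ge 2$, $m\ge 1$ be integers, $\kappa,\mu,\tau>0$ and $\lambda\in(0,1)$. Let $A=(a_{ij}^{\alpha\beta})$, $1\le i,j\le d$, $1\le\alpha,\beta\le m$, be a real tensor field on $\mathbb{R}^d$ such that for all $y,w\in\mathbb{R}^d$, $\xi\in\mathbb{R}^{dm}$, $\mathbf n\in\mathbb{Z}^d$: $$a_{ij}^{\alpha\beta}(y)=a_{ji}^{\beta\alpha}(y),\quad \mu|\xi|^2\le a_{ij}^{\alpha\beta}(y)\xi_i^\alpha\xi_j^\beta\le\mu^{-1}|\xi|^2,\quad A(y+\mathbf n)=A(y),\quad |A(y)-A(w)|\le\tau|y-w|^\lambda .$$ Let $Y=(-\tfrac12,\tfrac12)^d$ and let $\omega\subset Y$ be a simply connected Lipschitz domain with connected boundary and $\mathrm{dist}(\omega,\partial Y)>0$. Let $\Omega\subset\mathbb{R}^d$ be a bounded Lipschitz domain. For $\varepsilon\in(0,1)$ let $\omega_\varepsilon^{\mathbf n}=\varepsilon(\mathbf n+\omega)$, let $D_\varepsilon$ be the union of those $\omega_\varepsilon^{\mathbf n}$, $\mathbf n\in\mathbb{Z}^d$,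 with $\omega_\varepsilon^{\mathbf n}\subset\Omega$ and $\mathrm{dist}(\omega_\varepsilon^{\mathbf n},\partial\Omega)>\kappa\varepsilon$, and let $\Omega_\varepsilon=\Omega\setminus\overline{D_\varepsilon}$. For $\delta\in(0,1]$ put $$\Lambda_{\varepsilon,\delta}=\delta\,\mathbb 1_{D_\varepsilon}+\mathbb 1_{\Omega_\varepsilon},\qquad \mathcal L_{\varepsilon,\delta}(u)=-\mathrm{div}\big[\Lambda_{\varepsilon,\delta}(x)A(x/\varepsilon)\nabla u\big],$$ and, for a source $f$, let $f_{\varepsilon,\delta}=\Lambda_{\varepsilon,\delta}f$ if $\delta<1$ and $f_{\varepsilon,\delta}=f$ if $\delta=1$. Equations are understood in the weak sense, and $\fint$ denotes the mean value. Let $Q_R(x_0)=\{x:\|x-x_0\|_\infty<R\}$. Given a rigid motion $\Phi:\mathbb{R}^{d-1}\times\mathbb{R}\to\mathbb{R}^d$, a Lipschitz function $\psi:\mathbb{R}^{d-1}\to\mathbb{R}$ with $\psi(0)=0$ and Lipschitz constant at most $K_0$, and $M_0>0$, let $$\mathbf D_r=\Phi\{(x',z):|x'|<r,\ 0<z-\psi(x')<M_0r\},\qquad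 \Delta_r=\Phi\{(x',\psi(x')):|x'|<r\}.$$ We call $\mathbf D_r$ a boundary cylinder of $\Omega$ if $\mathbf D_r\subset\Omega$ and $\Delta_r\subset\partial\Omega$. **Theorem.** (i) (Interior estimate) There is a constant $C>0$ depending only on $d,m,\kappa,\mu,\lambda,\tau,\omega,\Omega$ such that the following holds for all $\varepsilon\in(0,1)$, $\delta\in(0,1]$, $R\ge4\varepsilon$ and every cube $Q_{2R}=Q_{2R}(x_0)\subset\Omega$. If $f\in L^2(Q_{2R};\mathbb{R}^m)$ and $u\in H^1(Q_{2R};\mathbb{R}^m)$ satisfies $\mathcal L_{\varepsilon,\delta}(u)=f_{\varepsilon,\delta}$ in $Q_{2R}$, then $$\fint_{Q_R}|\nabla u|^2\le C\Big(\frac1{R^2}\fint_{Q_{2R}}|u|^2+R^2\fint_{Q_{2R}}|f|^2\Big).$$ (ii) (Boundary estimate) For all $K_0\ge0$ and $M_0>0$ there is a constant $C>0$ depending only on $d,m,\kappa,\mu,\lambda,\tau,\omega,\Omega,K_0,M_0$ such that the following holds for all $\varepsilon\in(0,1)$, $\delta\in(0,1]$, $R\ge4\varepsilon$ and every $(\Phi,\psi)$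 as above for which $\mathbf D_{2R}$ is a boundary cylinder of $\Omega$. If $f\in L^2(\mathbf D_{2R};\mathbb{R}^m)$, $g$ is an $\mathbb{R}^m$-valued Lipschitz function on $\Delta_{2R}$, and $u\in H^1(\mathbf D_{2R};\mathbb{R}^m)$ satisfies $\mathcal L_{\varepsilon,\delta}(u)=f_{\varepsilon,\delta}$ in $\mathbf D_{2R}$ and $u=g$ on $\Delta_{2R}$ (in the sense of traces), then $$\fint_{\mathbf D_{3R/2}}|\nabla u|^2\le C\Big\{\frac1{R^2}\fint_{\mathbf D_{2R}}|u|^2+R^2\fint_{\mathbf D_{2R}}|f|^2+\frac1{R^2}\|g\|^2_{L^\infty(\Delta_{2R})}+\|\nabla_{\rm tan}g\|^2_{L^\infty(\Delta_{2R})}\Big\}.$$ -/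

import Mathlib

open MeasureTheory Set Filter Topology
open scoped ENNReal NNReal InnerProductSpace

noncomputable section

/-- Euclidean space `ℝ^d`. -/
abbrev Eu (d : ℕ) : Type := EuclideanSpace ℝ (Fin d)

/-- Gradients of `ℝ^m`-valued functions on `ℝ^d`: arrays `ξ (i, α)`, with the Euclidean (Frobenius)
norm. -/
abbrev GradSp (d m : ℕ) : Type := EuclideanSpace ℝ (Fin d × Fin m)

/-- Coefficient tensors: the entry at `(i, α)`, `(j, β)` is `a_{ij}^{αβ}`. -/
abbrev Tensor (d m : ℕ) : Type := Matrix (Fin d × Fin m) (Fin d × Fin m) ℝ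

/-- `a_{ij}^{αβ} ξ_j^β η_i^α` (summation over all indices). -/
def tensorForm {d m : ℕ} (a : Tensor d m) (ξ η : GradSp d m) : ℝ :=
  ∑ p, ∑ q, a p q * ξ q * η p

/-- The assumptions on the coefficients: symmetry, strong ellipticity with constant `μ`,
`ℤ^d`-periodicity, Hölder continuity with exponent `lam` and constant `τ`. -/
structure CoeffAssumptions {d m : ℕ} (μ lam τ : ℝ) (A : Eu d → Tensor d m) : Prop where
  symm : ∀ (y : Eu d) (i j : Fin d) (α β : Fin m), A y (i, α) (j, β) = A y (j, β) (i, α)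
  elliptic : ∀ (y : Eu d) (ξ : GradSp d m),
    μ * ‖ξ‖ ^ 2 ≤ tensorForm (A y) ξ ξ ∧ tensorForm (A y) ξ ξ ≤ μ⁻¹ * ‖ξ‖ ^ 2
  periodic : ∀ (y : Eu d) (n : Fin d → ℤ), A (y + WithLp.toLp 2 (fun i => (n i : ℝ))) = A y
  holder : ∀ y w : Eu d,
    Real.sqrt (∑ p, ∑ q, (A y p q - A w p q) ^ 2) ≤ τ * ‖y - w‖ ^ lam

/-- The open cube `{x : ‖x - x₀‖_∞ < R}` (side length `2R`). -/
def cube {d : ℕ} (x₀ : Eu d) (R : ℝ) : Set (Eu d) := {x | ∀ i, |x i - x₀ i| < R}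

/-- The unit cell `(-1/2, 1/2)^d`. -/
def unitCell (d : ℕ) : Set (Eu d) := cube 0 (1 / 2)

/-- The distance between two sets (infinite if one of them is empty). -/
def setDist {d : ℕ} (s t : Set (Eu d)) : ℝ≥0∞ := ⨅ x ∈ s, Metric.infEDist x t

/-- Local coordinates `(x', z) ∈ ℝ^{d-1} × ℝ` with the Euclidean norm. -/
abbrev LocalCoord (d : ℕ) : Type := WithLp 2 (Eu (d - 1) × ℝ)

/-- A rigid change of coordinates `Φ` together with a function `ψ : ℝ^{d-1} → ℝ`, `ψ 0 = 0`. The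
centre is `Φ 0`, a point of the graph of `ψ`. -/
structure GraphChart (d : ℕ) where
  Φ : LocalCoord d ≃ᵃⁱ[ℝ] Eu d
  ψ : Eu (d - 1) → ℝ
  ψ_zero : ψ 0 = 0

namespace GraphChart

variable {d : ℕ}

/-- The point of `ℝ^d` with local coordinates `(x', z)`. -/
def pt (c : GraphChart d) (x' : Eu (d - 1)) (z : ℝ) : Eu d := c.Φ (WithLp.toLp 2 (x', z))

/-- The point of the graph of `ψ` above `x'`. -/
def graphPt (c : GraphChart d) (x' : Eu (d - 1)) : Eu d := c.pt x' (c.ψ x')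

/-- The cylinder `D_r = Φ {(x', z) : |x'| < r, 0 < z - ψ x' < M₀ r}`. -/
def cyl (c : GraphChart d) (M₀ r : ℝ) : Set (Eu d) :=
  {x | ∃ (x' : Eu (d - 1)) (z : ℝ),
    ‖x'‖ < r ∧ 0 < z - c.ψ x' ∧ z - c.ψ x' < M₀ * r ∧ x = c.pt x' z}

/-- The base `Δ_r` of the cylinder `D_r`: the part of the graph of `ψ` above `{|x'| < r}`. -/
def base (c : GraphChart d) (r : ℝ) : Set (Eu d) := c.graphPt '' Metric.ball 0 r

/-- `D_r` is a boundary cylinder of `Ω`: it lies in `Ω` and its base lies on `∂Ω`. -/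
def IsBoundaryCyl (c : GraphChart d) (Ω : Set (Eu d)) (M₀ r : ℝ) : Prop :=
  c.cyl M₀ r ⊆ Ω ∧ c.base r ⊆ frontier Ω

/-- The tangential gradient of `g : ℝ^d → ℝ^m` along the graph of `ψ`, at the graph point above `x'`,
in local coordinates. For each component, with `h = g ∘ graphPt` and `p = ∇ψ x'`, it is the vector of
the tangent space `{(v, ⟪p, v⟫)}` whose inner product with each tangent vector `(v, ⟪p, v⟫)` is
`⟪∇h x', v⟫`. The norm on `PiLp 2` is the Euclidean norm of the whole array. -/
def tanGrad (c : GraphChart d) {m : ℕ} (g : Eu d → Eu m) (x' : Eu (d - 1)) :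
    PiLp 2 (fun _ : Fin m => LocalCoord d) :=
  WithLp.toLp 2 fun α =>
    let p := gradient c.ψ x'
    let k := gradient (fun y => g (c.graphPt y) α) x'
    let q := k - (⟪p, k⟫_ℝ / (1 + ‖p‖ ^ 2)) • p
    WithLp.toLp 2 (q, ⟪p, q⟫_ℝ)

/-- `‖g‖_{L^∞(Δ_r)}`. The graph is parametrized by a Lipschitz map with Lipschitz inverse when `ψ` is
Lipschitz, so null sets of the surface measure are those of the Lebesgue measure of the parameter. -/
def supNorm (c : GraphChart d) {m : ℕ} (g : Eu d → Eu m) (r : ℝ) : ℝ :=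
  (eLpNorm (fun x' => g (c.graphPt x')) ∞ (volume.restrict (Metric.ball 0 r))).toReal

/-- `‖∇_tan g‖_{L^∞(Δ_r)}`. -/
def tanGradSupNorm (c : GraphChart d) {m : ℕ} (g : Eu d → Eu m) (r : ℝ) : ℝ :=
  (eLpNorm (fun x' => c.tanGrad g x') ∞ (volume.restrict (Metric.ball 0 r))).toReal

end GraphChart

/-- A Lipschitz domain: an open connected nonempty set which, near each boundary point, is the region
above the graph of a Lipschitz function in suitable rigid coordinates. -/
structure IsLipschitzDomain {d : ℕ} (Ω : Set (Eu d)) : Prop where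
  isOpen : IsOpen Ω
  isConnected : IsConnected Ω
  boundary : ∀ x₀ ∈ frontier Ω, ∃ c : GraphChart d, c.Φ 0 = x₀ ∧ (∃ K, LipschitzWith K c.ψ) ∧
    ∃ r > 0, ∃ h > 0, ∀ (x' : Eu (d - 1)) (z : ℝ), ‖x'‖ < r → |z - c.ψ x'| < h →
      (c.pt x' z ∈ Ω ↔ c.ψ x' < z)

/-- The assumptions on the model inclusion `ω`. -/
structure InclusionAssumptions {d : ℕ} (ω : Set (Eu d)) : Prop where
  lipschitz : IsLipschitzDomain ω
  simplyConnected : IsSimplyConnected ω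
  connected_frontier : IsConnected (frontier ω)
  subset_cell : ω ⊆ unitCell d
  dist_pos : 0 < setDist ω (frontier (unitCell d))

/-- `ω_ε^n = ε (n + ω)`. -/
def cellInclusion {d : ℕ} (ω : Set (Eu d)) (ε : ℝ) (n : Fin d → ℤ) : Set (Eu d) :=
  (fun y => ε • (WithLp.toLp 2 (fun i => (n i : ℝ)) + y)) '' ω

/-- The index set of the inclusions: `ω_ε^n ⊆ Ω` and `dist (ω_ε^n, ∂Ω) > κ ε`. -/
def inclusionIndices {d : ℕ} (Ω ω : Set (Eu d)) (κ ε : ℝ) : Set (Fin d → ℤ) :=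
  {n | cellInclusion ω ε n ⊆ Ω ∧
    ENNReal.ofReal (κ * ε) < setDist (cellInclusion ω ε n) (frontier Ω)}

/-- `D_ε`, the union of the inclusions. -/
def inclusions {d : ℕ} (Ω ω : Set (Eu d)) (κ ε : ℝ) : Set (Eu d) :=
  ⋃ n ∈ inclusionIndices Ω ω κ ε, cellInclusion ω ε n

/-- The background `Ω_ε`, the complement in `Ω` of the closure of `D_ε`. -/
def background {d : ℕ} (Ω ω : Set (Eu d)) (κ ε : ℝ) : Set (Eu d) :=
  Ω \ closure (inclusions Ω ω κ ε)

/-- The contrast function `Λ_{ε,δ} = δ 1_{D_ε} + 1_{Ω_ε}`. -/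
def contrast {d : ℕ} (Ω ω : Set (Eu d)) (κ ε δ : ℝ) (x : Eu d) : ℝ :=
  δ * (inclusions Ω ω κ ε).indicator (fun _ => (1 : ℝ)) x
    + (background Ω ω κ ε).indicator (fun _ => (1 : ℝ)) x

open Classical in
/-- The modified source `f_{ε,δ}`: `f` if `δ ≥ 1`, and `Λ_{ε,δ} f` if `δ < 1`. -/
def modSource {d m : ℕ} (Ω ω : Set (Eu d)) (κ ε δ : ℝ) (f : Eu d → Eu m) (x : Eu d) : Eu m :=
  if 1 ≤ δ then f x else contrast Ω ω κ ε δ x • f x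

/-- The classical gradient, as an array: the entry at `(i, α)` is `∂_i φ^α`. -/
def gradArr {d m : ℕ} (φ : Eu d → Eu m) (x : Eu d) : GradSp d m :=
  WithLp.toLp 2 fun p => (fderiv ℝ φ x (EuclideanSpace.single p.1 1)) p.2

/-- `u ∈ H^1(U; ℝ^m)` with weak gradient `Du`. -/
structure IsH1 {d m : ℕ} (U : Set (Eu d)) (u : Eu d → Eu m) (Du : Eu d → GradSp d m) : Prop where
  memLp : MemLp u 2 (volume.restrict U)
  memLp_grad : MemLp Du 2 (volume.restrict U)
  weak : ∀ φ : Eu d → ℝ, ContDiff ℝ ((⊤ : ℕ∞) : WithTop ℕ∞) φ → HasCompactSupport φ → tsupport φ ⊆ U →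
    ∀ (i : Fin d) (α : Fin m),
      ∫ x in U, u x α * fderiv ℝ φ x (EuclideanSpace.single i 1) = -∫ x in U, Du x (i, α) * φ x

/-- The weak form of `-div (Λ_{ε,δ} A(x/ε) ∇u) = F` in the open set `U`, for `u` with weak gradient
`Du`, tested with smooth compactly supported functions. -/
def IsWeakSolution {d m : ℕ} (Ω ω : Set (Eu d)) (κ ε δ : ℝ) (A : Eu d → Tensor d m)
    (U : Set (Eu d)) (Du : Eu d → GradSp d m) (F : Eu d → Eu m) : Prop :=
  ∀ φ : Eu d → Eu m, ContDiff ℝ ((⊤ : ℕ∞) : WithTop ℕ∞) φ → HasCompactSupport φ → tsupport φ ⊆ U →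
    ∫ x in U, contrast Ω ω κ ε δ x * tensorForm (A (ε⁻¹ • x)) (Du x) (gradArr φ x)
      = ∫ x in U, ⟪F x, φ x⟫_ℝ

/-- `u = g` on the boundary portion `S` of `U`, for `u ∈ H^1(U)` with weak gradient `Du` and `g`
Lipschitz on `S`: `u` is the limit in `H^1(U)` of Lipschitz functions that are equal to `g` on `S`. -/
def HasBoundaryValue {d m : ℕ} (U S : Set (Eu d)) (u : Eu d → Eu m) (Du : Eu d → GradSp d m)
    (g : Eu d → Eu m) : Prop :=
  ∃ w : ℕ → Eu d → Eu m, (∀ k, ∃ K, LipschitzWith K (w k)) ∧ (∀ k, EqOn (w k) g S) ∧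
    Tendsto (fun k => eLpNorm (fun x => w k x - u x) 2 (volume.restrict U)) atTop (𝓝 0) ∧
    Tendsto (fun k => eLpNorm (fun x => gradArr (w k) x - Du x) 2 (volume.restrict U)) atTop (𝓝 0)

end

noncomputable section

/-! Testing the equation with a squared cutoff times the solution gives Caccioppoli's inequality
with the weight `Λ` (`WeakSol.caccioppoli`). It controls the gradient in the background, where `Λ =
1` (`WeakSol.background_le`), but degenerates like `δ` in the inclusions. What has to be recovered,
uniformly in `δ`, is the gradient inside each inclusion.

On one inclusion `Λ` is the constant `δ` and the source carries the same factor, so the equation,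
tested with a function supported there, can be divided by `δ`. The test function is `v - E`, where
`v` approximates the solution and `E` carries the values of `v` on the outer collar into the
inclusion. Friedrichs' inequality and absorption then bound the inner gradient by the gradient of
`E` and `ε² |f|²` (`WeakSol.cell_energy`). The extension `E` is built from local reflections
(`IsLipschitzDomain.exists_extension`) and is bounded by the `H¹` norm of `v` on the collar. If a
constant is subtracted first, the Poincaré inequality on the collar leaves only the gradient there;
this inequality rests on the connectedness of the frontier of `ω`
(`IsLipschitzDomain.exists_collar_poincare`). Scaling makes the constants independent of `ε` and of
the cell (`exists_cell_extension`). The collars lie in the background and the neighbourhoods of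
distinct inclusions are disjoint, so the estimates in the cells can be added
(`lintegral_le_background_add_cells`).

In the interior, `R ≥ 4 ε` keeps the neighbourhood of every inclusion that meets the small cube
inside an intermediate one. At the boundary such an inclusion may leave the larger cylinder. If `R`
is a large multiple of `ε` this does not happen, and the distance `κ ε` together with the
connectedness of `ω` keeps the neighbourhood above the graph. Otherwise `ε` and `R` are comparable,
the cell estimate is localized by a cutoff on scale `ε`, and its cost `ε⁻² |u|²` is admissible
(`exists_boundary_cell_estimate`).

All inequalities are proved for Lipschitz functions `w k` converging to `u` in `H¹`, with error
terms that vanish in the limit. To allow the test functions above, the weak equation is first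
extended to Lipschitz functions vanishing outside the set (`weak_eq_of_lipschitz`). -/

/-! ### Gradient arrays. -/

/-- The array of entries of a linear map, the gradient array of an affine function. -/
def arrL (d m : ℕ) : (Eu d →L[ℝ] Eu m) →L[ℝ] GradSp d m :=
  LinearMap.mkContinuous
    { toFun := fun L => WithLp.toLp 2 fun p => (L (EuclideanSpace.single p.1 1)) p.2
      map_add' := fun _ _ => by ext p; simp
      map_smul' := fun _ _ => by ext p; simp }
    (Real.sqrt d) (by
      intro L
      have h : ‖WithLp.toLp 2 fun p : Fin d × Fin m => (L (EuclideanSpace.single p.1 1)) p.2‖ ^ 2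
          ≤ d * ‖L‖ ^ 2 := by
        rw [EuclideanSpace.norm_sq_eq, Fintype.sum_prod_type]
        calc _ = ∑ i : Fin d, ‖L (EuclideanSpace.single i 1)‖ ^ 2 := by
              simp [EuclideanSpace.norm_sq_eq]
          _ ≤ ∑ _i : Fin d, ‖L‖ ^ 2 := by
              gcongr with i
              simpa using L.le_opNorm (EuclideanSpace.single i (1 : ℝ))
          _ = _ := by simp
      have := Real.le_sqrt_of_sq_le h
      rwa [Real.sqrt_mul (by positivity), Real.sqrt_sq (norm_nonneg _)] at this)

lemma gradArr_eq {d m : ℕ} (φ : Eu d → Eu m) (x : Eu d) :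
    gradArr φ x = arrL d m (fderiv ℝ φ x) := rfl

lemma norm_arrL_le {d m : ℕ} (L : Eu d →L[ℝ] Eu m) : ‖arrL d m L‖ ≤ Real.sqrt d * ‖L‖ :=
  (LinearMap.mkContinuous_norm_le _ (Real.sqrt_nonneg _) _ |> fun h =>
    (arrL d m).le_of_opNorm_le h L)

lemma norm_apply_le_arrL {d m : ℕ} (L : Eu d →L[ℝ] Eu m) (h : Eu d) :
    ‖L h‖ ≤ ‖arrL d m L‖ * ‖h‖ := by
  have hL : L h = ∑ i, h i • L (EuclideanSpace.single i 1) := by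
    conv_lhs => rw [← (EuclideanSpace.basisFun (Fin d) ℝ).sum_repr h]
    simp
  have hn : ‖arrL d m L‖ ^ 2 = ∑ i : Fin d, ‖L (EuclideanSpace.single i 1)‖ ^ 2 := by
    have : arrL d m L = WithLp.toLp 2 fun p => (L (EuclideanSpace.single p.1 1)) p.2 := rfl
    rw [this, EuclideanSpace.norm_sq_eq, Fintype.sum_prod_type]
    simp [EuclideanSpace.norm_sq_eq]
  refine le_of_sq_le_sq ?_ (by positivity)
  calc ‖L h‖ ^ 2 ≤ (∑ i, ‖h i‖ * ‖L (EuclideanSpace.single i 1)‖) ^ 2 := by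
        rw [hL]
        gcongr
        refine (norm_sum_le _ _).trans ?_
        simp [norm_smul]
    _ ≤ (∑ i, ‖h i‖ ^ 2) * ∑ i : Fin d, ‖L (EuclideanSpace.single i 1)‖ ^ 2 :=
        Finset.sum_mul_sq_le_sq_mul_sq _ _ _
    _ = _ := by rw [← hn, ← EuclideanSpace.norm_sq_eq]; ring
where
  le_of_sq_le_sq {a b : ℝ} (h : a ^ 2 ≤ b ^ 2) (hb : 0 ≤ b) : a ≤ b := by
    exact abs_le_of_sq_le_sq' h hb |>.2

lemma norm_le_arrL {d m : ℕ} (L : Eu d →L[ℝ] Eu m) : ‖L‖ ≤ ‖arrL d m L‖ :=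
  L.opNorm_le_bound (norm_nonneg _) (norm_apply_le_arrL L)

lemma measurable_gradArr {d m : ℕ} (φ : Eu d → Eu m) : Measurable (gradArr φ) :=
  (arrL d m).continuous.measurable.comp (measurable_fderiv ℝ φ)

lemma norm_gradArr_le {d m : ℕ} {φ : Eu d → Eu m} {K : ℝ≥0} (h : LipschitzWith K φ) (x : Eu d) :
    ‖gradArr φ x‖ ≤ Real.sqrt d * K := by
  rw [gradArr_eq]
  refine (norm_arrL_le _).trans ?_
  gcongr
  exact norm_fderiv_le_of_lipschitz ℝ h

lemma gradArr_congr {d m : ℕ} {φ χ : Eu d → Eu m} {x : Eu d} (h : φ =ᶠ[𝓝 x] χ) :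
    gradArr φ x = gradArr χ x := by
  rw [gradArr_eq, gradArr_eq, h.fderiv_eq]

lemma gradArr_zero {d m : ℕ} {φ : Eu d → Eu m} {x : Eu d} (h : φ =ᶠ[𝓝 x] fun _ => 0) :
    gradArr φ x = 0 := by
  rw [gradArr_congr h, gradArr_eq]; simp

lemma gradArr_sub {d m : ℕ} {φ χ : Eu d → Eu m} {x : Eu d} (hφ : DifferentiableAt ℝ φ x)
    (hχ : DifferentiableAt ℝ χ x) :
    gradArr (fun y => φ y - χ y) x = gradArr φ x - gradArr χ x := by
  rw [gradArr_eq, gradArr_eq, gradArr_eq, fderiv_fun_sub hφ hχ, map_sub]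

lemma gradArr_sub_const {d m : ℕ} (φ : Eu d → Eu m) (c : Eu m) (x : Eu d) :
    gradArr (fun y => φ y - c) x = gradArr φ x := by
  rw [gradArr_eq, gradArr_eq, fderiv_sub_const]

/-- The array `(∂_i η) v^α`. -/
def tensArr {d m : ℕ} (ℓ : Eu d →L[ℝ] ℝ) (v : Eu m) : GradSp d m := arrL d m (ℓ.smulRight v)

lemma norm_tensArr_le {d m : ℕ} (ℓ : Eu d →L[ℝ] ℝ) (v : Eu m) :
    ‖tensArr ℓ v‖ ≤ Real.sqrt d * ‖ℓ‖ * ‖v‖ := by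
  refine (norm_arrL_le _).trans_eq ?_
  rw [ContinuousLinearMap.norm_smulRight_apply, mul_assoc]

lemma gradArr_smul {d m : ℕ} {η : Eu d → ℝ} {φ : Eu d → Eu m} {x : Eu d}
    (hη : DifferentiableAt ℝ η x) (hφ : DifferentiableAt ℝ φ x) :
    gradArr (fun y => η y • φ y) x = η x • gradArr φ x + tensArr (fderiv ℝ η x) (φ x) := by
  rw [gradArr_eq, gradArr_eq, tensArr, fderiv_fun_smul hη hφ, map_add, map_smul]

/-! ### Gluing and multiplying Lipschitz functions. -/

lemma IsPreconnected.exists_mem_frontier {X : Type*} [TopologicalSpace X] {s U : Set X}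
    (hs : IsPreconnected s) {x y : X} (hx : x ∈ s) (hxU : x ∈ U) (hy : y ∈ s) (hyU : y ∉ U) :
    ∃ z ∈ s, z ∈ frontier U := by
  by_contra! h
  have h1 : ∀ z ∈ s, z ∈ U → z ∈ interior U := fun z hz hzU => by
    by_contra hc
    exact h z hz ⟨subset_closure hzU, hc⟩
  have h2 : ∀ z ∈ s, z ∉ U → z ∈ (closure U)ᶜ := fun z hz hzU hc =>
    h z hz ⟨hc, fun hi => hzU (interior_subset hi)⟩
  obtain ⟨z, -, hz1, hz2⟩ := hs (interior U) (closure U)ᶜ isOpen_interior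
    isClosed_closure.isOpen_compl
    (fun z hz => (em (z ∈ U)).imp (h1 z hz) (h2 z hz)) ⟨x, hx, h1 x hx hxU⟩ ⟨y, hy, h2 y hy hyU⟩
  exact hz2 (subset_closure (interior_subset hz1))

lemma exists_mem_segment_frontier {E : Type*} [NormedAddCommGroup E] [NormedSpace ℝ E]
    {U : Set E} {x y : E} (hx : x ∈ U) (hy : y ∉ U) :
    ∃ z ∈ segment ℝ x y, z ∈ frontier U :=
  (convex_segment x y).isPreconnected.exists_mem_frontier (left_mem_segment ℝ x y) hx
    (right_mem_segment ℝ x y) hy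

lemma dist_le_of_mem_segment {E : Type*} [NormedAddCommGroup E] [NormedSpace ℝ E] {x y z : E}
    (h : z ∈ segment ℝ x y) : dist x z ≤ dist x y := by
  have := dist_add_dist_of_mem_segment h
  linarith [dist_nonneg (x := z) (y := y)]

/-- Extension by zero of a Lipschitz function that vanishes on the frontier. -/
lemma LipschitzWith.indicator_of_frontier {E F : Type*} [NormedAddCommGroup E] [NormedSpace ℝ E]
    [NormedAddCommGroup F] {K : ℝ≥0} {θ : E → F} {U : Set E} (h : LipschitzWith K θ)
    (h0 : ∀ x ∈ frontier U, θ x = 0) : LipschitzWith K (U.indicator θ) := by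
  have key : ∀ x ∈ U, ∀ y ∉ U, ‖θ x‖ ≤ K * dist x y := by
    intro x hx y hy
    obtain ⟨z, hz, hz'⟩ := exists_mem_segment_frontier hx hy
    have := h.dist_le_mul x z
    rw [h0 z hz', dist_zero_right] at this
    exact this.trans (by gcongr; exact dist_le_of_mem_segment hz)
  refine LipschitzWith.of_dist_le_mul fun x y => ?_
  by_cases hx : x ∈ U <;> by_cases hy : y ∈ U
  · simpa [hx, hy] using h.dist_le_mul x y
  · simpa [hx, hy] using key x hx y hy
  · rw [dist_comm x y]; simpa [hx, hy] using key y hy x hx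
  · simp only [indicator_of_notMem hx, indicator_of_notMem hy, dist_self]; positivity

/-- The product of a Lipschitz function with bounded support and a Lipschitz function. -/
lemma LipschitzWith.exists_smul_of_bounded {E F : Type*} [NormedAddCommGroup E]
    [NormedAddCommGroup F] [NormedSpace ℝ F] {K L : ℝ≥0} {η : E → ℝ} {v : E → F}
    (hη : LipschitzWith K η) (hv : LipschitzWith L v) {B : Set E} (hB : Bornology.IsBounded B)
    (h0 : ∀ x ∉ B, η x = 0) : ∃ K', LipschitzWith K' fun x => η x • v x := by
  obtain ⟨r, hr⟩ := hB.subset_closedBall (0 : E)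
  obtain ⟨M, hM⟩ : ∃ M : ℝ≥0, ∀ x ∈ B, ‖v x‖ ≤ M ∧ ‖η x‖ ≤ M := by
    refine ⟨⟨max 0 (max (‖v 0‖ + L * r) (‖η 0‖ + K * r)), le_max_left _ _⟩, fun x hx => ?_⟩
    have hx' : dist x 0 ≤ r := hr hx
    have h1 := hv.dist_le_mul x 0
    have h2 := hη.dist_le_mul x 0
    rw [dist_eq_norm] at h1 h2
    have h3 := norm_le_norm_add_norm_sub' (v x) (v 0)
    have h4 := norm_le_norm_add_norm_sub' (η x) (η 0)
    have h5 : (L : ℝ) * dist x 0 ≤ L * r := by gcongr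
    have h6 : (K : ℝ) * dist x 0 ≤ K * r := by gcongr
    constructor
    · exact le_trans (by linarith) (le_trans (le_max_left _ _) (le_max_right 0 _))
    · exact le_trans (by linarith) (le_trans (le_max_right _ _) (le_max_right 0 _))
  have key : ∀ x ∈ B, ∀ y, dist (η x • v x) (η y • v y) ≤ (K * M + M * L : ℝ≥0) * dist x y := by
    intro x hx y
    have h1 := hv.dist_le_mul x y
    have h2 := hη.dist_le_mul x y
    by_cases hy : y ∈ B
    · calc dist (η x • v x) (η y • v y) ≤ dist (η x • v x) (η y • v x) +
            dist (η y • v x) (η y • v y) := dist_triangle _ _ _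
        _ = dist (η x) (η y) * ‖v x‖ + ‖η y‖ * dist (v x) (v y) := by
            rw [dist_eq_norm, dist_eq_norm, dist_eq_norm, dist_eq_norm, ← sub_smul, ← smul_sub,
              norm_smul, norm_smul]
        _ ≤ (K * dist x y) * M + M * (L * dist x y) := by
            gcongr
            · exact (hM x hx).1
            · exact (hM y hy).2
        _ = _ := by push_cast; ring
    · rw [h0 y hy, zero_smul, dist_zero_right, norm_smul]
      rw [h0 y hy, dist_zero_right] at h2
      calc ‖η x‖ * ‖v x‖ ≤ (K * dist x y) * M := by gcongr; exact (hM x hx).1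
        _ ≤ (K * dist x y) * M + M * (L * dist x y) := le_add_of_nonneg_right (by positivity)
        _ = _ := by push_cast; ring
  refine ⟨K * M + M * L, LipschitzWith.of_dist_le_mul fun x y => ?_⟩
  by_cases hx : x ∈ B
  · exact key x hx y
  · by_cases hy : y ∈ B
    · rw [dist_comm, dist_comm x y]; exact key y hy x
    · simp only [h0 x hx, h0 y hy, zero_smul, dist_self]; positivity

/-! ### Squared norms under the lower integral. -/

lemma eLpNorm_two_sq {α F : Type*} [MeasurableSpace α] [NormedAddCommGroup F] (f : α → F)
    (μ : Measure α) : eLpNorm f 2 μ ^ 2 = ∫⁻ x, ‖f x‖ₑ ^ 2 ∂μ := by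
  rw [eLpNorm_eq_lintegral_rpow_enorm_toReal (by norm_num) (by norm_num)]
  rw [← ENNReal.rpow_natCast, ← ENNReal.rpow_mul]
  simp

lemma enorm_add_sq_le {F : Type*} [NormedAddCommGroup F] (a b : F) :
    ‖a + b‖ₑ ^ 2 ≤ 2 * ‖a‖ₑ ^ 2 + 2 * ‖b‖ₑ ^ 2 := by
  have h : ‖a + b‖ ^ 2 ≤ 2 * ‖a‖ ^ 2 + 2 * ‖b‖ ^ 2 := by
    nlinarith [norm_add_le a b, norm_nonneg (a + b), norm_nonneg a, norm_nonneg b,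
      sq_nonneg (‖a‖ - ‖b‖)]
  have h' := ENNReal.ofReal_le_ofReal h
  rw [ENNReal.ofReal_add (by positivity) (by positivity), ENNReal.ofReal_mul (by norm_num),
    ENNReal.ofReal_mul (by norm_num), ENNReal.ofReal_pow (norm_nonneg _),
    ENNReal.ofReal_pow (norm_nonneg _), ENNReal.ofReal_pow (norm_nonneg _), ofReal_norm,
    ofReal_norm, ofReal_norm] at h'
  simpa using h'

lemma enorm_sub_sq_le {F : Type*} [NormedAddCommGroup F] (a b : F) :
    ‖a - b‖ₑ ^ 2 ≤ 2 * ‖a‖ₑ ^ 2 + 2 * ‖b‖ₑ ^ 2 := by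
  simpa [sub_eq_add_neg] using enorm_add_sq_le a (-b)

lemma enorm_sq_le_add_sub {F : Type*} [NormedAddCommGroup F] (a b : F) :
    ‖a‖ₑ ^ 2 ≤ 2 * ‖b‖ₑ ^ 2 + 2 * ‖a - b‖ₑ ^ 2 := by
  simpa using enorm_add_sq_le b (a - b)

/-! ### Translation and Poincaré inequalities for Lipschitz functions. -/

/-- Rademacher's theorem holds on every translate, and Fubini exchanges the two "almost every"
quantifiers. A Lipschitz function is therefore differentiable almost everywhere along almost every
line of a given direction, which is what the fundamental theorem of calculus needs below. -/
lemma ae_forall_ae_differentiableAt {d m : ℕ} {v : Eu d → Eu m} {K : ℝ≥0} (hv : LipschitzWith K v)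
    (h : Eu d) : ∀ᵐ x : Eu d, ∀ᵐ t : ℝ, DifferentiableAt ℝ v (x - t • h) := by
  have hm : MeasurableSet {z : Eu d × ℝ | DifferentiableAt ℝ v (z.1 - z.2 • h)} := by
    have hg : Measurable fun z : Eu d × ℝ => z.1 - z.2 • h := by fun_prop
    exact hg (measurableSet_of_differentiableAt ℝ v)
  rw [Measure.ae_ae_comm hm]
  refine Eventually.of_forall fun t => ?_
  exact (measurePreserving_sub_right volume (t • h)).quasiMeasurePreserving.ae
    (hv.ae_differentiableAt)

/-- Pairing with the increment `e` itself reduces the claim to a real Lipschitz, hence absolutely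
continuous, function on `[0, 1]`. Its total variation gives `‖e‖²` on one side and a factor `‖e‖` on
the other, which is cancelled at the end. -/
lemma norm_sub_le_integral_gradArr {d m : ℕ} {v : Eu d → Eu m} {K : ℝ≥0} (hv : LipschitzWith K v)
    {h x : Eu d} (hx : ∀ᵐ t : ℝ, DifferentiableAt ℝ v (x - t • h)) :
    ‖v x - v (x - h)‖ ≤ ∫ t in (0 : ℝ)..1, ‖h‖ * ‖gradArr v (x - t • h)‖ := by
  set e := v x - v (x - h) with he
  have hg : LipschitzWith (‖e‖₊ * (K * ‖h‖₊)) fun t : ℝ => ⟪e, v (x - t • h)⟫_ℝ := by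
    refine LipschitzWith.of_dist_le_mul fun s t => ?_
    rw [Real.dist_eq, ← inner_sub_right]
    refine (abs_real_inner_le_norm _ _).trans ?_
    have := hv.dist_le_mul (x - s • h) (x - t • h)
    rw [dist_eq_norm] at this
    push_cast
    rw [mul_assoc]
    gcongr
    refine this.trans_eq ?_
    rw [dist_sub_left, dist_eq_norm, ← sub_smul, norm_smul, Real.dist_eq, Real.norm_eq_abs]
    ring
  have hac := (hg.lipschitzOnWith (s := uIcc 0 1)).absolutelyContinuousOnInterval
  have hftc := hac.integral_deriv_eq_sub
  have hbd : ∀ᵐ t : ℝ, -deriv (fun t : ℝ => ⟪e, v (x - t • h)⟫_ℝ) t ≤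
      ‖e‖ * (‖h‖ * ‖gradArr v (x - t • h)‖) := by
    filter_upwards [hx] with t ht
    have h1 : HasDerivAt (fun t : ℝ => x - t • h) (-h) t := by
      simpa using ((hasDerivAt_id t).smul_const h).const_sub x
    have h2 := ht.hasFDerivAt.comp_hasDerivAt t h1
    have h3 : HasDerivAt (fun t : ℝ => ⟪e, v (x - t • h)⟫_ℝ)
        (⟪e, fderiv ℝ v (x - t • h) (-h)⟫_ℝ) t := by
      simpa using (hasDerivAt_const t e).inner ℝ h2
    rw [h3.deriv]
    refine (neg_le_abs _).trans ((abs_real_inner_le_norm _ _).trans ?_)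
    gcongr
    have := norm_apply_le_arrL (fderiv ℝ v (x - t • h)) (-h)
    rw [norm_neg, mul_comm] at this
    exact this
  have hint : IntervalIntegrable (fun t => ‖h‖ * ‖gradArr v (x - t • h)‖) volume 0 1 := by
    rw [intervalIntegrable_iff]
    refine Measure.integrableOn_of_bounded (M := ‖h‖ * (Real.sqrt d * K)) (by simp) ?_ ?_
    · have h2 : Measurable fun t : ℝ => x - t • h := by fun_prop
      exact ((((measurable_gradArr v).comp h2).norm).const_mul _).aestronglyMeasurable
    · refine Eventually.of_forall fun t => ?_
      rw [Real.norm_of_nonneg (by positivity)]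
      gcongr
      exact norm_gradArr_le hv _
  have hsq : ‖e‖ * ‖e‖ ≤ ‖e‖ * ∫ t in (0 : ℝ)..1, ‖h‖ * ‖gradArr v (x - t • h)‖ := by
    have h1 : ‖e‖ * ‖e‖ = -∫ t in (0 : ℝ)..1, deriv (fun t : ℝ => ⟪e, v (x - t • h)⟫_ℝ) t := by
      rw [hftc, ← real_inner_self_eq_norm_mul_norm, neg_sub, ← inner_sub_right]
      simp [he]
    rw [h1, ← intervalIntegral.integral_const_mul, ← intervalIntegral.integral_neg]
    refine intervalIntegral.integral_mono_ae zero_le_one ?_ (hint.const_mul _) hbd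
    exact hac.intervalIntegrable_deriv.neg
  rcases eq_or_lt_of_le (norm_nonneg e) with h0 | h0
  · rw [← h0]
    exact intervalIntegral.integral_nonneg zero_le_one fun t _ => by positivity
  · exact le_of_mul_le_mul_left hsq h0

lemma lintegral_sq_le_of_prob {α : Type*} [MeasurableSpace α] {μ : Measure α}
    [IsProbabilityMeasure μ] {f : α → ℝ} (hf : AEStronglyMeasurable f μ) :
    (∫⁻ x, ‖f x‖ₑ ∂μ) ^ 2 ≤ ∫⁻ x, ‖f x‖ₑ ^ 2 ∂μ := by
  rw [← eLpNorm_two_sq, ← eLpNorm_one_eq_lintegral_enorm]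
  gcongr
  exact eLpNorm_le_eLpNorm_of_exponent_le (by norm_num) hf

lemma enorm_sub_sq_le_lintegral_gradArr {d m : ℕ} {v : Eu d → Eu m} {K : ℝ≥0}
    (hv : LipschitzWith K v) {h x : Eu d} (hx : ∀ᵐ t : ℝ, DifferentiableAt ℝ v (x - t • h)) :
    ‖v x - v (x - h)‖ₑ ^ 2 ≤
      ∫⁻ t in Ioc (0 : ℝ) 1, ‖h‖ₑ ^ 2 * ‖gradArr v (x - t • h)‖ₑ ^ 2 := by
  have hp : IsProbabilityMeasure (volume.restrict (Ioc (0 : ℝ) 1)) := ⟨by simp⟩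
  have hm : Measurable fun t : ℝ => ‖h‖ * ‖gradArr v (x - t • h)‖ := by
    have h2 : Measurable fun t : ℝ => x - t • h := by fun_prop
    exact (((measurable_gradArr v).comp h2).norm).const_mul _
  have h1 := norm_sub_le_integral_gradArr hv hx
  rw [intervalIntegral.integral_of_le zero_le_one] at h1
  have h3 : ‖v x - v (x - h)‖ₑ ≤
      ∫⁻ t in Ioc (0 : ℝ) 1, ‖‖h‖ * ‖gradArr v (x - t • h)‖‖ₑ := by
    rw [← ofReal_norm]
    refine (ENNReal.ofReal_le_ofReal (h1.trans (le_abs_self _))).trans ?_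
    rw [← Real.norm_eq_abs, ofReal_norm]
    exact enorm_integral_le_lintegral_enorm _
  refine (pow_le_pow_left' h3 2).trans ((lintegral_sq_le_of_prob hm.aestronglyMeasurable).trans ?_)
  simp [enorm_mul, mul_pow]

/-- The `L²` modulus of continuity of a Lipschitz function under translations. -/
lemma lintegral_sub_translate_le {d m : ℕ} {v : Eu d → Eu m} {K : ℝ≥0} (hv : LipschitzWith K v)
    (h : Eu d) {S W : Set (Eu d)} (hW : MeasurableSet W)
    (hSW : ∀ x ∈ S, ∀ t ∈ Icc (0 : ℝ) 1, x - t • h ∈ W) :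
    ∫⁻ x in S, ‖v x - v (x - h)‖ₑ ^ 2 ≤ ‖h‖ₑ ^ 2 * ∫⁻ x in W, ‖gradArr v x‖ₑ ^ 2 := by
  have hF : Measurable fun x => ‖gradArr v x‖ₑ ^ 2 := (measurable_gradArr v).enorm.pow_const 2
  calc _ ≤ ∫⁻ x in S, ∫⁻ t in Ioc (0 : ℝ) 1, ‖h‖ₑ ^ 2 * ‖gradArr v (x - t • h)‖ₑ ^ 2 := by
        refine lintegral_mono_ae (ae_restrict_of_ae ?_)
        filter_upwards [ae_forall_ae_differentiableAt hv h] with x hx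
        exact enorm_sub_sq_le_lintegral_gradArr hv hx
    _ = ∫⁻ t in Ioc (0 : ℝ) 1, ∫⁻ x in S, ‖h‖ₑ ^ 2 * ‖gradArr v (x - t • h)‖ₑ ^ 2 := by
        refine lintegral_lintegral_swap (Measurable.aemeasurable ?_)
        have h2 : Measurable fun z : Eu d × ℝ => z.1 - z.2 • h := by fun_prop
        exact (hF.comp h2).const_mul _
    _ ≤ ∫⁻ _ in Ioc (0 : ℝ) 1, ‖h‖ₑ ^ 2 * ∫⁻ x in W, ‖gradArr v x‖ₑ ^ 2 := by
        refine setLIntegral_mono' measurableSet_Ioc fun t ht => ?_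
        rw [lintegral_const_mul']
        · refine mul_le_mul' le_rfl ?_
          rw [← (measurePreserving_sub_right volume (t • h)).setLIntegral_comp_preimage hW hF]
          exact lintegral_mono_set fun x hx => hSW x hx t ⟨ht.1.le, ht.2⟩
        · finiteness
    _ = _ := by simp

/-- A Poincaré-type relation: on `S₂`, Lipschitz functions are controlled in `L²` by their values on
`S₁` and their gradients on `O`. -/
def Linked {d : ℕ} (m : ℕ) (O S₁ S₂ : Set (Eu d)) : Prop :=
  ∃ C : ℝ≥0, ∀ (v : Eu d → Eu m) (K : ℝ≥0), LipschitzWith K v →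
    ∫⁻ x in S₂, ‖v x‖ₑ ^ 2 ≤ C * ((∫⁻ x in S₁, ‖v x‖ₑ ^ 2) + ∫⁻ x in O, ‖gradArr v x‖ₑ ^ 2)

namespace Linked

variable {d m : ℕ} {O S₁ S₂ S₃ : Set (Eu d)}

lemma trans (h : Linked m O S₁ S₂) (h' : Linked m O S₂ S₃) : Linked m O S₁ S₃ := by
  obtain ⟨C, hC⟩ := h
  obtain ⟨C', hC'⟩ := h'
  refine ⟨C' * (C + 1), fun v K hv => (hC' v K hv).trans ?_⟩
  push_cast
  rw [mul_assoc]
  refine mul_le_mul' le_rfl ?_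
  rw [add_mul, one_mul]
  exact add_le_add (hC v K hv) le_add_self

lemma of_superset (h : S₂ ⊆ S₁) : Linked m O S₁ S₂ :=
  ⟨1, fun v K hv => by
    rw [ENNReal.coe_one, one_mul]
    exact (lintegral_mono_set h).trans le_self_add⟩

/-- Write `v x` as `v (x - h)` plus an increment: the first lives on `S₁`, the second is an integral
of the gradient over a segment inside `O`. -/
lemma translate (h : Eu d) (hS₁ : MeasurableSet S₁) (hO : MeasurableSet O)
    (h₁ : ∀ x ∈ S₂, x - h ∈ S₁) (hx : ∀ x ∈ S₂, ∀ t ∈ Icc (0 : ℝ) 1, x - t • h ∈ O) :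
    Linked m O S₁ S₂ := by
  refine ⟨2 + 2 * ‖h‖₊ ^ 2, fun v K hv => ?_⟩
  have hm : Measurable fun x => ‖v x‖ₑ ^ 2 := hv.continuous.measurable.enorm.pow_const 2
  calc ∫⁻ x in S₂, ‖v x‖ₑ ^ 2
      ≤ ∫⁻ x in S₂, (2 * ‖v (x - h)‖ₑ ^ 2 + 2 * ‖v x - v (x - h)‖ₑ ^ 2) :=
        lintegral_mono fun x => enorm_sq_le_add_sub _ _
    _ = 2 * (∫⁻ x in S₂, ‖v (x - h)‖ₑ ^ 2) + 2 * ∫⁻ x in S₂, ‖v x - v (x - h)‖ₑ ^ 2 := by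
        rw [lintegral_add_left, lintegral_const_mul', lintegral_const_mul'] <;> try finiteness
        exact (hm.comp (measurable_sub_const h)).const_mul 2
    _ ≤ 2 * (∫⁻ x in S₁, ‖v x‖ₑ ^ 2) + 2 * (‖h‖ₑ ^ 2 * ∫⁻ x in O, ‖gradArr v x‖ₑ ^ 2) := by
        refine add_le_add (mul_le_mul' le_rfl ?_) (mul_le_mul' le_rfl ?_)
        · rw [← (measurePreserving_sub_right volume h).setLIntegral_comp_preimage hS₁ hm]
          exact lintegral_mono_set h₁
        · exact lintegral_sub_translate_le hv h hO hx
    _ ≤ _ := by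
        push_cast
        rw [add_mul, mul_assoc 2 (_ ^ 2), ← enorm_eq_nnnorm]
        exact add_le_add (mul_le_mul' le_rfl le_self_add)
          (mul_le_mul' le_rfl (mul_le_mul' le_rfl le_add_self))

end Linked

/-- After the substitution `y = x - h` and Tonelli, each `h` contributes a translation estimate
whose segments stay in the ball by convexity. Only `‖h‖ < 2 r` contributes, which gives the finite
volume factor. -/
lemma lintegral_lintegral_ball_sub_le {d m : ℕ} {v : Eu d → Eu m} {K : ℝ≥0}
    (hv : LipschitzWith K v) (p : Eu d) (r : ℝ) :
    ∫⁻ x in Metric.ball p r, ∫⁻ y in Metric.ball p r, ‖v x - v y‖ₑ ^ 2 ≤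
      volume (Metric.ball (0 : Eu d) (2 * r)) *
        (ENNReal.ofReal (2 * r) ^ 2 * ∫⁻ x in Metric.ball p r, ‖gradArr v x‖ₑ ^ 2) := by
  set B := Metric.ball p r with hB
  have hBm : MeasurableSet B := measurableSet_ball
  have hvm : Measurable v := hv.continuous.measurable
  have hm : Measurable fun z : Eu d × Eu d => B.indicator (fun _ => (1 : ℝ≥0∞)) (z.1 - z.2) *
      ‖v z.1 - v (z.1 - z.2)‖ₑ ^ 2 := by
    have h1 : Measurable (B.indicator (fun _ => (1 : ℝ≥0∞))) := measurable_const.indicator hBm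
    fun_prop
  calc _ = ∫⁻ x in B, ∫⁻ h, B.indicator (fun _ => (1 : ℝ≥0∞)) (x - h) *
          ‖v x - v (x - h)‖ₑ ^ 2 := by
        refine lintegral_congr fun x => ?_
        rw [lintegral_sub_left_eq_self (fun y => B.indicator (fun _ => (1 : ℝ≥0∞)) y *
          ‖v x - v y‖ₑ ^ 2) x, ← lintegral_indicator hBm]
        refine lintegral_congr fun y => ?_
        by_cases hy : y ∈ B <;> simp [hy]
    _ = ∫⁻ h, ∫⁻ x in B, B.indicator (fun _ => (1 : ℝ≥0∞)) (x - h) * ‖v x - v (x - h)‖ₑ ^ 2 :=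
        lintegral_lintegral_swap hm.aemeasurable
    _ ≤ ∫⁻ h, (Metric.ball (0 : Eu d) (2 * r)).indicator (fun _ =>
          ENNReal.ofReal (2 * r) ^ 2 * ∫⁻ x in B, ‖gradArr v x‖ₑ ^ 2) h := by
        refine lintegral_mono fun h => ?_
        have hSm : MeasurableSet (B ∩ {x | x - h ∈ B}) :=
          hBm.inter (measurable_sub_const h hBm)
        have h1 : ∫⁻ x in B, B.indicator (fun _ => (1 : ℝ≥0∞)) (x - h) * ‖v x - v (x - h)‖ₑ ^ 2
            = ∫⁻ x in B ∩ {x | x - h ∈ B}, ‖v x - v (x - h)‖ₑ ^ 2 := by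
          rw [← lintegral_indicator hSm, ← lintegral_indicator hBm]
          refine lintegral_congr fun x => ?_
          by_cases hx : x ∈ B <;> by_cases hy : x - h ∈ B <;> simp [hx, hy]
        rw [h1]
        by_cases hh : h ∈ Metric.ball (0 : Eu d) (2 * r)
        · rw [indicator_of_mem hh]
          refine (lintegral_sub_translate_le hv h hBm ?_).trans ?_
          · rintro x ⟨hx, hx'⟩ t ht
            have := (convex_ball p r) hx hx' (sub_nonneg.2 ht.2) ht.1 (sub_add_cancel _ _)
            convert this using 1
            module
          · gcongr
            rw [← ofReal_norm]
            exact ENNReal.ofReal_le_ofReal (by simpa using (mem_ball_zero_iff.1 hh).le)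
        · have : B ∩ {x | x - h ∈ B} = ∅ := by
            ext x
            simp only [mem_inter_iff, mem_ofPred_eq, mem_empty_iff_false, iff_false, not_and]
            intro hx hx'
            apply hh
            rw [mem_ball_zero_iff]
            have h2 : h = (x - p) - ((x - h) - p) := by abel
            rw [hB, mem_ball_iff_norm] at hx hx'
            rw [h2]
            linarith [norm_sub_le (x - p) ((x - h) - p)]
          rw [this]
          simp
    _ = _ := by
        rw [lintegral_indicator measurableSet_ball, setLIntegral_const, mul_comm]

/-- Integrate `|v x|² ≤ 2 |v y|² + 2 |v x - v y|²` over `x` in the ball and `y` in `S₁`, then divide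
by the volume of `S₁`. -/
lemma Linked.ball {d m : ℕ} {O S₁ : Set (Eu d)} {p : Eu d} {r : ℝ} (hO : Metric.ball p r ⊆ O)
    (hS₁ : S₁ ⊆ Metric.ball p r) (h0 : volume S₁ ≠ 0) : Linked m O S₁ (Metric.ball p r) := by
  set B := Metric.ball p r with hB
  have hBfin : volume B ≠ ∞ := measure_ball_lt_top.ne
  have hSfin : volume S₁ ≠ ∞ := ((measure_mono hS₁).trans_lt measure_ball_lt_top).ne
  set D := volume (Metric.ball (0 : Eu d) (2 * r)) * ENNReal.ofReal (2 * r) ^ 2 with hD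
  have hDfin : D ≠ ∞ := ENNReal.mul_ne_top measure_ball_lt_top.ne (by finiteness)
  have hCfin : (volume S₁)⁻¹ * (2 * volume B + 2 * D) ≠ ∞ :=
    ENNReal.mul_ne_top (ENNReal.inv_ne_top.2 h0) (by finiteness)
  refine ⟨((volume S₁)⁻¹ * (2 * volume B + 2 * D)).toNNReal, fun v K hv => ?_⟩
  rw [ENNReal.coe_toNNReal hCfin]
  have hm : Measurable fun x => ‖v x‖ₑ ^ 2 := hv.continuous.measurable.enorm.pow_const 2
  have hvm : Measurable v := hv.continuous.measurable
  have key : volume S₁ * ∫⁻ x in B, ‖v x‖ₑ ^ 2 ≤ (2 * volume B + 2 * D) *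
      ((∫⁻ x in S₁, ‖v x‖ₑ ^ 2) + ∫⁻ x in O, ‖gradArr v x‖ₑ ^ 2) := by
    calc _ = ∫⁻ x in B, ∫⁻ _ in S₁, ‖v x‖ₑ ^ 2 := by
          simp_rw [setLIntegral_const]
          rw [lintegral_mul_const' _ _ hSfin, mul_comm]
      _ ≤ ∫⁻ x in B, (2 * (∫⁻ y in S₁, ‖v y‖ₑ ^ 2) + 2 * ∫⁻ y in B, ‖v x - v y‖ₑ ^ 2) := by
          refine lintegral_mono fun x => ?_
          rw [← lintegral_const_mul' _ _ (by finiteness), ← lintegral_const_mul' _ _ (by finiteness)]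
          calc _ ≤ ∫⁻ y in S₁, (2 * ‖v y‖ₑ ^ 2 + 2 * ‖v x - v y‖ₑ ^ 2) :=
                lintegral_mono fun y => enorm_sq_le_add_sub _ _
            _ = _ := lintegral_add_left (hm.const_mul 2) _
            _ ≤ _ := add_le_add le_rfl (lintegral_mono_set hS₁)
      _ = 2 * (volume B * ∫⁻ y in S₁, ‖v y‖ₑ ^ 2) +
            2 * ∫⁻ x in B, ∫⁻ y in B, ‖v x - v y‖ₑ ^ 2 := by
          rw [lintegral_add_left (by fun_prop), lintegral_const_mul' 2 _ (by finiteness),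
            lintegral_const_mul' 2 _ (by finiteness), setLIntegral_const]
          ring
      _ ≤ 2 * (volume B * ∫⁻ y in S₁, ‖v y‖ₑ ^ 2) + 2 * (D * ∫⁻ x in O, ‖gradArr v x‖ₑ ^ 2) := by
          refine add_le_add le_rfl (mul_le_mul' le_rfl ?_)
          refine (lintegral_lintegral_ball_sub_le hv p r).trans ?_
          rw [← mul_assoc]
          exact mul_le_mul' le_rfl (lintegral_mono_set hO)
      _ ≤ _ := by
          rw [add_mul, mul_assoc 2 (volume B), mul_assoc 2 D]
          exact add_le_add (mul_le_mul' le_rfl (mul_le_mul' le_rfl le_self_add))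
            (mul_le_mul' le_rfl (mul_le_mul' le_rfl le_add_self))
  rw [mul_assoc, ← ENNReal.div_eq_inv_mul, ENNReal.le_div_iff_mul_le (Or.inl h0) (Or.inl hSfin),
    mul_comm]
  exact key

/-! ### Graph charts: flattening and reflection. -/

namespace GraphChart

variable {d : ℕ} (c : GraphChart d)

/-- The horizontal coordinate of a point. -/
def proj (x : Eu d) : Eu (d - 1) := (c.Φ.symm x).fst

/-- The height of a point above the graph. -/
def ht (x : Eu d) : ℝ := (c.Φ.symm x).snd - c.ψ (c.proj x)

/-- The upward unit vector of the chart. -/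
def up : Eu d := c.Φ.linearIsometryEquiv (WithLp.toLp 2 (0, 1))

/-- The reflection in the graph along the vertical direction. -/
def reflect (x : Eu d) : Eu d := c.pt (c.proj x) (c.ψ (c.proj x) - c.ht x)

@[simp] lemma proj_pt (x' : Eu (d - 1)) (z : ℝ) : c.proj (c.pt x' z) = x' := by
  simp [proj, pt]

@[simp] lemma ht_pt (x' : Eu (d - 1)) (z : ℝ) : c.ht (c.pt x' z) = z - c.ψ x' := by
  simp [ht, proj, pt]

lemma pt_proj (x : Eu d) : c.pt (c.proj x) (c.ψ (c.proj x) + c.ht x) = x := by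
  have : (WithLp.toLp 2 (c.proj x, c.ψ (c.proj x) + c.ht x) : LocalCoord d) = c.Φ.symm x := by
    refine (WithLp.ofLp_injective 2) (Prod.ext ?_ ?_) <;> simp [proj, ht]
  rw [pt, this, AffineIsometryEquiv.apply_symm_apply]

lemma dist_pt (a b : Eu (d - 1)) (z w : ℝ) :
    dist (c.pt a z) (c.pt b w) ^ 2 = dist a b ^ 2 + dist z w ^ 2 := by
  rw [pt, pt, AffineIsometryEquiv.dist_map, dist_eq_norm, WithLp.prod_norm_sq_eq_of_L2]
  simp [dist_eq_norm]

lemma dist_pt_le (a b : Eu (d - 1)) (z w : ℝ) :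
    dist (c.pt a z) (c.pt b w) ≤ dist a b + dist z w := by
  nlinarith [c.dist_pt a b z w, dist_nonneg (x := a) (y := b), dist_nonneg (x := z) (y := w),
    dist_nonneg (x := c.pt a z) (y := c.pt b w)]

lemma dist_proj_le (x y : Eu d) : dist (c.proj x) (c.proj y) ≤ dist x y := by
  have := c.dist_pt (c.proj x) (c.proj y) (c.ψ (c.proj x) + c.ht x) (c.ψ (c.proj y) + c.ht y)
  rw [pt_proj, pt_proj] at this
  exact abs_le_of_sq_le_sq' (by nlinarith) dist_nonneg |>.2

lemma dist_vert_le (x y : Eu d) :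
    |(c.ψ (c.proj x) + c.ht x) - (c.ψ (c.proj y) + c.ht y)| ≤ dist x y := by
  have := c.dist_pt (c.proj x) (c.proj y) (c.ψ (c.proj x) + c.ht x) (c.ψ (c.proj y) + c.ht y)
  rw [pt_proj, pt_proj, Real.dist_eq] at this
  exact abs_le_of_sq_le_sq (by
    rw [this, sq_abs]; linarith [sq_nonneg (dist (c.proj x) (c.proj y))]) dist_nonneg

lemma lipschitz_proj : LipschitzWith 1 c.proj :=
  LipschitzWith.of_dist_le_mul fun x y => by simpa using c.dist_proj_le x y

lemma lipschitz_ht {K : ℝ≥0} (h : LipschitzWith K c.ψ) : LipschitzWith (1 + K) c.ht := by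
  refine LipschitzWith.of_dist_le_mul fun x y => ?_
  have h1 := c.dist_vert_le x y
  have h2 := h.dist_le_mul (c.proj x) (c.proj y)
  have h3 : (K : ℝ) * dist (c.proj x) (c.proj y) ≤ K * dist x y := by
    gcongr; exact c.dist_proj_le x y
  rw [Real.dist_eq] at h2 ⊢
  push_cast
  rw [abs_le] at *
  constructor <;> linarith

@[simp] lemma proj_reflect (x : Eu d) : c.proj (c.reflect x) = c.proj x := by simp [reflect]

@[simp] lemma ht_reflect (x : Eu d) : c.ht (c.reflect x) = -c.ht x := by simp [reflect]

lemma dist_reflect (x : Eu d) : dist (c.reflect x) x = 2 * |c.ht x| := by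
  have := c.dist_pt (c.proj x) (c.proj x) (c.ψ (c.proj x) - c.ht x) (c.ψ (c.proj x) + c.ht x)
  rw [pt_proj, dist_self, Real.dist_eq, zero_pow two_ne_zero, zero_add, sq_abs] at this
  rw [← abs_of_nonneg (dist_nonneg (x := c.reflect x) (y := x)), ← abs_two, ← abs_mul]
  refine (sq_eq_sq_iff_abs_eq_abs _ _).1 ?_
  rw [reflect, this]; ring

lemma reflect_of_ht_eq_zero {x : Eu d} (h : c.ht x = 0) : c.reflect x = x := by
  rw [← dist_le_zero, dist_reflect, h]; simp

lemma lipschitz_reflect {K : ℝ≥0} (h : LipschitzWith K c.ψ) :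
    LipschitzWith (2 + 2 * K) c.reflect := by
  refine LipschitzWith.of_dist_le_mul fun x y => ?_
  refine (c.dist_pt_le _ _ _ _).trans ?_
  have h1 := c.dist_vert_le x y
  have h2 := h.dist_le_mul (c.proj x) (c.proj y)
  have h3 : (K : ℝ) * dist (c.proj x) (c.proj y) ≤ K * dist x y := by
    gcongr; exact c.dist_proj_le x y
  have h4 := c.dist_proj_le x y
  have h5 : dist (c.ψ (c.proj x) - c.ht x) (c.ψ (c.proj y) - c.ht y) ≤ (1 + 2 * K) * dist x y := by
    rw [Real.dist_eq] at h2 ⊢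
    rw [abs_le] at *
    constructor <;> linarith
  push_cast
  linarith

lemma add_smul_up (x : Eu d) (s : ℝ) :
    x + s • c.up = c.pt (c.proj x) (c.ψ (c.proj x) + c.ht x + s) := by
  conv_lhs => rw [← c.pt_proj x]
  have h : (WithLp.toLp 2 (c.proj x, c.ψ (c.proj x) + c.ht x + s) : LocalCoord d) =
      s • WithLp.toLp 2 ((0 : Eu (d - 1)), (1 : ℝ)) +ᵥ
        WithLp.toLp 2 (c.proj x, c.ψ (c.proj x) + c.ht x) := by
    refine (WithLp.ofLp_injective 2) (Prod.ext ?_ ?_) <;> simp [add_comm]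
  rw [pt, pt, h, AffineIsometryEquiv.map_vadd, map_smul, add_comm]
  rfl

@[simp] lemma ht_add_smul_up (x : Eu d) (s : ℝ) : c.ht (x + s • c.up) = c.ht x + s := by
  rw [add_smul_up, ht_pt]; ring

lemma norm_up : ‖c.up‖ = 1 := by
  rw [up, LinearIsometryEquiv.norm_map]
  simp

lemma measurePreserving_symm [NeZero d] : MeasurePreserving c.Φ.symm := by
  have h : (c.Φ.symm : Eu d → LocalCoord d) =
      (fun y => y + c.Φ.symm 0) ∘ c.Φ.symm.linearIsometryEquiv := by
    ext x : 1
    have := c.Φ.symm.map_vadd 0 x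
    simpa using this
  rw [h]
  exact (measurePreserving_add_right volume _).comp
    (LinearIsometryEquiv.measurePreserving _)

/-- The coordinates in which the graph is flat. -/
def flat (x : Eu d) : Eu (d - 1) × ℝ := (c.proj x, c.ht x)

/-- Flattening is a rigid motion followed by the shear `(a, t) ↦ (a, t - ψ a)`, which translates
each vertical line. -/
lemma measurePreserving_flat [NeZero d] (hψ : Measurable c.ψ) : MeasurePreserving c.flat := by
  have h1 : MeasurePreserving (fun p : Eu (d - 1) × ℝ => (p.1, p.2 - c.ψ p.1)) :=
    (MeasurePreserving.id volume).skew_product (g := fun a t => t - c.ψ a)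
      (measurable_snd.sub (hψ.comp measurable_fst))
      (Eventually.of_forall fun a => (measurePreserving_sub_right volume (c.ψ a)).map_eq)
  exact h1.comp ((WithLp.volume_preserving_ofLp (Eu (d - 1)) ℝ).comp c.measurePreserving_symm)

/-- Conjugation by `flat` turns the reflection into `(a, t) ↦ (a, -t)`. As `flat` is an injective
measurable embedding, equality of the images of the two measures under `flat` can be pulled back. -/
lemma measurePreserving_reflect [NeZero d] {K : ℝ≥0} (h : LipschitzWith K c.ψ) :
    MeasurePreserving c.reflect := by
  have hf := c.measurePreserving_flat h.continuous.measurable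
  have hcont : Continuous c.reflect := (c.lipschitz_reflect h).continuous
  have h1 : MeasurePreserving (fun p : Eu (d - 1) × ℝ => (p.1, -p.2)) :=
    (MeasurePreserving.id volume).prod (Measure.measurePreserving_neg volume)
  have hinj : Function.Injective c.flat := fun x y hxy => by
    rw [flat, flat, Prod.mk.injEq] at hxy
    rw [← c.pt_proj x, ← c.pt_proj y, hxy.1, hxy.2]
  have hcomp : c.flat ∘ c.reflect = (fun p : Eu (d - 1) × ℝ => (p.1, -p.2)) ∘ c.flat := by
    ext x : 1; simp [flat]
  have hflat : MeasurableEmbedding c.flat := by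
    have hc : Continuous c.flat :=
      c.lipschitz_proj.continuous.prodMk (c.lipschitz_ht h).continuous
    exact hc.measurableEmbedding hinj
  refine ⟨hcont.measurable, ?_⟩
  have hmap : Measure.map c.flat (Measure.map c.reflect volume) = Measure.map c.flat volume := by
    rw [Measure.map_map hflat.measurable hcont.measurable, hcomp, (h1.comp hf).map_eq, hf.map_eq]
  ext s hs
  have := congrArg (fun μ => μ (c.flat '' s)) hmap
  simp only [hflat.map_apply, preimage_image_eq _ hinj] at this
  exact this

lemma volume_ht_eq_zero [NeZero d] (hψ : Measurable c.ψ) : volume {x | c.ht x = 0} = 0 := by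
  have hf := c.measurePreserving_flat hψ
  have : {x | c.ht x = 0} = c.flat ⁻¹' (univ ×ˢ {0}) := by ext x; simp [flat]
  rw [this, hf.measure_preimage (MeasurableSet.univ.prod (measurableSet_singleton 0)).nullMeasurableSet,
    Measure.volume_eq_prod, Measure.prod_prod]
  simp

lemma mem_cyl {M r : ℝ} {x : Eu d} :
    x ∈ c.cyl M r ↔ ‖c.proj x‖ < r ∧ 0 < c.ht x ∧ c.ht x < M * r := by
  constructor
  · rintro ⟨x', z, h1, h2, h3, rfl⟩
    rw [proj_pt, ht_pt]
    exact ⟨h1, h2, h3⟩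
  · rintro ⟨h1, h2, h3⟩
    exact ⟨c.proj x, c.ψ (c.proj x) + c.ht x, h1, by simpa using h2, by simpa using h3,
      (c.pt_proj x).symm⟩

lemma mem_base {r : ℝ} {x : Eu d} : x ∈ c.base r ↔ ‖c.proj x‖ < r ∧ c.ht x = 0 := by
  constructor
  · rintro ⟨x', h1, rfl⟩
    simpa [graphPt] using h1
  · rintro ⟨h1, h2⟩
    refine ⟨c.proj x, by simpa using h1, ?_⟩
    have := c.pt_proj x
    rwa [h2, add_zero] at this

lemma cyl_eq_preimage (M r : ℝ) :
    c.cyl M r = c.flat ⁻¹' (Metric.ball 0 r ×ˢ Ioo 0 (M * r)) := by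
  ext x; rw [mem_cyl]; simp [flat]

lemma isOpen_cyl {K : ℝ≥0} (h : LipschitzWith K c.ψ) (M r : ℝ) : IsOpen (c.cyl M r) := by
  rw [cyl_eq_preimage]
  exact (Metric.isOpen_ball.prod isOpen_Ioo).preimage
    (c.lipschitz_proj.continuous.prodMk (c.lipschitz_ht h).continuous)

lemma volume_cyl [NeZero d] (hψ : Measurable c.ψ) (M r : ℝ) :
    volume (c.cyl M r) = volume (Metric.ball (0 : Eu (d - 1)) r) * ENNReal.ofReal (M * r) := by
  rw [cyl_eq_preimage, (c.measurePreserving_flat hψ).measure_preimage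
    (measurableSet_ball.prod measurableSet_Ioo).nullMeasurableSet, Measure.volume_eq_prod,
    Measure.prod_prod]
  simp

end GraphChart

/-! ### Lipschitz domains: charts, reflections, extension from the collar. -/

/-- Local charts of a Lipschitz domain, in terms of the height above the graph. -/
lemma IsLipschitzDomain.exists_chart {d : ℕ} {Ω : Set (Eu d)} (hΩ : IsLipschitzDomain Ω)
    {x₀ : Eu d} (hx₀ : x₀ ∈ frontier Ω) :
    ∃ (c : GraphChart d) (K : ℝ≥0), LipschitzWith K c.ψ ∧ c.ht x₀ = 0 ∧
      ∃ ρ > 0, ∀ x ∈ Metric.ball x₀ ρ, (x ∈ Ω ↔ 0 < c.ht x) ∧ (x ∈ closure Ω ↔ 0 ≤ c.ht x) := by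
  obtain ⟨c, hc0, ⟨K, hK⟩, r, hr, h, hh, hloc⟩ := hΩ.boundary x₀ hx₀
  have hx0 : x₀ = c.pt 0 0 := by rw [← hc0]; rfl
  have hp0 : c.proj x₀ = 0 := by rw [hx0]; simp
  have hh0 : c.ht x₀ = 0 := by rw [hx0]; simp [c.ψ_zero]
  have hcp : Continuous c.proj := c.lipschitz_proj.continuous
  have hch : Continuous c.ht := (c.lipschitz_ht hK).continuous
  have hNo : IsOpen {x | ‖c.proj x‖ < r ∧ |c.ht x| < h} :=
    (isOpen_lt hcp.norm continuous_const).inter (isOpen_lt hch.abs continuous_const)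
  obtain ⟨ρ, hρ, hball⟩ := Metric.isOpen_iff.1 hNo x₀ ⟨by simpa [hp0], by simpa [hh0]⟩
  have hN : ∀ x, ‖c.proj x‖ < r ∧ |c.ht x| < h → (x ∈ Ω ↔ 0 < c.ht x) := by
    intro x hx
    have := hloc (c.proj x) (c.ψ (c.proj x) + c.ht x) hx.1 (by simpa using hx.2)
    rw [c.pt_proj] at this
    rw [this]; simp
  refine ⟨c, K, hK, hh0, ρ, hρ, fun x hx => ⟨hN x (hball hx), ?_, ?_⟩⟩
  · intro hcl
    by_contra! hneg
    obtain ⟨y, ⟨hy1, hy2⟩, hy3⟩ := mem_closure_iff.1 hcl _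
      (hNo.inter (isOpen_lt hch continuous_const)) ⟨hball hx, hneg⟩
    exact absurd ((hN y hy1).1 hy3) (not_lt.2 (le_of_lt hy2))
  -- Points on the graph are limits of points strictly above it, obtained by moving along `up`.
  · intro hnn
    have hcont : Continuous fun s : ℝ => x + s • c.up := by fun_prop
    have ht : Tendsto (fun s : ℝ => x + s • c.up) (𝓝[>] 0) (𝓝 x) := by
      simpa using (hcont.tendsto 0).mono_left (nhdsWithin_le_nhds (s := Ioi 0))
    refine mem_closure_of_tendsto ht ?_
    filter_upwards [ht.eventually (hNo.mem_nhds (hball hx)), self_mem_nhdsWithin] with s hs hs0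
    rw [hN _ hs, c.ht_add_smul_up]
    exact add_pos_of_nonneg_of_pos hnn hs0

/-- Locally the frontier lies in the graph `{ht = 0}`, which becomes a hyperplane in flat
coordinates. -/
lemma IsLipschitzDomain.volume_frontier {d : ℕ} [NeZero d] {Ω : Set (Eu d)}
    (hΩ : IsLipschitzDomain Ω) : volume (frontier Ω) = 0 := by
  refine measure_null_of_locally_null _ fun x hx => ?_
  obtain ⟨c, K, hK, -, ρ, hρ, hloc⟩ := hΩ.exists_chart hx
  refine ⟨frontier Ω ∩ Metric.ball x ρ,
    inter_mem self_mem_nhdsWithin (mem_nhdsWithin_of_mem_nhds (Metric.ball_mem_nhds x hρ)), ?_⟩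
  refine measure_mono_null ?_ (c.volume_ht_eq_zero hK.continuous.measurable)
  rintro y ⟨hy, hyb⟩
  rw [hΩ.isOpen.frontier_eq] at hy
  have h1 := ((hloc y hyb).2).1 hy.1
  have h2 := mt ((hloc y hyb).1).2 hy.2
  exact le_antisymm (not_lt.1 h2) h1

/-- The part of the `r`-neighbourhood of `ω` outside the closure of `ω`. -/
def collar {d : ℕ} (ω : Set (Eu d)) (r : ℝ) : Set (Eu d) := Metric.thickening r ω \ closure ω

lemma measurableSet_collar {d : ℕ} (ω : Set (Eu d)) (r : ℝ) : MeasurableSet (collar ω r) :=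
  Metric.isOpen_thickening.measurableSet.diff isClosed_closure.measurableSet

/-- Local reflections in the frontier of a Lipschitz domain. -/
lemma IsLipschitzDomain.exists_reflection {d : ℕ} [NeZero d] {ω : Set (Eu d)}
    (hω : IsLipschitzDomain ω) {p : Eu d} (hp : p ∈ frontier ω) {r : ℝ} (hr : 0 < r) :
    ∃ (S : Eu d → Eu d) (L : ℝ≥0), LipschitzWith L S ∧ MeasurePreserving S ∧
      ∃ σ > 0, ∀ x ∈ Metric.ball p σ, (x ∈ frontier ω → S x = x) ∧
        (x ∈ ω → S x ∉ closure ω ∧ dist (S x) x < r) := by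
  obtain ⟨c, K, hK, hp0, ρ, hρ, hloc⟩ := hω.exists_chart hp
  -- The reflection moves `x` by `2 |ht x| ≤ 2 (1 + K) dist x p`, so its image is within `(3 + 2 K)
  -- dist x p` of `p`. The denominator `4 + 2 K` keeps this below `ρ`, where the chart is valid, and
  -- the displacement below `r`.
  refine ⟨c.reflect, _, c.lipschitz_reflect hK, c.measurePreserving_reflect hK,
    min ρ r / (4 + 2 * K), by positivity, fun x hx => ?_⟩
  rw [Metric.mem_ball, lt_div_iff₀ (by positivity)] at hx
  have hm1 := min_le_left ρ r
  have hm2 := min_le_right ρ r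
  have hht : |c.ht x| ≤ (1 + K) * dist x p := by
    have := (c.lipschitz_ht hK).dist_le_mul x p
    rwa [hp0, dist_zero_right, Real.norm_eq_abs] at this
  have hd := c.dist_reflect x
  have hdist := dist_nonneg (x := x) (y := p)
  have hKd : 0 ≤ (K : ℝ) * dist x p := by positivity
  have hxρ : x ∈ Metric.ball p ρ := Metric.mem_ball.2 (by nlinarith)
  have hSρ : c.reflect x ∈ Metric.ball p ρ :=
    Metric.mem_ball.2 (by nlinarith [dist_triangle (c.reflect x) x p])
  refine ⟨fun hxf => ?_, fun hxω => ⟨fun hcl => ?_, by nlinarith⟩⟩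
  · rw [hω.isOpen.frontier_eq] at hxf
    refine c.reflect_of_ht_eq_zero (le_antisymm ?_ (((hloc x hxρ).2).1 hxf.1))
    exact not_lt.1 (mt ((hloc x hxρ).1).2 hxf.2)
  · have h1 := ((hloc _ hSρ).2).1 hcl
    rw [c.ht_reflect] at h1
    linarith [((hloc x hxρ).1).1 hxω]

lemma enorm_sum_sq_le {ι F : Type*} [NormedAddCommGroup F] (s : Finset ι) (a : ι → F) :
    ‖∑ k ∈ s, a k‖ₑ ^ 2 ≤ s.card * ∑ k ∈ s, ‖a k‖ₑ ^ 2 := by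
  have h : ‖∑ k ∈ s, a k‖ ^ 2 ≤ s.card * ∑ k ∈ s, ‖a k‖ ^ 2 := by
    refine le_trans ?_ sq_sum_le_card_mul_sum_sq
    gcongr
    exact norm_sum_le _ _
  have h' := ENNReal.ofReal_le_ofReal h
  rw [ENNReal.ofReal_mul (by positivity), ENNReal.ofReal_sum_of_nonneg (fun _ _ => by positivity),
    ENNReal.ofReal_pow (norm_nonneg _), ofReal_norm, ENNReal.ofReal_natCast] at h'
  refine h'.trans_eq ?_
  congr 1
  refine Finset.sum_congr rfl fun k _ => ?_
  rw [ENNReal.ofReal_pow (norm_nonneg _), ofReal_norm]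

lemma enorm_sq_le_of_norm_le {F G H : Type*} [NormedAddCommGroup F] [NormedAddCommGroup G]
    [NormedAddCommGroup H] {M : ℝ≥0} {a : F} {b : G} {c : H} (h : ‖a‖ ≤ M * (‖b‖ + ‖c‖)) :
    ‖a‖ₑ ^ 2 ≤ 2 * M ^ 2 * (‖b‖ₑ ^ 2 + ‖c‖ₑ ^ 2) := by
  have h1 : ‖a‖ ^ 2 ≤ 2 * M ^ 2 * (‖b‖ ^ 2 + ‖c‖ ^ 2) := by
    calc ‖a‖ ^ 2 ≤ (M * (‖b‖ + ‖c‖)) ^ 2 := by gcongr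
      _ ≤ 2 * M ^ 2 * (‖b‖ ^ 2 + ‖c‖ ^ 2) := by
        nlinarith [mul_nonneg (sq_nonneg (M : ℝ)) (sq_nonneg (‖b‖ - ‖c‖))]
  have h' := ENNReal.ofReal_le_ofReal h1
  rw [ENNReal.ofReal_mul (by positivity), ENNReal.ofReal_mul (by positivity),
    ENNReal.ofReal_add (by positivity) (by positivity)] at h'
  simpa [ENNReal.ofReal_pow] using h'

/-- The pullback of a Lipschitz function by a Lipschitz measure preserving map, cut off. -/
lemma ae_cutoff_comp_le {d m : ℕ} {η : Eu d → ℝ} {a L : ℝ≥0} (hη : LipschitzWith a η)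
    (hη1 : ∀ x, |η x| ≤ 1) {B : Set (Eu d)} (hB : tsupport η ⊆ B) {S : Eu d → Eu d}
    (hS : LipschitzWith L S) (hSm : MeasurePreserving S) {w : Eu d → Eu m} {K : ℝ≥0}
    (hw : LipschitzWith K w) :
    ∀ᵐ x, DifferentiableAt ℝ (fun y => η y • w (S y)) x ∧
      ‖η x • w (S x)‖ₑ ^ 2 + ‖gradArr (fun y => η y • w (S y)) x‖ₑ ^ 2 ≤
      B.indicator (fun x => ((2 * (1 + NNReal.sqrt d * (a + L)) ^ 2 + 1 : ℝ≥0) : ℝ≥0∞) *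
        (‖w (S x)‖ₑ ^ 2 + ‖gradArr w (S x)‖ₑ ^ 2)) x := by
  -- Measure preservation is what gives the chain rule almost everywhere: preimages under `S` of the
  -- null set where `w` fails to be differentiable are null.
  filter_upwards [hη.ae_differentiableAt, hS.ae_differentiableAt,
    hSm.quasiMeasurePreserving.ae hw.ae_differentiableAt] with x h1 h2 h3
  have h4 : DifferentiableAt ℝ (fun y => w (S y)) x := h3.comp x h2
  refine ⟨h1.smul h4, ?_⟩
  by_cases hx : x ∈ tsupport η
  · rw [indicator_of_mem (hB hx)]
    have e1 : ‖η x • w (S x)‖ₑ ^ 2 ≤ ‖w (S x)‖ₑ ^ 2 := by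
      gcongr
      rw [← ofReal_norm, ← ofReal_norm, norm_smul]
      refine ENNReal.ofReal_le_ofReal (mul_le_of_le_one_left (norm_nonneg _) (hη1 x))
    have e2 : ‖gradArr (fun y => η y • w (S y)) x‖ ≤ (1 + NNReal.sqrt d * (a + L) : ℝ≥0) *
        (‖w (S x)‖ + ‖gradArr w (S x)‖) := by
      rw [gradArr_smul h1 h4]
      have hc : fderiv ℝ (fun y => w (S y)) x = (fderiv ℝ w (S x)).comp (fderiv ℝ S x) :=
        fderiv_comp x h3 h2
      have n1 : ‖gradArr (fun y => w (S y)) x‖ ≤ Real.sqrt d * (‖gradArr w (S x)‖ * L) := by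
        rw [gradArr_eq, hc]
        refine (norm_arrL_le _).trans ?_
        gcongr
        refine (ContinuousLinearMap.opNorm_comp_le _ _).trans ?_
        gcongr
        · exact norm_le_arrL _
        · exact norm_fderiv_le_of_lipschitz ℝ hS
      have n2 : ‖tensArr (fderiv ℝ η x) (w (S x))‖ ≤ Real.sqrt d * a * ‖w (S x)‖ := by
        refine (norm_tensArr_le _ _).trans ?_
        gcongr
        exact norm_fderiv_le_of_lipschitz ℝ hη
      have n3 : ‖η x • gradArr (fun y => w (S y)) x‖ ≤ ‖gradArr (fun y => w (S y)) x‖ := by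
        rw [norm_smul]
        exact mul_le_of_le_one_left (norm_nonneg _) (hη1 x)
      refine (norm_add_le _ _).trans ?_
      push_cast
      have p1 : 0 ≤ Real.sqrt d * a * ‖gradArr w (S x)‖ := by positivity
      have p2 : 0 ≤ Real.sqrt d * L * ‖w (S x)‖ := by positivity
      nlinarith [norm_nonneg (w (S x)), norm_nonneg (gradArr w (S x))]
    refine (add_le_add e1 (enorm_sq_le_of_norm_le e2)).trans ?_
    push_cast
    rw [add_mul _ (1 : ℝ≥0∞), one_mul, add_comm]
    gcongr
    exact le_self_add
  · have h0 : (fun y => η y • w (S y)) =ᶠ[𝓝 x] fun _ => 0 := by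
      filter_upwards [notMem_tsupport_iff_eventuallyEq.1 hx] with y hy
      simp [hy]
    rw [gradArr_zero h0, h0.eq_of_nhds]
    simp

/-- A Lipschitz partition of unity on a compact set, subordinate to a cover by balls. -/
lemma exists_lipschitz_partition {d : ℕ} {F : Set (Eu d)} (hF : IsCompact F)
    {σ : Eu d → ℝ} (hσ : ∀ p ∈ F, 0 < σ p) :
    ∃ (t : Finset (Eu d)) (η : t → Eu d → ℝ), (∀ p ∈ t, p ∈ F) ∧
      (∀ k, ∃ a : ℝ≥0, LipschitzWith a (η k)) ∧ (∀ k x, |η k x| ≤ 1) ∧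
      (∀ k : t, tsupport (η k) ⊆ Metric.ball k (σ k)) ∧ ∀ x ∈ F, ∑ k, η k x = 1 := by
  obtain ⟨t, htF, hcov⟩ := hF.elim_nhds_subcover (fun p => Metric.ball p (σ p))
    (fun p hp => Metric.ball_mem_nhds p (hσ p hp))
  obtain ⟨f, hf⟩ := SmoothPartitionOfUnity.exists_isSubordinate (modelWithCornersSelf ℝ (Eu d))
    hF.isClosed (fun k : t => Metric.ball (k : Eu d) (σ k)) (fun _ => Metric.isOpen_ball) (by
      intro x hx
      obtain ⟨p, hp, hxp⟩ := mem_iUnion₂.1 (hcov hx)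
      exact mem_iUnion.2 ⟨⟨p, hp⟩, hxp⟩)
  refine ⟨t, fun k x => f k x, htF, fun k => ?_, fun k x => ?_, hf, fun x hx => ?_⟩
  · have hc : HasCompactSupport (fun x => f k x) :=
      (isCompact_closedBall (k : Eu d) (σ k)).of_isClosed_subset (isClosed_tsupport _)
        ((hf k).trans Metric.ball_subset_closedBall)
    exact ContDiff.lipschitzWith_of_hasCompactSupport hc (f k).contMDiff.contDiff (by simp)
  · rw [abs_of_nonneg (f.nonneg k x)]
    exact f.le_one k x
  · rw [← finsum_eq_sum_of_fintype]
    exact f.sum_eq_one hx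

/-- Extension of a Lipschitz function from the collar into a Lipschitz domain by local reflections,
with bounds that are local up to distance `r`. -/
theorem IsLipschitzDomain.exists_extension {d : ℕ} [NeZero d] (m : ℕ) {ω : Set (Eu d)}
    (hω : IsLipschitzDomain ω) (hb : Bornology.IsBounded ω) {r : ℝ} (hr : 0 < r) :
    ∃ C : ℝ≥0, ∀ (w : Eu d → Eu m) (K : ℝ≥0), LipschitzWith K w →
      ∃ E : Eu d → Eu m, (∃ K', LipschitzWith K' E) ∧ (∀ x ∈ frontier ω, E x = w x) ∧
        ∀ P : Set (Eu d), MeasurableSet P →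
          ∫⁻ x in ω ∩ P, (‖E x‖ₑ ^ 2 + ‖gradArr E x‖ₑ ^ 2) ≤
            C * ∫⁻ x in collar ω r ∩ Metric.thickening r P, (‖w x‖ₑ ^ 2 + ‖gradArr w x‖ₑ ^ 2) := by
  classical
  have hF : IsCompact (frontier ω) :=
    Metric.isCompact_of_isClosed_isBounded isClosed_frontier
      (hb.closure.subset frontier_subset_closure)
  have hex : ∀ p : Eu d, ∃ (S : Eu d → Eu d) (L : ℝ≥0) (σ : ℝ), p ∈ frontier ω →
      LipschitzWith L S ∧ MeasurePreserving S ∧ 0 < σ ∧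
      ∀ x ∈ Metric.ball p σ, (x ∈ frontier ω → S x = x) ∧
        (x ∈ ω → S x ∉ closure ω ∧ dist (S x) x < r) := by
    intro p
    by_cases hp : p ∈ frontier ω
    · obtain ⟨S, L, h1, h2, σ, h3, h4⟩ := hω.exists_reflection hp hr
      exact ⟨S, L, σ, fun _ => ⟨h1, h2, h3, h4⟩⟩
    · exact ⟨id, 0, 0, fun h => absurd h hp⟩
  choose S L σ hS using hex
  obtain ⟨t, η, htF, hηL, hη1, hηs, hsum⟩ :=
    exists_lipschitz_partition hF (fun p hp => (hS p hp).2.2.1)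
  choose a ha using hηL
  have hSk : ∀ k : t, _ := fun k => hS k (htF k k.2)
  set M : t → ℝ≥0 := fun k => 2 * (1 + NNReal.sqrt d * (a k + L k)) ^ 2 + 1 with hM
  refine ⟨t.card * ∑ k, M k, fun w K hw => ?_⟩
  have hterm : ∀ k : t, ∃ K', LipschitzWith K' fun x => η k x • w (S k x) := fun k =>
    (ha k).exists_smul_of_bounded (hw.comp (hSk k).1) Metric.isBounded_ball
      (fun x hx => image_eq_zero_of_notMem_tsupport fun h => hx (hηs k h))
  choose K' hK' using hterm
  refine ⟨fun x => ∑ k, η k x • w (S k x), ⟨∑ k, K' k, ?_⟩, fun x hx => ?_, fun P hP => ?_⟩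
  · refine LipschitzWith.of_dist_le_mul fun x y => ?_
    refine (dist_sum_sum_le _ _ _).trans ?_
    push_cast
    rw [Finset.sum_mul]
    exact Finset.sum_le_sum fun k _ => (hK' k).dist_le_mul x y
  -- Each reflection fixes the frontier points in its ball, so on the frontier the sum collapses to
  -- `w` times the partition of unity.
  · have : ∀ k : t, η k x • w (S k x) = η k x • w x := fun k => by
      by_cases hk : x ∈ Metric.ball (k : Eu d) (σ k)
      · rw [((hSk k).2.2.2 x hk).1 hx]
      · rw [image_eq_zero_of_notMem_tsupport fun h => hk (hηs k h), zero_smul, zero_smul]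
    simp only [this]
    rw [← Finset.sum_smul, hsum x hx, one_smul]
  · set Q := collar ω r ∩ Metric.thickening r P with hQ
    have hQm : MeasurableSet Q :=
      (measurableSet_collar ω r).inter Metric.isOpen_thickening.measurableSet
    have hωP : MeasurableSet (ω ∩ P) := hω.isOpen.measurableSet.inter hP
    set g : Eu d → ℝ≥0∞ := fun x => ‖w x‖ₑ ^ 2 + ‖gradArr w x‖ₑ ^ 2 with hg
    have hgm : Measurable g := (hw.continuous.measurable.enorm.pow_const 2).add
      ((measurable_gradArr w).enorm.pow_const 2)
    have hall := ae_all_iff.2 fun k : t =>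
      ae_cutoff_comp_le (ha k) (hη1 k) (hηs k) (hSk k).1 (hSk k).2.1 hw
    have hQi : ∀ k : t, Measurable (Q.indicator g ∘ S k) := fun k =>
      (hgm.indicator hQm).comp (hSk k).2.1.measurable
    calc ∫⁻ x in ω ∩ P, (‖∑ k, η k x • w (S k x)‖ₑ ^ 2 +
            ‖gradArr (fun x => ∑ k, η k x • w (S k x)) x‖ₑ ^ 2)
        ≤ ∫⁻ x in ω ∩ P, t.card * ∑ k : t, M k * (Q.indicator g ∘ S k) x := by
          refine lintegral_mono_ae ?_
          filter_upwards [ae_restrict_of_ae hall, ae_restrict_mem hωP] with x hx hxP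
          have hgr : gradArr (fun x => ∑ k, η k x • w (S k x)) x =
              ∑ k, gradArr (fun x => η k x • w (S k x)) x := by
            rw [gradArr_eq, fderiv_fun_sum (fun k _ => (hx k).1), map_sum]
            rfl
          rw [hgr]
          refine (add_le_add (enorm_sum_sq_le _ _) (enorm_sum_sq_le _ _)).trans ?_
          rw [← mul_add, ← Finset.sum_add_distrib, Finset.card_univ, Fintype.card_coe]
          gcongr with k _
          refine (hx k).2.trans ?_
          by_cases hk : x ∈ Metric.ball (k : Eu d) (σ k)
          · rw [indicator_of_mem hk]
            have h1 := ((hSk k).2.2.2 x hk).2 hxP.1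
            -- The reflection sends `x ∈ ω ∩ P` out of the closure of `ω` and moves it by less than
            -- `r`. This keeps the bound local with respect to `P`, which the cutoff version of the
            -- cell estimate depends on.
            have hSQ : S k x ∈ Q := by
              refine ⟨⟨Metric.mem_thickening_iff.2 ⟨x, hxP.1, h1.2⟩, h1.1⟩,
                Metric.mem_thickening_iff.2 ⟨x, hxP.2, h1.2⟩⟩
            rw [Function.comp_apply, indicator_of_mem hSQ]
          · rw [indicator_of_notMem hk]; exact zero_le
      _ ≤ ∫⁻ x, t.card * ∑ k : t, M k * (Q.indicator g ∘ S k) x := setLIntegral_le_lintegral _ _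
      _ = t.card * ∑ k : t, M k * ∫⁻ x, (Q.indicator g ∘ S k) x := by
          rw [lintegral_const_mul' _ _ (by finiteness),
            lintegral_finsetSum _ (fun k _ => (hQi k).const_mul _)]
          congr 1
          refine Finset.sum_congr rfl fun k _ => ?_
          rw [lintegral_const_mul' _ _ (by finiteness)]
      _ = t.card * ∑ k : t, M k * ∫⁻ x in Q, g x := by
          congr 1
          refine Finset.sum_congr rfl fun k _ => ?_
          rw [← lintegral_indicator hQm]
          congr 1
          exact (hSk k).2.1.lintegral_comp (hgm.indicator hQm)
      _ = _ := by
          rw [← Finset.sum_mul]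
          push_cast
          rw [mul_assoc]

/-! ### The Poincaré inequality on the outer collar. -/

/-- The set is open, and moving slightly down from `p` along the chart lands in it. -/
lemma IsLipschitzDomain.volume_ball_diff_ne_zero {d : ℕ} {ω : Set (Eu d)}
    (hω : IsLipschitzDomain ω) {p : Eu d} (hp : p ∈ frontier ω) {τ : ℝ} (hτ : 0 < τ) :
    volume (Metric.ball p τ \ closure ω) ≠ 0 := by
  obtain ⟨c, K, hK, hp0, ρ, hρ, hloc⟩ := hω.exists_chart hp
  have ho : IsOpen (Metric.ball p τ \ closure ω) := Metric.isOpen_ball.sdiff isClosed_closure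
  refine (ho.measure_pos volume ?_).ne'
  set s := min τ ρ / 2 with hs
  have hs0 : 0 < s := by positivity
  have hdist : dist (p + (-s) • c.up) p = s := by
    rw [dist_eq_norm, add_sub_cancel_left, norm_smul, c.norm_up, mul_one, norm_neg,
      Real.norm_of_nonneg hs0.le]
  have h1 := min_le_left τ ρ
  have h2 := min_le_right τ ρ
  refine ⟨p + (-s) • c.up, Metric.mem_ball.2 (by rw [hdist]; linarith), fun hcl => ?_⟩
  have := ((hloc _ (Metric.mem_ball.2 (by rw [hdist]; linarith))).2).1 hcl
  rw [c.ht_add_smul_up, hp0] at this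
  linarith

/-- The local Poincaré inequality on the outer side of a frontier point. -/
lemma IsLipschitzDomain.exists_linked {d : ℕ} (m : ℕ) {ω : Set (Eu d)}
    (hω : IsLipschitzDomain ω) {p : Eu d} (hp : p ∈ frontier ω) {r : ℝ} (hr : 0 < r) :
    ∃ σ > 0, (∀ S₁, MeasurableSet S₁ → S₁ ⊆ Metric.ball p σ \ closure ω → volume S₁ ≠ 0 →
      Linked m (collar ω r) S₁ (Metric.ball p σ \ closure ω)) ∧
      ∃ b, Metric.ball b σ ⊆ collar ω r ∧
        Linked m (collar ω r) (Metric.ball b σ) (Metric.ball p σ \ closure ω) := by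
  obtain ⟨c, K, hK, hp0, ρ, hρ, hloc⟩ := hω.exists_chart hp
  -- With `s = (1 + K) σ` below, every point used is within `σ + s = (2 + K) σ < min ρ r` of `p`,
  -- hence in the range of the chart and in the `r`-neighbourhood of `ω`.
  set σ := min ρ r / (3 + K) with hσ
  have hσ0 : 0 < σ := by positivity
  have hm1 := min_le_left ρ r
  have hm2 := min_le_right ρ r
  have hσm : σ * (3 + K) = min ρ r := by rw [hσ]; field_simp
  -- Since `ht` has Lipschitz constant `1 + K`, lowering `p` by `s` makes `ht` negative on the whole
  -- ball of radius `σ` around the new centre `b`.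
  set s := (1 + K) * σ with hs
  have hK0 : (0 : ℝ) ≤ K := K.2
  have hs0 : 0 < s := by positivity
  have hO : ∀ y, dist y p < min ρ r → c.ht y < 0 → y ∈ collar ω r := by
    intro y hy hyh
    refine ⟨?_, fun hcl => ?_⟩
    · rw [← Metric.thickening_closure]
      exact Metric.mem_thickening_iff.2 ⟨p, frontier_subset_closure hp, by linarith⟩
    · exact absurd (((hloc y (Metric.mem_ball.2 (by linarith))).2).1 hcl) (not_le.2 hyh)
  have hN : ∀ x ∈ Metric.ball p σ \ closure ω, dist x p < σ ∧ c.ht x < 0 := by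
    rintro x ⟨hx, hxc⟩
    refine ⟨hx, ?_⟩
    by_contra! h
    refine hxc (((hloc x (Metric.mem_ball.2 ?_)).2).2 h)
    have : dist x p < σ := hx
    nlinarith
  have hdt : ∀ (x : Eu d) (t : ℝ), dist (x - t • c.up) p ≤ dist x p + |t| := by
    intro x t
    refine (dist_triangle _ x _).trans ?_
    rw [add_comm, dist_eq_norm (x - t • c.up), sub_sub_cancel_left, norm_neg, norm_smul, c.norm_up,
      mul_one, Real.norm_eq_abs]
  have hht : ∀ (x : Eu d) (t : ℝ), c.ht (x - t • c.up) = c.ht x - t := by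
    intro x t
    have := c.ht_add_smul_up x (-t)
    rw [neg_smul, ← sub_eq_add_neg] at this
    rw [this]; ring
  have hpath : ∀ x ∈ Metric.ball p σ \ closure ω, ∀ t ∈ Icc (0 : ℝ) 1,
      x - t • (s • c.up) ∈ collar ω r := by
    intro x hx t ht
    obtain ⟨h1, h2⟩ := hN x hx
    have h3 : 0 ≤ t * s := mul_nonneg ht.1 hs0.le
    have h4 : t * s ≤ s := mul_le_of_le_one_left hs0.le ht.2
    rw [smul_smul]
    refine hO _ ((hdt x (t * s)).trans_lt ?_) ?_
    · rw [abs_of_nonneg h3]; nlinarith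
    · rw [hht]; linarith
  set b := p - s • c.up with hb
  have hball : Metric.ball b σ ⊆ collar ω r := by
    intro y hy
    have h1 : dist y b < σ := hy
    have h2 := (c.lipschitz_ht hK).dist_le_mul y b
    rw [hb, hht, hp0, Real.dist_eq, ← hb] at h2
    push_cast at h2
    have h3 : (1 + (K : ℝ)) * dist y b < s := by rw [hs]; gcongr
    have h4 := (abs_le.1 h2).2
    refine hO _ ?_ (by linarith)
    have h5 := hdt p s
    rw [dist_self, zero_add, abs_of_pos hs0] at h5
    nlinarith [dist_triangle y b p]
  have hcm := measurableSet_collar ω r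
  have hlast : Linked m (collar ω r) (Metric.ball b σ) (Metric.ball p σ \ closure ω) := by
    refine Linked.translate (s • c.up) measurableSet_ball hcm (fun x hx => ?_) hpath
    have : dist x p < σ := hx.1
    rw [Metric.mem_ball, hb, dist_sub_right]
    exact this
  refine ⟨σ, hσ0, fun S₁ hS₁ hsub h0 => ?_, b, hball, hlast⟩
  -- The region outside `ω` near `p` need not be convex, so the link goes down, across and up:
  -- translate `S₁` into the ball around `b`, spread over that ball, translate back.
  set S' := (fun y => y + s • c.up) ⁻¹' S₁ with hS'
  have l1 : Linked m (collar ω r) S₁ S' := by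
    refine Linked.translate (-(s • c.up)) hS₁ hcm (fun x hx => ?_) fun x hx t ht => ?_
    · rw [sub_neg_eq_add]; exact hx
    · have := hpath _ (hsub hx) (1 - t) ⟨by linarith [ht.2], by linarith [ht.1]⟩
      convert this using 1
      module
  have l2 : Linked m (collar ω r) S' (Metric.ball b σ) := by
    refine Linked.ball hball (fun x hx => ?_) ?_
    · have : dist (x + s • c.up) p < σ := (hsub hx).1
      rw [Metric.mem_ball, hb]
      rwa [dist_eq_norm, sub_sub_eq_add_sub, ← dist_eq_norm]
    · rw [hS', measure_preimage_add_right]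
      exact h0
  exact (l1.trans l2).trans hlast

/-- The Poincaré inequality on the outer collar of a bounded Lipschitz domain with connected
frontier. -/
theorem IsLipschitzDomain.exists_collar_poincare {d : ℕ} (m : ℕ) {ω : Set (Eu d)}
    (hω : IsLipschitzDomain ω) (hb : Bornology.IsBounded ω) (hc : IsConnected (frontier ω))
    {r₀ : ℝ} (hr₀ : 0 < r₀) :
    ∃ r₁ > 0, r₁ ≤ r₀ ∧ ∃ C : ℝ≥0, ∀ (w : Eu d → Eu m) (K : ℝ≥0), LipschitzWith K w →
      ∃ a : Eu m, ∫⁻ x in collar ω r₁, ‖w x - a‖ₑ ^ 2 ≤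
        C * ∫⁻ x in collar ω r₀, ‖gradArr w x‖ₑ ^ 2 := by
  have hex : ∀ p : Eu d, ∃ σ : ℝ, p ∈ frontier ω → 0 < σ ∧
      (∀ S₁, MeasurableSet S₁ → S₁ ⊆ Metric.ball p σ \ closure ω → volume S₁ ≠ 0 →
      Linked m (collar ω r₀) S₁ (Metric.ball p σ \ closure ω)) ∧
      ∃ b, Metric.ball b σ ⊆ collar ω r₀ ∧
        Linked m (collar ω r₀) (Metric.ball b σ) (Metric.ball p σ \ closure ω) := by
    intro p
    by_cases hp : p ∈ frontier ω
    · obtain ⟨σ, h⟩ := hω.exists_linked m hp hr₀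
      exact ⟨σ, fun _ => h⟩
    · exact ⟨0, fun h => absurd h hp⟩
  choose σ hσ using hex
  set N : Eu d → Set (Eu d) := fun p => Metric.ball p (σ p) \ closure ω with hN
  have hNm : ∀ p, MeasurableSet (N p) := fun p =>
    measurableSet_ball.diff isClosed_closure.measurableSet
  have hlink : ∀ p ∈ frontier ω, ∀ q ∈ frontier ω, q ∈ Metric.ball p (σ p) →
      Linked m (collar ω r₀) (N p) (N q) ∧ Linked m (collar ω r₀) (N q) (N p) := by
    intro p hp q hq hpq
    obtain ⟨τ, hτ, hτs⟩ := Metric.isOpen_iff.1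
      (Metric.isOpen_ball.inter (Metric.isOpen_ball (x := q) (ε := σ q))) q
      ⟨hpq, Metric.mem_ball_self (hσ q hq).1⟩
    -- The outer neighbourhoods `N p` and `N q` overlap in a set of positive measure, and the local
    -- inequality applies from that set to each of them.
    have hI : volume (Metric.ball q τ \ closure ω) ≠ 0 := hω.volume_ball_diff_ne_zero hq hτ
    have hIm : MeasurableSet (Metric.ball q τ \ closure ω) :=
      measurableSet_ball.diff isClosed_closure.measurableSet
    have hIp : Metric.ball q τ \ closure ω ⊆ N p := fun x hx => ⟨(hτs hx.1).1, hx.2⟩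
    have hIq : Metric.ball q τ \ closure ω ⊆ N q := fun x hx => ⟨(hτs hx.1).2, hx.2⟩
    exact ⟨(Linked.of_superset hIp).trans ((hσ q hq).2.1 _ hIm hIq hI),
      (Linked.of_superset hIq).trans ((hσ p hp).2.1 _ hIm hIp hI)⟩
  have hF : IsCompact (frontier ω) :=
    Metric.isCompact_of_isClosed_isBounded isClosed_frontier
      (hb.closure.subset frontier_subset_closure)
  have hall : ∀ p ∈ frontier ω, ∀ q ∈ frontier ω, Linked m (collar ω r₀) (N p) (N q) := by
    intro p hp q hq
    -- Connectedness of the frontier enters here: a locally valid transitive relation holds between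
    -- any two of its points.
    refine hc.isPreconnected.induction₂' (fun p q => Linked m (collar ω r₀) (N p) (N q)) ?_ ?_ hp hq
    · intro p hp
      filter_upwards [self_mem_nhdsWithin,
        mem_nhdsWithin_of_mem_nhds (Metric.ball_mem_nhds p (hσ p hp).1)] with q hq hpq
      exact hlink p hp q hq hpq
    · intro p q s _ _ _ h1 h2
      exact h1.trans h2
  obtain ⟨t, htF, hcov⟩ := hF.elim_nhds_subcover (fun p => Metric.ball p (σ p))
    (fun p hp => Metric.ball_mem_nhds p (hσ p hp).1)
  obtain ⟨δ, hδ, hδs⟩ := hF.exists_thickening_subset_open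
    (isOpen_biUnion fun p _ => Metric.isOpen_ball) hcov
  obtain ⟨p₀, hp₀⟩ := hc.nonempty
  obtain ⟨hσ₀, -, b, hbO, hbl⟩ := hσ p₀ hp₀
  set B := Metric.ball b (σ p₀) with hB
  have hlb : ∀ p : t, Linked m (collar ω r₀) B (N p) := fun p =>
    hbl.trans (hall p₀ hp₀ p (htF p p.2))
  choose C hC using hlb
  have hBtop : volume B ≠ ∞ := measure_ball_lt_top.ne
  have hB0 : volume B ≠ 0 := (Metric.measure_ball_pos volume b hσ₀).ne'
  set D := (volume (Metric.ball (0 : Eu d) (2 * σ p₀)) * ENNReal.ofReal (2 * σ p₀) ^ 2) / volume B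
    with hD
  have hDtop : D ≠ ∞ := ENNReal.div_ne_top
    (ENNReal.mul_ne_top measure_ball_lt_top.ne (by finiteness)) hB0
  refine ⟨min δ r₀, lt_min hδ hr₀, min_le_right _ _, (∑ p, C p) * (D.toNNReal + 1),
    fun w K hw => ?_⟩
  have hwm : Measurable w := hw.continuous.measurable
  -- In place of the mean value, the constant is `w y` for a point `y` at which the squared
  -- deviation from `w y` over `B` is at most its average.
  obtain ⟨y, -, hy⟩ := exists_le_setLAverage (s := B) (μ := volume)
    (f := fun x => ∫⁻ y in B, ‖w x - w y‖ₑ ^ 2) hB0 hBtop (by fun_prop)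
  have hyD : ∫⁻ x in B, ‖w x - w y‖ₑ ^ 2 ≤ D * ∫⁻ x in collar ω r₀, ‖gradArr w x‖ₑ ^ 2 := by
    simp_rw [enorm_sub_rev _ (w y)]
    refine hy.trans ?_
    rw [setLAverage_eq, hD, ENNReal.div_eq_inv_mul, ENNReal.div_eq_inv_mul, mul_assoc]
    refine mul_le_mul' le_rfl ((lintegral_lintegral_ball_sub_le hw b (σ p₀)).trans ?_)
    rw [mul_assoc]
    exact mul_le_mul' le_rfl (mul_le_mul' le_rfl (lintegral_mono_set hbO))
  refine ⟨w y, ?_⟩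
  have hsub : collar ω (min δ r₀) ⊆ ⋃ p : t, N p := by
    rintro x ⟨hx, hxc⟩
    obtain ⟨z, hz, hxz⟩ := Metric.mem_thickening_iff.1 hx
    -- A point of the collar is close to `ω` but outside it, so the segment to a nearby point of `ω`
    -- crosses the frontier. Hence the collar is covered by the finitely many `N p`.
    obtain ⟨z', hz', hzf⟩ := exists_mem_segment_frontier (U := ω) hz (fun h => hxc (subset_closure h))
    have hd : dist x z' < δ := by
      rw [segment_symm] at hz'
      exact (dist_le_of_mem_segment hz').trans_lt (hxz.trans_le (min_le_left _ _))
    obtain ⟨p, hp, hxp⟩ := mem_iUnion₂.1 (hδs (Metric.mem_thickening_iff.2 ⟨z', hzf, hd⟩))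
    exact mem_iUnion.2 ⟨⟨p, hp⟩, hxp, hxc⟩
  have hwy : LipschitzWith K fun x => w x - w y := by
    simpa using hw.sub (LipschitzWith.const (w y))
  set G := ∫⁻ x in collar ω r₀, ‖gradArr w x‖ₑ ^ 2 with hG
  calc ∫⁻ x in collar ω (min δ r₀), ‖w x - w y‖ₑ ^ 2
      ≤ ∫⁻ x in ⋃ p : t, N p, ‖w x - w y‖ₑ ^ 2 := lintegral_mono_set hsub
    _ ≤ ∑' p : t, ∫⁻ x in N p, ‖w x - w y‖ₑ ^ 2 := lintegral_iUnion_le _ _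
    _ = ∑ p : t, ∫⁻ x in N p, ‖w x - w y‖ₑ ^ 2 := tsum_fintype _
    _ ≤ ∑ p : t, C p * (D * G + G) := by
        refine Finset.sum_le_sum fun p _ => (hC p _ K hwy).trans ?_
        simp_rw [gradArr_sub_const]
        exact mul_le_mul' le_rfl (add_le_add hyD le_rfl)
    _ = _ := by
        rw [← Finset.sum_mul]
        push_cast
        rw [ENNReal.coe_toNNReal hDtop]
        ring

/-! ### Scaling to a single inclusion. -/

/-- The homothety `y ↦ ε (v + y)`. -/
def cellMap {d : ℕ} (ε : ℝ) (hε : 0 < ε) (v : Eu d) : Eu d ≃ₜ Eu d :=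
  (Homeomorph.addLeft v).trans (Homeomorph.smulOfNeZero ε hε.ne')

section CellMap

variable {d m : ℕ} {ε : ℝ} (hε : 0 < ε) (v : Eu d)

lemma cellMap_apply (y : Eu d) : cellMap ε hε v y = ε • (v + y) := rfl

lemma dist_cellMap (x y : Eu d) :
    dist (cellMap ε hε v x) (cellMap ε hε v y) = ε * dist x y := by
  rw [cellMap_apply, cellMap_apply, dist_smul₀, dist_add_left, Real.norm_of_nonneg hε.le]

lemma lipschitz_cellMap : LipschitzWith ε.toNNReal (cellMap ε hε v) :=
  LipschitzWith.of_dist_le_mul fun x y => by rw [dist_cellMap, Real.coe_toNNReal _ hε.le]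

lemma lipschitz_cellMap_symm : LipschitzWith (ε⁻¹).toNNReal (cellMap ε hε v).symm :=
  LipschitzWith.of_dist_le_mul fun x y => by
    have := dist_cellMap hε v ((cellMap ε hε v).symm x) ((cellMap ε hε v).symm y)
    rw [Homeomorph.apply_symm_apply, Homeomorph.apply_symm_apply] at this
    rw [this, Real.coe_toNNReal _ (inv_pos.2 hε).le, inv_mul_cancel_left₀ hε.ne']

lemma cellMap_image_thickening (r : ℝ) (S : Set (Eu d)) :
    cellMap ε hε v '' Metric.thickening r S =
      Metric.thickening (r * ε) (cellMap ε hε v '' S) := by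
  ext x
  obtain ⟨x, rfl⟩ := (cellMap ε hε v).surjective x
  simp only [(cellMap ε hε v).injective.mem_set_image, Metric.mem_thickening_iff,
    exists_mem_image]
  refine exists_congr fun z => and_congr_right fun _ => ?_
  rw [dist_cellMap, mul_comm ε]
  exact (mul_lt_mul_iff_left₀ hε).symm

lemma cellMap_image_collar (r : ℝ) (S : Set (Eu d)) :
    cellMap ε hε v '' collar S r = collar (cellMap ε hε v '' S) (r * ε) := by
  rw [collar, image_sdiff (cellMap ε hε v).injective, cellMap_image_thickening,
    (cellMap ε hε v).image_closure, collar]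

lemma gradArr_comp_cellMap (w : Eu d → Eu m) (y : Eu d) :
    gradArr (fun z => w (cellMap ε hε v z)) y = ε • gradArr w (cellMap ε hε v y) := by
  have h : fderiv ℝ (fun z => w (cellMap ε hε v z)) y =
      ε • fderiv ℝ w (cellMap ε hε v y) := by
    have h1 := fderiv_comp_add_left (𝕜 := ℝ) (f := fun z => w (ε • z)) (x := y) v
    have h2 := fderiv_comp_smul (𝕜 := ℝ) (f := w) (x := v + y) ε
    exact h1.trans h2
  rw [gradArr_eq, h, map_smul, gradArr_eq]

/-- The factor `k` is the Jacobian. It appears on both sides of every scaled inequality, so only its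
being nonzero and finite matters. -/
lemma exists_lintegral_cellMap : ∃ k : ℝ≥0∞, k ≠ 0 ∧ k ≠ ∞ ∧ ∀ (T : Set (Eu d)) (F : Eu d → ℝ≥0∞),
    MeasurableSet T →
    ∫⁻ y in T, F (cellMap ε hε v y) = k * ∫⁻ x in cellMap ε hε v '' T, F x := by
  refine ⟨ENNReal.ofReal |(ε ^ Module.finrank ℝ (Eu d))⁻¹|, ?_, ENNReal.ofReal_ne_top,
    fun T F hT => ?_⟩
  · rw [Ne, ENNReal.ofReal_eq_zero, not_le]; positivity
  · have hmap : Measure.map (cellMap ε hε v) volume =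
        ENNReal.ofReal |(ε ^ Module.finrank ℝ (Eu d))⁻¹| • volume := by
      rw [← Measure.map_addHaar_smul volume hε.ne']
      conv_rhs => rw [← (measurePreserving_add_left volume v).map_eq]
      rw [Measure.map_map (by fun_prop) (by fun_prop)]
      rfl
    have he := (cellMap ε hε v).measurableEmbedding
    have hTi : T = cellMap ε hε v ⁻¹' (cellMap ε hε v '' T) :=
      (preimage_image_eq _ (cellMap ε hε v).injective).symm
    rw [← smul_eq_mul, ← lintegral_smul_measure, ← Measure.restrict_smul, ← hmap, he.restrict_map,
      he.lintegral_map, ← hTi]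

end CellMap

lemma cellInclusion_eq {d : ℕ} (ω : Set (Eu d)) {ε : ℝ} (hε : 0 < ε) (n : Fin d → ℤ) :
    cellInclusion ω ε n = cellMap ε hε (WithLp.toLp 2 fun i => (n i : ℝ)) '' ω := rfl

/-- The scaled extension and Poincaré inequalities around an inclusion. -/
theorem exists_cell_extension {d : ℕ} [NeZero d] (m : ℕ) {ω : Set (Eu d)}
    (hω : IsLipschitzDomain ω) (hb : Bornology.IsBounded ω) (hc : IsConnected (frontier ω))
    {r₀ : ℝ} (hr₀ : 0 < r₀) :
    ∃ r₁ > 0, r₁ ≤ r₀ ∧ ∃ C : ℝ≥0, ∀ (ε : ℝ), 0 < ε → ∀ (n : Fin d → ℤ) (w : Eu d → Eu m) (K : ℝ≥0),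
      LipschitzWith K w →
      (∃ a : Eu m, ∫⁻ x in collar (cellInclusion ω ε n) (r₁ * ε), ‖w x - a‖ₑ ^ 2 ≤
        C * ENNReal.ofReal ε ^ 2 *
          ∫⁻ x in collar (cellInclusion ω ε n) (r₀ * ε), ‖gradArr w x‖ₑ ^ 2) ∧
      ∃ E : Eu d → Eu m, (∃ K', LipschitzWith K' E) ∧
        (∀ x ∈ frontier (cellInclusion ω ε n), E x = w x) ∧
        ∀ P : Set (Eu d), MeasurableSet P →
          ∫⁻ x in cellInclusion ω ε n ∩ P,
            (‖E x‖ₑ ^ 2 + ENNReal.ofReal ε ^ 2 * ‖gradArr E x‖ₑ ^ 2) ≤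
            C * ∫⁻ x in collar (cellInclusion ω ε n) (r₁ * ε) ∩ Metric.thickening (r₁ * ε) P,
              (‖w x‖ₑ ^ 2 + ENNReal.ofReal ε ^ 2 * ‖gradArr w x‖ₑ ^ 2) := by
  obtain ⟨r₁, hr₁, hle, C₁, hC₁⟩ := hω.exists_collar_poincare m hb hc hr₀
  obtain ⟨C₂, hC₂⟩ := hω.exists_extension m hb hr₁
  refine ⟨r₁, hr₁, hle, max C₁ C₂, fun ε hε n w K hw => ?_⟩
  set v : Eu d := WithLp.toLp 2 fun i => (n i : ℝ) with hv
  set g := cellMap ε hε v with hg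
  obtain ⟨k, hk0, hktop, hk⟩ := exists_lintegral_cellMap hε v
  have hwg : LipschitzWith (K * ε.toNNReal) fun y => w (g y) := hw.comp (lipschitz_cellMap hε v)
  have hgr : ∀ (u : Eu d → Eu m) y, ‖gradArr (fun z => u (g z)) y‖ₑ ^ 2 =
      ENNReal.ofReal ε ^ 2 * ‖gradArr u (g y)‖ₑ ^ 2 := by
    intro u y
    rw [gradArr_comp_cellMap, enorm_smul, mul_pow, Real.enorm_of_nonneg hε.le]
  have hcancel : ∀ {a b : ℝ≥0∞}, k * a ≤ k * b → a ≤ b := fun h =>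
    (ENNReal.mul_le_mul_iff_right hk0 hktop).1 h
  have himg : cellInclusion ω ε n = g '' ω := rfl
  rw [himg]
  constructor
  · obtain ⟨a, ha⟩ := hC₁ _ _ hwg
    refine ⟨a, hcancel ?_⟩
    rw [← cellMap_image_collar, ← cellMap_image_collar,
      ← hk _ (fun x => ‖w x - a‖ₑ ^ 2) (measurableSet_collar _ _), mul_left_comm,
      ← hk _ (fun x => ‖gradArr w x‖ₑ ^ 2) (measurableSet_collar _ _), mul_assoc,
      ← lintegral_const_mul' _ _ (by finiteness)]
    refine ha.trans ?_
    simp_rw [hgr]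
    gcongr
    exact le_max_left _ _
  · obtain ⟨E, ⟨K', hE⟩, hEf, hEP⟩ := hC₂ _ _ hwg
    obtain ⟨E', hE'⟩ : ∃ E' : Eu d → Eu m, E' = fun x => E (g.symm x) := ⟨_, rfl⟩
    have hEE : ∀ y, E y = E' (g y) := fun y => by rw [hE']; simp
    refine ⟨E', ⟨K' * (ε⁻¹).toNNReal, by
      rw [hE']; exact hE.comp (lipschitz_cellMap_symm hε v)⟩, ?_, ?_⟩
    · rw [← g.image_frontier]
      rintro _ ⟨y, hy, rfl⟩
      rw [← hEE]
      exact hEf y hy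
    · intro P hP
      have hPm : MeasurableSet (g ⁻¹' P) := g.continuous.measurable hP
      have himP : g '' (ω ∩ g ⁻¹' P) = g '' ω ∩ P := image_inter_preimage g ω P
      have himQ : g '' (collar ω r₁ ∩ Metric.thickening r₁ (g ⁻¹' P)) =
          collar (g '' ω) (r₁ * ε) ∩ Metric.thickening (r₁ * ε) P := by
        rw [image_inter g.injective, cellMap_image_collar, cellMap_image_thickening,
          image_preimage_eq _ g.surjective]
      have h := hEP _ hPm
      simp_rw [hgr] at h
      have hE2 : ∀ y, ‖gradArr E y‖ₑ ^ 2 =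
          ENNReal.ofReal ε ^ 2 * ‖gradArr E' (g y)‖ₑ ^ 2 := by
        intro y
        rw [← hgr]
        simp_rw [← hEE]
      simp_rw [hE2] at h
      simp_rw [hEE] at h
      rw [hk _ (fun x => ‖E' x‖ₑ ^ 2 + ENNReal.ofReal ε ^ 2 * ‖gradArr E' x‖ₑ ^ 2)
          (hω.isOpen.measurableSet.inter hPm), himP,
        hk _ (fun x => ‖w x‖ₑ ^ 2 + ENNReal.ofReal ε ^ 2 * ‖gradArr w x‖ₑ ^ 2)
          ((measurableSet_collar _ _).inter Metric.isOpen_thickening.measurableSet), himQ,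
        mul_left_comm] at h
      refine (hcancel h).trans ?_
      gcongr
      exact le_max_right _ _

lemma mem_cellInclusion_coord {d : ℕ} {ω : Set (Eu d)} (hω : ω ⊆ unitCell d) {ε : ℝ} (hε : 0 < ε)
    {n : Fin d → ℤ} {x : Eu d} (hx : x ∈ cellInclusion ω ε n) (i : Fin d) :
    |x i - ε * n i| < ε / 2 := by
  obtain ⟨y, hy, rfl⟩ := hx
  have h := hω hy i
  simp only [PiLp.smul_apply, PiLp.add_apply, smul_eq_mul, PiLp.zero_apply, sub_zero] at h ⊢
  have : ε * ((n i : ℝ) + y i) - ε * n i = ε * y i := by ring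
  rw [this, abs_mul, abs_of_pos hε]
  nlinarith

/-- Friedrichs' inequality for functions supported in an inclusion. -/
lemma lintegral_le_of_eq_zero_off_cell {d m : ℕ} [NeZero d] {ω : Set (Eu d)} (hω : ω ⊆ unitCell d)
    {ε : ℝ} (hε : 0 < ε) (n : Fin d → ℤ) {φ : Eu d → Eu m} {K : ℝ≥0} (hφ : LipschitzWith K φ)
    (h0 : ∀ x ∉ cellInclusion ω ε n, φ x = 0) :
    ∫⁻ x, ‖φ x‖ₑ ^ 2 ≤ ENNReal.ofReal ε ^ 2 * ∫⁻ x, ‖gradArr φ x‖ₑ ^ 2 := by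
  -- The inclusion has width less than `ε` in each coordinate direction, so a shift by `ε` leaves it
  -- and `φ (x - h) = 0` for `x` in the inclusion. Friedrichs' inequality is then the translation
  -- estimate.
  set h : Eu d := EuclideanSpace.single 0 ε with hh
  have hn : ‖h‖ₑ = ENNReal.ofReal ε := by
    rw [← ofReal_norm, hh, PiLp.norm_single, Real.norm_of_nonneg hε.le]
  have key := lintegral_sub_translate_le hφ h (S := univ) MeasurableSet.univ
    (fun x _ t _ => mem_univ _)
  rw [Measure.restrict_univ, hn] at key
  refine le_trans (lintegral_mono fun x => ?_) key
  by_cases hx : x ∈ cellInclusion ω ε n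
  · rw [h0 (x - h), sub_zero]
    intro hx'
    have h1 := mem_cellInclusion_coord hω hε hx 0
    have h2 := mem_cellInclusion_coord hω hε hx' 0
    simp only [hh, PiLp.sub_apply, PiLp.single_apply, if_true] at h2
    rw [abs_lt] at h1 h2
    linarith
  · rw [h0 x hx]; simp

/-! ### Mollification as averaging against a probability measure. -/

/-- A sequence of bump functions shrinking to the origin. -/
def bumpSeq (d k : ℕ) : ContDiffBump (0 : Eu d) :=
  ⟨1 / (2 * (k + 1)), 1 / (k + 1), by positivity, by
    rw [div_lt_div_iff_of_pos_left] <;> first | positivity | linarith⟩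

/-- Mollification at scale `1 / (k + 1)`. -/
def moll {d : ℕ} {F : Type*} [NormedAddCommGroup F] [NormedSpace ℝ F] (k : ℕ) (g : Eu d → F) :
    Eu d → F :=
  convolution ((bumpSeq d k).normed volume) g (ContinuousLinearMap.lsmul ℝ ℝ) volume

/-- The mollification kernel as a probability measure. -/
def mollMeasure (d k : ℕ) : Measure (Eu d) :=
  volume.withDensity fun t => (((bumpSeq d k).normed volume t).toNNReal : ℝ≥0∞)

lemma bumpSeq_rOut (d k : ℕ) : (bumpSeq d k).rOut = 1 / (k + 1) := rfl

lemma tendsto_bumpSeq_rOut (d : ℕ) : Tendsto (fun k => (bumpSeq d k).rOut) atTop (𝓝 0) :=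
  tendsto_one_div_add_atTop_nhds_zero_nat

section Moll

variable {d m : ℕ} {F : Type*} [NormedAddCommGroup F] [NormedSpace ℝ F]

lemma measurable_normed_toNNReal (d k : ℕ) :
    Measurable fun t : Eu d => ((bumpSeq d k).normed volume t).toNNReal :=
  (bumpSeq d k).continuous_normed.measurable.real_toNNReal

instance isProbabilityMeasure_mollMeasure (d k : ℕ) : IsProbabilityMeasure (mollMeasure d k) := by
  constructor
  rw [mollMeasure, withDensity_apply _ MeasurableSet.univ, Measure.restrict_univ]
  have h := ofReal_integral_eq_lintegral_ofReal ((bumpSeq d k).integrable_normed (μ := volume))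
    (Eventually.of_forall fun t => (bumpSeq d k).nonneg_normed t)
  rw [(bumpSeq d k).integral_normed, ENNReal.ofReal_one] at h
  exact h.symm

lemma moll_eq (k : ℕ) (g : Eu d → F) (x : Eu d) : moll k g x = ∫ t, g (x - t) ∂mollMeasure d k := by
  rw [mollMeasure, integral_withDensity_eq_integral_smul (measurable_normed_toNNReal d k), moll,
    convolution_def]
  refine integral_congr_ae (Eventually.of_forall fun t => ?_)
  simp only [ContinuousLinearMap.lsmul_apply, NNReal.smul_def,
    Real.coe_toNNReal _ ((bumpSeq d k).nonneg_normed t)]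

lemma mollMeasure_absolutelyContinuous (d k : ℕ) : mollMeasure d k ≪ volume :=
  withDensity_absolutelyContinuous _ _

lemma ae_mollMeasure_norm_lt (d k : ℕ) : ∀ᵐ t ∂mollMeasure d k, ‖t‖ < 1 / (k + 1) := by
  rw [mollMeasure, ae_withDensity_iff (measurable_normed_toNNReal d k).coe_nnreal_ennreal]
  refine Eventually.of_forall fun t ht => ?_
  have h1 : t ∈ Function.support ((bumpSeq d k).normed volume) := by
    intro h0
    simp [h0] at ht
  rw [(bumpSeq d k).support_normed_eq, mem_ball_zero_iff] at h1
  exact h1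

lemma norm_moll_le {k : ℕ} {g : Eu d → F} {M : ℝ} (h : ∀ x, ‖g x‖ ≤ M) (x : Eu d) :
    ‖moll k g x‖ ≤ M := by
  rw [moll_eq]
  have := norm_integral_le_of_norm_le_const (μ := mollMeasure d k)
    (Eventually.of_forall fun t => h (x - t))
  simpa using this

lemma quasiMeasurePreserving_sub_left (x : Eu d) :
    Measure.QuasiMeasurePreserving (fun t => x - t) (mollMeasure d k) volume :=
  (quasiMeasurePreserving_sub_left_of_right_invariant volume x).mono_left
    (mollMeasure_absolutelyContinuous d k)

/-- The gradient of a mollified Lipschitz function. -/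
lemma gradArr_moll {θ : Eu d → Eu m} {K : ℝ≥0} (hθ : LipschitzWith K θ) (k : ℕ) (x : Eu d) :
    gradArr (moll k θ) x = moll k (gradArr θ) x := by
  have hint : ∀ y, Integrable (fun t => θ (y - t)) (mollMeasure d k) := by
    intro y
    refine Integrable.of_bound (C := ‖θ y‖ + K * 1) ?_ ?_
    · exact (hθ.continuous.comp (by fun_prop)).aestronglyMeasurable
    · filter_upwards [ae_mollMeasure_norm_lt d k] with t ht
      have h1 := hθ.dist_le_mul (y - t) y
      have h2 : dist (y - t) y ≤ 1 := by
        rw [dist_eq_norm, sub_sub_cancel_left, norm_neg]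
        refine ht.le.trans ?_
        rw [div_le_one (by positivity)]
        linarith [(Nat.cast_nonneg k : (0 : ℝ) ≤ k)]
      have h3 := norm_le_norm_add_norm_sub' (θ (y - t)) (θ y)
      rw [dist_eq_norm] at h1
      refine h3.trans ?_
      gcongr
      exact h1.trans (by gcongr)
  -- Differentiation under the integral needs the integrand to be Lipschitz in the parameter and
  -- differentiable at `x` only for almost every `t`, which is Rademacher's theorem.
  have hd := hasFDerivAt_integral_of_dominated_loc_of_lip (μ := mollMeasure d k)
    (F := fun y t => θ (y - t)) (F' := fun t => fderiv ℝ θ (x - t)) (x₀ := x) (s := univ)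
    (bound := fun _ => (K : ℝ)) univ_mem
    (Eventually.of_forall fun y => (hint y).1) (hint x)
    ((measurable_fderiv ℝ θ).comp (by fun_prop)).aestronglyMeasurable
    (Eventually.of_forall fun t => by
      have : LipschitzWith K fun y => θ (y - t) := by
        simpa [Function.comp_def] using hθ.comp (LipschitzWith.id.sub (LipschitzWith.const t))
      simpa using this)
    (integrable_const _) (by
      filter_upwards [(quasiMeasurePreserving_sub_left (k := k) x).ae hθ.ae_differentiableAt]
        with t ht
      simpa [Function.comp_def] using ht.hasFDerivAt.comp x ((hasFDerivAt_id x).sub_const t))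
  have hfd : fderiv ℝ (moll k θ) x = ∫ t, fderiv ℝ θ (x - t) ∂mollMeasure d k := by
    rw [← hd.2.fderiv]
    congr 1
    ext1 y
    exact moll_eq k θ y
  rw [gradArr_eq, hfd, moll_eq, ← ContinuousLinearMap.integral_comp_comm _ hd.1]
  rfl

lemma contDiff_moll [FiniteDimensional ℝ F] {g : Eu d → F} (hg : LocallyIntegrable g) (k : ℕ) :
    ContDiff ℝ ((⊤ : ℕ∞) : WithTop ℕ∞) (moll k g) :=
  (bumpSeq d k).hasCompactSupport_normed.contDiff_convolution_left _
    (bumpSeq d k).contDiff_normed hg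

lemma tsupport_moll_subset {g : Eu d → F} (k : ℕ) :
    tsupport (moll k g) ⊆ Metric.cthickening (1 / (k + 1)) (tsupport g) := by
  refine closure_minimal (fun x hx => ?_) Metric.isClosed_cthickening
  obtain ⟨y, hy, z, hz, rfl⟩ := support_convolution_subset _ hx
  rw [(bumpSeq d k).support_normed_eq, mem_ball_zero_iff] at hy
  refine Metric.thickening_subset_cthickening _ _
    (Metric.mem_thickening_iff.2 ⟨z, subset_tsupport _ hz, ?_⟩)
  rw [bumpSeq_rOut] at hy
  simpa [dist_eq_norm] using hy

lemma hasCompactSupport_moll {g : Eu d → F} (hg : HasCompactSupport g) (k : ℕ) :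
    HasCompactSupport (moll k g) :=
  (bumpSeq d k).hasCompactSupport_normed.convolution _ hg

end Moll

/-! ### From smooth to Lipschitz test functions. -/

/-- Passing to the limit in a weak equation along test functions with bounded gradients. -/
lemma weak_eq_of_tendsto {d m : ℕ} {U : Set (Eu d)} {H : Eu d → GradSp d m} {F : Eu d → Eu m}
    (hH : IntegrableOn H U) (hF : IntegrableOn F U) {θ : Eu d → Eu m} {θk : ℕ → Eu d → Eu m} {M : ℝ}
    (hc : ∀ k, Continuous (θk k)) (hb : ∀ k, ∀ᵐ x, ‖gradArr (θk k) x‖ ≤ M)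
    (hb' : ∀ k x, ‖θk k x‖ ≤ M)
    (ht : ∀ᵐ x ∂volume.restrict U, Tendsto (fun k => gradArr (θk k) x) atTop (𝓝 (gradArr θ x)))
    (ht' : ∀ᵐ x ∂volume.restrict U, Tendsto (fun k => θk k x) atTop (𝓝 (θ x)))
    (heq : ∀ᶠ k in atTop, ∫ x in U, ⟪H x, gradArr (θk k) x⟫_ℝ = ∫ x in U, ⟪F x, θk k x⟫_ℝ) :
    ∫ x in U, ⟪H x, gradArr θ x⟫_ℝ = ∫ x in U, ⟪F x, θ x⟫_ℝ := by
  have h1 : Tendsto (fun k => ∫ x in U, ⟪H x, gradArr (θk k) x⟫_ℝ) atTop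
      (𝓝 (∫ x in U, ⟪H x, gradArr θ x⟫_ℝ)) := by
    refine tendsto_integral_of_dominated_convergence (fun x => ‖H x‖ * M)
      (fun k => hH.1.inner (measurable_gradArr _).aestronglyMeasurable) (hH.norm.mul_const M)
      (fun k => ?_) ?_
    · filter_upwards [ae_restrict_of_ae (hb k)] with x hx
      exact (norm_inner_le_norm _ _).trans (by gcongr)
    · filter_upwards [ht] with x hx
      exact tendsto_const_nhds.inner hx
  have h2 : Tendsto (fun k => ∫ x in U, ⟪F x, θk k x⟫_ℝ) atTop (𝓝 (∫ x in U, ⟪F x, θ x⟫_ℝ)) := by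
    refine tendsto_integral_of_dominated_convergence (fun x => ‖F x‖ * M)
      (fun k => hF.1.inner (hc k).aestronglyMeasurable) (hF.norm.mul_const M) (fun k => ?_) ?_
    · refine Eventually.of_forall fun x => (norm_inner_le_norm _ _).trans ?_
      gcongr
      exact hb' k x
    · filter_upwards [ht'] with x hx
      exact tendsto_const_nhds.inner hx
  exact tendsto_nhds_unique (h1.congr' heq) h2

/-- Mollifications of `θ` are admissible once the scale is below the distance from the support to
the complement of `U`. Their gradients are mollified gradients, hence uniformly bounded and
convergent almost everywhere, so dominated convergence applies. -/
lemma weak_eq_of_hasCompactSupport {d m : ℕ} {U : Set (Eu d)} (hU : IsOpen U)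
    {H : Eu d → GradSp d m} {F : Eu d → Eu m} (hH : IntegrableOn H U) (hF : IntegrableOn F U)
    (h : ∀ φ : Eu d → Eu m, ContDiff ℝ ((⊤ : ℕ∞) : WithTop ℕ∞) φ → HasCompactSupport φ →
      tsupport φ ⊆ U → ∫ x in U, ⟪H x, gradArr φ x⟫_ℝ = ∫ x in U, ⟪F x, φ x⟫_ℝ)
    {θ : Eu d → Eu m} {K : ℝ≥0} (hθ : LipschitzWith K θ) (hc : HasCompactSupport θ)
    (hs : tsupport θ ⊆ U) :
    ∫ x in U, ⟪H x, gradArr θ x⟫_ℝ = ∫ x in U, ⟪F x, θ x⟫_ℝ := by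
  obtain ⟨M, hM⟩ := hc.exists_bound_of_continuous hθ.continuous
  have hli : LocallyIntegrable θ := hθ.continuous.locallyIntegrable
  have hgb := norm_gradArr_le hθ
  have hgi : LocallyIntegrable (gradArr θ) := by
    intro x
    refine ⟨Metric.ball x 1, Metric.ball_mem_nhds x one_pos, ?_⟩
    exact Measure.integrableOn_of_bounded (M := Real.sqrt d * K) measure_ball_lt_top.ne
      (measurable_gradArr θ).aestronglyMeasurable (Eventually.of_forall hgb)
  obtain ⟨δ, hδ, hδU⟩ := hc.isCompact.exists_cthickening_subset_open hU hs
  have hsm : ∀ᶠ k : ℕ in atTop, 1 / ((k : ℝ) + 1) < δ :=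
    (tendsto_one_div_add_atTop_nhds_zero_nat (𝕜 := ℝ)).eventually_lt_const hδ
  have hrr : ∀ᶠ k in atTop, (bumpSeq d k).rOut ≤ 2 * (bumpSeq d k).rIn :=
    Eventually.of_forall fun k => by
      change 1 / ((k : ℝ) + 1) ≤ 2 * (1 / (2 * (k + 1)))
      apply le_of_eq; field_simp
  refine weak_eq_of_tendsto hH hF (θk := fun k => moll k θ) (M := max M (Real.sqrt d * K))
    (fun k => (contDiff_moll hli k).continuous) (fun k => Eventually.of_forall fun x => ?_)
    (fun k x => (norm_moll_le hM x).trans (le_max_left _ _)) ?_ ?_ ?_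
  · rw [gradArr_moll hθ]
    exact (norm_moll_le hgb x).trans (le_max_right _ _)
  · simp_rw [gradArr_moll hθ]
    exact ae_restrict_of_ae (ContDiffBump.ae_convolution_tendsto_right_of_locallyIntegrable
      (tendsto_bumpSeq_rOut d) hrr hgi)
  · exact Eventually.of_forall fun x => ContDiffBump.convolution_tendsto_right_of_continuous
      (tendsto_bumpSeq_rOut d) hθ.continuous x
  · filter_upwards [hsm] with k hk
    refine h _ (contDiff_moll hli k) (hasCompactSupport_moll hc k) ?_
    exact (tsupport_moll_subset k).trans ((Metric.cthickening_mono hk.le _).trans hδU)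

/-- A weak equation in a bounded open set may be tested with Lipschitz functions that vanish outside
the set. -/
lemma weak_eq_of_lipschitz {d m : ℕ} {U : Set (Eu d)} (hU : IsOpen U) (hUb : Bornology.IsBounded U)
    (hne : U ≠ univ)
    {H : Eu d → GradSp d m} {F : Eu d → Eu m} (hH : IntegrableOn H U) (hF : IntegrableOn F U)
    (h : ∀ φ : Eu d → Eu m, ContDiff ℝ ((⊤ : ℕ∞) : WithTop ℕ∞) φ → HasCompactSupport φ →
      tsupport φ ⊆ U → ∫ x in U, ⟪H x, gradArr φ x⟫_ℝ = ∫ x in U, ⟪F x, φ x⟫_ℝ)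
    {θ : Eu d → Eu m} {K : ℝ≥0} (hθ : LipschitzWith K θ) (h0 : ∀ x ∉ U, θ x = 0) :
    ∫ x in U, ⟪H x, gradArr θ x⟫_ℝ = ∫ x in U, ⟪F x, θ x⟫_ℝ := by
  have hcl : IsClosed Uᶜ := hU.isClosed_compl
  have hnc : (Uᶜ).Nonempty := nonempty_compl.2 hne
  set ρ : Eu d → ℝ := fun x => Metric.infDist x Uᶜ with hρ
  have hρL : LipschitzWith 1 ρ := Metric.lipschitz_infDist_pt _
  have hρ0 : ∀ x, 0 ≤ ρ x := fun x => Metric.infDist_nonneg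
  have hθρ : ∀ x, ‖θ x‖ ≤ K * ρ x := by
    intro x
    obtain ⟨y, hy, hxy⟩ := hcl.exists_infDist_eq_dist hnc x
    have := hθ.dist_le_mul x y
    rw [h0 y hy, dist_zero_right] at this
    rw [hρ]; simp only; rw [hxy]; exact this
  have hρU : ∀ x ∈ U, 0 < ρ x := fun x hx =>
    (hcl.notMem_iff_infDist_pos hnc).1 fun h => h hx
  -- This cutoff in the distance `ρ` to the complement vanishes for `ρ ≤ 1 / (k + 1)` and equals `1`
  -- for `ρ ≥ 2 / (k + 1)`. Its slope `k + 1` grows, but `θ` is at most `K ρ` in the transition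
  -- layer, so the gradients of `χ k • θ` stay bounded. No regularity of the boundary of `U` is
  -- needed.
  set χ : ℕ → Eu d → ℝ := fun k x => max 0 (min 1 ((k + 1) * ρ x - 1)) with hχ
  have hχL : ∀ k : ℕ, LipschitzWith (k + 1) (χ k) := by
    intro k
    have h1 : LipschitzWith (k + 1) fun x => (k + 1) * ρ x - 1 := by
      refine LipschitzWith.of_dist_le_mul fun x y => ?_
      have := hρL.dist_le_mul x y
      rw [dist_sub_right, Real.dist_eq, ← mul_sub, abs_mul, ← Real.dist_eq,
        abs_of_nonneg (by positivity : (0 : ℝ) ≤ k + 1)]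
      push_cast
      gcongr
      simpa using this
    exact (h1.const_min 1).const_max 0
  have hχ01 : ∀ k x, 0 ≤ χ k x ∧ χ k x ≤ 1 := fun k x =>
    ⟨le_max_left _ _, max_le zero_le_one (min_le_left _ _)⟩
  have hχ1 : ∀ (k : ℕ) x, 2 < (k + 1) * ρ x → χ k =ᶠ[𝓝 x] fun _ => 1 := by
    intro k x hx
    have hcont : Continuous fun y => ((k : ℝ) + 1) * ρ y := hρL.continuous.const_mul _
    filter_upwards [(isOpen_lt continuous_const hcont).mem_nhds hx] with y hy
    have : (2 : ℝ) < (k + 1) * ρ y := hy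
    simp only [hχ]
    rw [min_eq_left (by linarith), max_eq_right zero_le_one]
  have hχ0 : ∀ (k : ℕ) x, (k + 1) * ρ x ≤ 1 → χ k x = 0 := by
    intro k x hx
    exact max_eq_left ((min_le_right _ _).trans (by linarith))
  have hev : ∀ x ∈ U, ∀ᶠ k : ℕ in atTop, χ k =ᶠ[𝓝 x] fun _ => 1 := by
    intro x hx
    obtain ⟨N, hN⟩ := exists_nat_gt (2 / ρ x)
    filter_upwards [eventually_ge_atTop N] with k hk
    refine hχ1 k x ?_
    rw [div_lt_iff₀ (hρU x hx)] at hN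
    have : (N : ℝ) ≤ k + 1 := by exact_mod_cast Nat.le_succ_of_le hk
    nlinarith [hρU x hx]
  obtain ⟨R, hR⟩ := hUb.subset_closedBall (0 : Eu d)
  have hθb : ∃ M, ∀ x, ‖θ x‖ ≤ M := by
    have hcs : HasCompactSupport θ := HasCompactSupport.intro (isCompact_closedBall (0 : Eu d) R)
      fun x hx => h0 x fun hxU => hx (hR hxU)
    exact hcs.exists_bound_of_continuous hθ.continuous
  obtain ⟨M, hM⟩ := hθb
  have hLk : ∀ k, ∃ K', LipschitzWith K' fun x => χ k x • θ x := fun k =>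
    (hχL k).exists_smul_of_bounded hθ hUb fun x hx => hχ0 k x (by
      have : ρ x = 0 := Metric.infDist_zero_of_mem hx
      rw [this]; norm_num)
  refine weak_eq_of_tendsto hH hF (θk := fun k x => χ k x • θ x)
    (M := max M (3 * (Real.sqrt d * K))) (fun k => ?_) (fun k => ?_) (fun k x => ?_) ?_ ?_ ?_
  · exact (hχL k).continuous.smul hθ.continuous
  · filter_upwards [(hχL k).ae_differentiableAt, hθ.ae_differentiableAt] with x h1 h2
    refine le_trans ?_ (le_max_right _ _)
    have h3 := norm_gradArr_le hθ x
    by_cases hx : 2 < (k + 1) * ρ x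
    · have : (fun y => χ k y • θ y) =ᶠ[𝓝 x] θ := by
        filter_upwards [hχ1 k x hx] with y hy
        rw [hy, one_smul]
      rw [gradArr_congr this]
      have : 0 ≤ Real.sqrt d * K := by positivity
      linarith
    · rw [gradArr_smul h1 h2]
      refine (norm_add_le _ _).trans ?_
      have h4 : ‖χ k x • gradArr θ x‖ ≤ Real.sqrt d * K := by
        rw [norm_smul, Real.norm_of_nonneg (hχ01 k x).1]
        exact (mul_le_of_le_one_left (norm_nonneg _) (hχ01 k x).2).trans h3
      have h5 : ‖tensArr (fderiv ℝ (χ k) x) (θ x)‖ ≤ 2 * (Real.sqrt d * K) := by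
        refine (norm_tensArr_le _ _).trans ?_
        have h6 : ‖fderiv ℝ (χ k) x‖ ≤ k + 1 := by
          have := norm_fderiv_le_of_lipschitz ℝ (hχL k) (x₀ := x)
          exact_mod_cast this
        calc Real.sqrt d * ‖fderiv ℝ (χ k) x‖ * ‖θ x‖ ≤ Real.sqrt d * (k + 1) * (K * ρ x) := by
              gcongr; exact hθρ x
          _ = Real.sqrt d * K * ((k + 1) * ρ x) := by ring
          _ ≤ Real.sqrt d * K * 2 := by gcongr; exact not_lt.1 hx
          _ = _ := by ring
      linarith
  · rw [norm_smul, Real.norm_of_nonneg (hχ01 k x).1]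
    exact ((mul_le_of_le_one_left (norm_nonneg _) (hχ01 k x).2).trans (hM x)).trans (le_max_left _ _)
  · filter_upwards [ae_restrict_mem hU.measurableSet] with x hx
    refine tendsto_const_nhds.congr' ?_
    filter_upwards [hev x hx] with k hk
    refine (gradArr_congr ?_).symm
    filter_upwards [hk] with y hy
    rw [hy, one_smul]
  · filter_upwards [ae_restrict_mem hU.measurableSet] with x hx
    refine tendsto_const_nhds.congr' ?_
    filter_upwards [hev x hx] with k hk
    rw [hk.eq_of_nhds, one_smul]
  · refine Eventually.of_forall fun k => ?_
    obtain ⟨K', hK'⟩ := hLk k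
    have hsupp : tsupport (fun x => χ k x • θ x) ⊆ {x | 1 ≤ (k + 1) * ρ x} := by
      refine closure_minimal (fun x hx => ?_)
        (isClosed_le continuous_const (hρL.continuous.const_mul _))
      by_contra hlt
      exact hx (by simp only [hχ0 k x (not_le.1 hlt).le, zero_smul])
    have hsU : tsupport (fun x => χ k x • θ x) ⊆ U := by
      intro x hx
      by_contra hxU
      have h1 : 1 ≤ ((k : ℝ) + 1) * ρ x := hsupp hx
      have : ρ x = 0 := Metric.infDist_zero_of_mem hxU
      rw [this] at h1
      norm_num at h1
    refine weak_eq_of_hasCompactSupport hU hH hF h hK' ?_ hsU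
    exact (isCompact_closedBall (0 : Eu d) R).of_isClosed_subset (isClosed_tsupport _)
      (hsU.trans hR)

/-! ### Interior approximation of `H¹` functions. -/

section Approximation

variable {d m : ℕ} {F : Type*} [NormedAddCommGroup F]

/-- This is the continuity in `L²` of composition with a continuous family of measure preserving
maps, here the translations. -/
lemma tendsto_lintegral_translate_sub {h : Eu d → F} (hh : MemLp h 2 volume) :
    Tendsto (fun t => ∫⁻ x, ‖h (x - t) - h x‖ₑ ^ 2) (𝓝 0) (𝓝 0) := by
  let G : C(Eu d × Eu d, Eu d) := ⟨fun p => p.2 - p.1, by fun_prop⟩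
  have hG : Tendsto G.curry (𝓝 0) (𝓝 (G.curry 0)) := G.curry.continuous.tendsto 0
  have hmp : ∀ t, MeasurePreserving (G.curry t) volume volume := fun t =>
    measurePreserving_sub_right volume t
  have hT := Filter.Tendsto.compMeasurePreservingLp (E := F) (p := 2) (μ := volume) (ν := volume)
    (tendsto_const_nhds (x := hh.toLp h)) hG hmp (hmp 0) (by simp)
  simp_rw [Lp.toLp_compMeasurePreserving] at hT
  rw [tendsto_iff_edist_tendsto_0] at hT
  simp_rw [Lp.edist_toLp_toLp] at hT
  have h2 := ENNReal.Tendsto.pow (n := 2) hT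
  rw [zero_pow two_ne_zero] at h2
  refine h2.congr fun t => ?_
  rw [eLpNorm_two_sq]
  refine lintegral_congr fun x => ?_
  simp [G]

variable [NormedSpace ℝ F]

lemma integrable_comp_sub_left {h : Eu d → F} (hh : LocallyIntegrable h) (k : ℕ) (x : Eu d) :
    Integrable (fun t => h (x - t)) (mollMeasure d k) := by
  rw [mollMeasure, integrable_withDensity_iff_integrable_smul (measurable_normed_toNNReal d k)]
  have := (bumpSeq d k).hasCompactSupport_normed (μ := volume) |>.convolutionExists_left
    (ContinuousLinearMap.lsmul ℝ ℝ) (bumpSeq d k).continuous_normed hh x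
  refine this.congr (Eventually.of_forall fun t => ?_)
  simp only [ContinuousLinearMap.lsmul_apply, NNReal.smul_def,
    Real.coe_toNNReal _ ((bumpSeq d k).nonneg_normed t)]

lemma moll_congr {h h' : Eu d → F} (hh : h =ᵐ[volume] h') (k : ℕ) : moll k h = moll k h' := by
  ext1 x
  rw [moll_eq, moll_eq]
  exact integral_congr_ae ((quasiMeasurePreserving_sub_left x).ae_eq_comp hh)

/-- Jensen's inequality for the mollification measure, then Tonelli. The inner integrals on the
right are small by continuity of translations. -/
lemma lintegral_moll_sub_le [CompleteSpace F] {h : Eu d → F} (hh : MemLp h 2 volume)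
    (hs : StronglyMeasurable h) (k : ℕ) :
    ∫⁻ x, ‖moll k h x - h x‖ₑ ^ 2 ≤
      ∫⁻ t, ∫⁻ x, ‖h (x - t) - h x‖ₑ ^ 2 ∂volume ∂mollMeasure d k := by
  have hli : LocallyIntegrable h := hh.locallyIntegrable (by norm_num)
  have hm : StronglyMeasurable fun z : Eu d × Eu d => h (z.2 - z.1) - h z.2 :=
    (hs.comp_measurable (by fun_prop)).sub (hs.comp_measurable measurable_snd)
  rw [lintegral_lintegral_swap (by exact (hm.enorm.pow_const 2).aemeasurable)]
  refine lintegral_mono fun x => ?_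
  have h1 : moll k h x - h x = ∫ t, (h (x - t) - h x) ∂mollMeasure d k := by
    rw [integral_sub (integrable_comp_sub_left hli k x) (integrable_const _), moll_eq]
    simp
  rw [h1]
  have hmx : StronglyMeasurable fun t => h (x - t) - h x :=
    hm.comp_measurable (g := fun t => (t, x)) (by fun_prop)
  calc _ ≤ (∫⁻ t, ‖h (x - t) - h x‖ₑ ∂mollMeasure d k) ^ 2 := by
        gcongr
        exact enorm_integral_le_lintegral_enorm _
    _ = (∫⁻ t, ‖‖h (x - t) - h x‖‖ₑ ∂mollMeasure d k) ^ 2 := by simp only [enorm_norm]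
    _ ≤ ∫⁻ t, ‖‖h (x - t) - h x‖‖ₑ ^ 2 ∂mollMeasure d k :=
        lintegral_sq_le_of_prob hmx.norm.aestronglyMeasurable
    _ = _ := by simp only [enorm_norm]

lemma tendsto_eLpNorm_moll_sub [CompleteSpace F] {h : Eu d → F} (hh : MemLp h 2 volume) :
    Tendsto (fun k => eLpNorm (fun x => moll k h x - h x) 2 volume) atTop (𝓝 0) := by
  set h' := hh.1.mk h with hh'
  have hae : h =ᵐ[volume] h' := hh.1.ae_eq_mk
  have hs : StronglyMeasurable h' := hh.1.stronglyMeasurable_mk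
  have hL : MemLp h' 2 volume := hh.ae_eq hae
  have key : Tendsto (fun k => ∫⁻ x, ‖moll k h' x - h' x‖ₑ ^ 2) atTop (𝓝 0) := by
    rw [ENNReal.tendsto_nhds_zero]
    intro e he
    have h1 := (ENNReal.tendsto_nhds_zero.1 (tendsto_lintegral_translate_sub hL)) e he
    obtain ⟨r, hr, hr'⟩ := Metric.eventually_nhds_iff.1 h1
    filter_upwards [(tendsto_one_div_add_atTop_nhds_zero_nat (𝕜 := ℝ)).eventually_lt_const hr]
      with k hk
    calc _ ≤ _ := lintegral_moll_sub_le hL hs k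
      _ ≤ ∫⁻ _, e ∂mollMeasure d k := by
          refine lintegral_mono_ae ?_
          filter_upwards [ae_mollMeasure_norm_lt d k] with t ht
          exact hr' (by rw [dist_zero_right]; exact ht.trans hk)
      _ = e := by simp
  have h2 : Tendsto (fun k => (∫⁻ x, ‖moll k h' x - h' x‖ₑ ^ 2) ^ (1 / 2 : ℝ)) atTop (𝓝 0) := by
    have := key.ennrpow_const (1 / 2)
    rwa [ENNReal.zero_rpow_of_pos (by norm_num)] at this
  refine h2.congr fun k => ?_
  rw [moll_congr hae k, ← eLpNorm_two_sq, ← ENNReal.rpow_natCast, ← ENNReal.rpow_mul]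
  norm_num
  refine eLpNorm_congr_ae ?_
  filter_upwards [hae] with x hx
  rw [hx]

/-- Away from the boundary the classical gradient of the mollification of an `H^1` function is the
mollification of its weak gradient. -/
lemma IsH1.gradArr_moll {U : Set (Eu d)} (hU : IsOpen U) {u : Eu d → Eu m} {Du : Eu d → GradSp d m}
    (h : IsH1 U u Du) {k : ℕ} {x : Eu d} (hx : Metric.closedBall x (1 / (k + 1)) ⊆ U) :
    gradArr (moll k (U.indicator u)) x = moll k (U.indicator Du) x := by
  have hUm := hU.measurableSet
  set ρ := (bumpSeq d k).normed volume with hρ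
  have hρc : HasCompactSupport ρ := (bumpSeq d k).hasCompactSupport_normed
  have hρd : ContDiff ℝ ((⊤ : ℕ∞) : WithTop ℕ∞) ρ := (bumpSeq d k).contDiff_normed
  have hul : LocallyIntegrable (U.indicator u) :=
    ((memLp_indicator_iff_restrict hUm).2 h.memLp).locallyIntegrable (by norm_num)
  have hDl : LocallyIntegrable (U.indicator Du) :=
    ((memLp_indicator_iff_restrict hUm).2 h.memLp_grad).locallyIntegrable (by norm_num)
  -- The derivative is placed on the kernel. The definition of the weak gradient, tested with `t ↦ ρ
  -- (x - t)`, then moves it to `u`.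
  have hd := hρc.hasFDerivAt_convolution_left (μ := volume) (ContinuousLinearMap.lsmul ℝ ℝ)
    (hρd.of_le (by exact_mod_cast le_top)) hul x
  have hdi := (hρc.fderiv (𝕜 := ℝ)).convolutionExists_left
    ((ContinuousLinearMap.lsmul ℝ ℝ : ℝ →L[ℝ] Eu m →L[ℝ] Eu m).precompL (Eu d))
    (hρd.continuous_fderiv (by simp)) hul x
  rw [gradArr_eq, moll, hd.fderiv]
  ext ⟨i, α⟩
  have hφ : ContDiff ℝ ((⊤ : ℕ∞) : WithTop ℕ∞) fun t => ρ (x - t) :=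
    hρd.comp (contDiff_const.sub contDiff_id)
  have hs : tsupport (fun t => ρ (x - t)) ⊆ Metric.closedBall x (1 / (k + 1)) := by
    refine closure_minimal (fun t ht => ?_) Metric.isClosed_closedBall
    have : x - t ∈ Function.support ρ := ht
    rw [hρ, (bumpSeq d k).support_normed_eq, mem_ball_zero_iff, bumpSeq_rOut] at this
    rw [Metric.mem_closedBall', dist_eq_norm]
    exact this.le
  have hw := h.weak _ hφ ((isCompact_closedBall _ _).of_isClosed_subset (isClosed_tsupport _) hs)
    (hs.trans hx) i α
  have hfd : ∀ t, fderiv ℝ (fun t => ρ (x - t)) t = - fderiv ℝ ρ (x - t) := fun t => by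
    have h1 := ((hρd.differentiable (by simp)) (x - t)).hasFDerivAt.comp t
      ((hasFDerivAt_id t).const_sub x)
    have h2 := h1.fderiv
    simpa [Function.comp_def] using h2
  let P : (Eu d →L[ℝ] Eu m) →L[ℝ] ℝ := (EuclideanSpace.proj α : Eu m →L[ℝ] ℝ).comp
    (ContinuousLinearMap.apply ℝ (Eu m) (EuclideanSpace.single i (1 : ℝ)))
  have hL : arrL d m (convolution (fderiv ℝ ρ) (U.indicator u)
      ((ContinuousLinearMap.lsmul ℝ ℝ).precompL (Eu d)) volume x) (i, α) =
      ∫ t in U, u t α * fderiv ℝ ρ (x - t) (EuclideanSpace.single i 1) := by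
    change P _ = _
    rw [← ContinuousLinearMap.integral_comp_comm P hdi, ← integral_indicator hUm,
      ← integral_sub_left_eq_self _ volume x]
    refine integral_congr_ae (Eventually.of_forall fun t => ?_)
    by_cases ht : t ∈ U <;> simp [P, ht, mul_comm]
  have hR : moll k (U.indicator Du) x (i, α) = ∫ t in U, Du t (i, α) * ρ (x - t) := by
    have hdi' := hρc.convolutionExists_left (ContinuousLinearMap.lsmul ℝ ℝ) hρd.continuous hDl x
    change (EuclideanSpace.proj (i, α) : GradSp d m →L[ℝ] ℝ) _ = _
    rw [moll, convolution_def, ← ContinuousLinearMap.integral_comp_comm _ hdi',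
      ← integral_indicator hUm, ← integral_sub_left_eq_self _ volume x]
    refine integral_congr_ae (Eventually.of_forall fun t => ?_)
    by_cases ht : t ∈ U <;> simp [ht, mul_comm, hρ]
  rw [hL, hR]
  simp only [hfd, neg_apply, mul_neg, integral_neg, neg_inj] at hw
  exact hw

/-- Interior approximation of `H^1` functions by Lipschitz functions. -/
lemma IsH1.hasBoundaryValue_empty {U V : Set (Eu d)} (hU : IsOpen U) (hUb : Bornology.IsBounded U)
    {u : Eu d → Eu m} {Du : Eu d → GradSp d m} (h : IsH1 U u Du) {r : ℝ} (hr : 0 < r)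
    (hV : MeasurableSet V) (hVU : Metric.thickening r V ⊆ U) (g : Eu d → Eu m) :
    HasBoundaryValue V ∅ u Du g := by
  have hUm := hU.measurableSet
  have hVU' : V ⊆ U := (Metric.self_subset_thickening hr V).trans hVU
  have hu : MemLp (U.indicator u) 2 volume := (memLp_indicator_iff_restrict hUm).2 h.memLp
  have hD : MemLp (U.indicator Du) 2 volume := (memLp_indicator_iff_restrict hUm).2 h.memLp_grad
  have hc : HasCompactSupport (U.indicator u) := by
    obtain ⟨R, hR⟩ := hUb.subset_closedBall (0 : Eu d)
    exact HasCompactSupport.intro (isCompact_closedBall (0 : Eu d) R) fun x hx =>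
      indicator_of_notMem (fun hxU => hx (hR hxU)) _
  -- The sequence starts at index `N` so that every mollification radius is below the distance `r`
  -- from `V` to the complement of `U`.
  obtain ⟨N, hN⟩ := eventually_atTop.1
    ((tendsto_one_div_add_atTop_nhds_zero_nat (𝕜 := ℝ)).eventually_lt_const hr)
  refine ⟨fun k => moll (k + N) (U.indicator u), fun k => ?_, fun k => by simp, ?_, ?_⟩
  · exact ((contDiff_moll (hu.locallyIntegrable (by norm_num)) _).of_le
      (by exact_mod_cast le_top)).lipschitzWith_of_hasCompactSupport
      (hasCompactSupport_moll hc _) (n := 1) (by simp)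
  · have := (tendsto_eLpNorm_moll_sub hu).comp (tendsto_add_atTop_nat N)
    refine tendsto_of_tendsto_of_tendsto_of_le_of_le tendsto_const_nhds this
      (fun _ => zero_le) fun k => ?_
    refine le_trans (le_of_eq ?_) (eLpNorm_mono_measure _ (Measure.restrict_le_self (s := V)))
    refine eLpNorm_congr_ae ?_
    filter_upwards [ae_restrict_mem hV] with x hx
    rw [indicator_of_mem (hVU' hx)]
  · have := (tendsto_eLpNorm_moll_sub hD).comp (tendsto_add_atTop_nat N)
    refine tendsto_of_tendsto_of_tendsto_of_le_of_le tendsto_const_nhds this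
      (fun _ => zero_le) fun k => ?_
    refine le_trans (le_of_eq ?_) (eLpNorm_mono_measure _ (Measure.restrict_le_self (s := V)))
    refine eLpNorm_congr_ae ?_
    filter_upwards [ae_restrict_mem hV] with x hx
    rw [h.gradArr_moll hU, indicator_of_mem (hVU' hx)]
    intro y hy
    refine hVU (Metric.mem_thickening_iff.2 ⟨x, hx, ?_⟩)
    exact (Metric.mem_closedBall.1 hy).trans_lt (hN (k + N) (Nat.le_add_left _ _))

end Approximation

/-! ### Elliptic forms and the pointwise energy inequality. -/

section TensorForm

variable {d m : ℕ}

/-- The array `a_{ij}^{αβ} ξ_j^β`. -/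
def tensApply (a : Tensor d m) (ξ : GradSp d m) : GradSp d m :=
  WithLp.toLp 2 fun p => ∑ q, a p q * ξ q

lemma tensorForm_eq_inner (a : Tensor d m) (ξ η : GradSp d m) :
    tensorForm a ξ η = ⟪tensApply a ξ, η⟫_ℝ := by
  simp only [tensorForm, tensApply, PiLp.inner_apply, RCLike.inner_apply, conj_trivial]
  refine Finset.sum_congr rfl fun p _ => ?_
  rw [Finset.mul_sum]
  exact Finset.sum_congr rfl fun q _ => by ring

lemma tensorForm_comm {a : Tensor d m} (ha : ∀ p q, a p q = a q p) (ξ η : GradSp d m) :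
    tensorForm a ξ η = tensorForm a η ξ := by
  rw [tensorForm, Finset.sum_comm, tensorForm]
  refine Finset.sum_congr rfl fun p _ => Finset.sum_congr rfl fun q _ => ?_
  rw [ha q p]; ring

/-- Symmetric elliptic tensors with constant `μ`. -/
def IsElliptic (μ : ℝ) (a : Tensor d m) : Prop :=
  (∀ p q, a p q = a q p) ∧
    ∀ ξ, μ * ‖ξ‖ ^ 2 ≤ tensorForm a ξ ξ ∧ tensorForm a ξ ξ ≤ μ⁻¹ * ‖ξ‖ ^ 2

variable {μ : ℝ} {a : Tensor d m}

/-- Cauchy–Schwarz for the nonnegative symmetric form, by the discriminant of `t ↦ a (ξ + t η, ξ + t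
η)`, followed by the upper ellipticity bound. -/
lemma IsElliptic.abs_tensorForm_le (h : IsElliptic μ a) (hμ : 0 < μ) (ξ η : GradSp d m) :
    |tensorForm a ξ η| ≤ μ⁻¹ * (‖ξ‖ * ‖η‖) := by
  have hpos : ∀ ζ, 0 ≤ tensorForm a ζ ζ := fun ζ => le_trans (by positivity) (h.2 ζ).1
  have hexp : ∀ t : ℝ, 0 ≤ tensorForm a η η * (t * t) + 2 * tensorForm a ξ η * t +
      tensorForm a ξ ξ := by
    intro t
    have h1 : tensorForm a (ξ + t • η) (ξ + t • η) = tensorForm a η η * (t * t) +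
        2 * tensorForm a ξ η * t + tensorForm a ξ ξ := by
      have h2 : tensorForm a (ξ + t • η) (ξ + t • η) = tensorForm a ξ ξ + t * tensorForm a ξ η +
          (t * tensorForm a η ξ + t * t * tensorForm a η η) := by
        simp only [tensorForm, PiLp.add_apply, PiLp.smul_apply, smul_eq_mul, Finset.mul_sum,
          ← Finset.sum_add_distrib]
        refine Finset.sum_congr rfl fun p _ => Finset.sum_congr rfl fun q _ => ?_
        ring
      rw [h2, tensorForm_comm h.1 η ξ]; ring
    rw [← h1]; exact hpos _
  have hd := discrim_le_zero hexp
  rw [discrim] at hd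
  refine abs_le_of_sq_le_sq ?_ (by positivity)
  have h1 : tensorForm a ξ η ^ 2 ≤ tensorForm a ξ ξ * tensorForm a η η := by nlinarith
  calc _ ≤ (μ⁻¹ * ‖ξ‖ ^ 2) * (μ⁻¹ * ‖η‖ ^ 2) :=
        h1.trans (mul_le_mul (h.2 ξ).2 (h.2 η).2 (hpos η) (by positivity))
    _ = _ := by ring

lemma IsElliptic.norm_tensApply_le (h : IsElliptic μ a) (hμ : 0 < μ) (ξ : GradSp d m) :
    ‖tensApply a ξ‖ ≤ μ⁻¹ * ‖ξ‖ := by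
  have h1 := (le_abs_self _).trans (h.abs_tensorForm_le hμ ξ (tensApply a ξ))
  rw [tensorForm_eq_inner, real_inner_self_eq_norm_sq] at h1
  by_contra! h2
  have h3 : 0 < ‖tensApply a ξ‖ := lt_of_le_of_lt (by positivity) h2
  nlinarith

/-- The pointwise inequality behind the energy estimates. -/
lemma IsElliptic.energy_le (h : IsElliptic μ a) (hμ : 0 < μ) {z s : ℝ} (hs : s ≠ 0)
    (ξ η ζ Z : GradSp d m) (f φ : Eu m) :
    ‖z • ξ‖ ^ 2 ≤ 2 / μ * (tensorForm a ξ (z ^ 2 • (η - ζ) + (2 * z) • Z) - ⟪f, z ^ 2 • φ⟫_ℝ) +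
      (2 / μ * (8 / μ ^ 3 + 1)) * (s ^ 2 * ‖z • f‖ ^ 2 + (s ^ 2)⁻¹ * ‖z • φ‖ ^ 2 + ‖z • ζ‖ ^ 2
        + ‖Z‖ ^ 2 + ‖z • (η - ξ)‖ ^ 2) := by
  -- Here `η` is the gradient of the Lipschitz approximation and `ξ` the weak gradient. Replacing
  -- `η` by `ξ + (η - ξ)` isolates the coercive term and leaves an approximation error.
  have e1 : tensorForm a ξ (z ^ 2 • (η - ζ) + (2 * z) • Z) =
      z ^ 2 * tensorForm a ξ ξ + z * tensorForm a ξ (z • (η - ξ)) - z * tensorForm a ξ (z • ζ)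
        + 2 * z * tensorForm a ξ Z := by
    simp only [tensorForm_eq_inner, inner_add_right, inner_smul_right, inner_sub_right]
    ring
  have b : ∀ w, |z * tensorForm a ξ w| ≤ μ⁻¹ * (‖z • ξ‖ * ‖w‖) := fun w => by
    rw [abs_mul, norm_smul, Real.norm_eq_abs]
    calc _ ≤ |z| * (μ⁻¹ * (‖ξ‖ * ‖w‖)) := by gcongr; exact h.abs_tensorForm_le hμ ξ w
      _ = _ := by ring
  have b1 := abs_le.1 (b (z • (η - ξ)))
  have b2 := abs_le.1 (b (z • ζ))
  have b3 := abs_le.1 (b Z)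
  have b4 : μ * ‖z • ξ‖ ^ 2 ≤ z ^ 2 * tensorForm a ξ ξ := by
    rw [norm_smul, mul_pow, Real.norm_eq_abs, sq_abs]
    nlinarith [(h.2 ξ).1, sq_nonneg z]
  have b5 : ⟪f, z ^ 2 • φ⟫_ℝ ≤ ‖z • f‖ * ‖z • φ‖ := by
    have : ⟪f, z ^ 2 • φ⟫_ℝ = ⟪z • f, z • φ⟫_ℝ := by
      rw [inner_smul_right, inner_smul_right, real_inner_smul_left]; ring
    rw [this]; exact real_inner_le_norm _ _
  have b6 : ‖z • f‖ * ‖z • φ‖ ≤ s ^ 2 * ‖z • f‖ ^ 2 + (s ^ 2)⁻¹ * ‖z • φ‖ ^ 2 := by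
    have h1 : (s * ‖z • f‖) * (s⁻¹ * ‖z • φ‖) = ‖z • f‖ * ‖z • φ‖ := by field_simp
    rw [← inv_pow, ← mul_pow, ← mul_pow]
    nlinarith [sq_nonneg (s * ‖z • f‖ - s⁻¹ * ‖z • φ‖), sq_nonneg (s * ‖z • f‖),
      sq_nonneg (s⁻¹ * ‖z • φ‖)]
  rw [e1]
  set X := ‖z • ξ‖
  set q := ‖z • (η - ξ)‖
  set hh := ‖z • ζ‖
  set zz := ‖Z‖
  set ff := s ^ 2 * ‖z • f‖ ^ 2 + (s ^ 2)⁻¹ * ‖z • φ‖ ^ 2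
  have hff : 0 ≤ ff := by positivity
  -- There are three cross terms, each costing `μ / 8 * X ^ 2`. Together they take less than half of
  -- the coercive `μ * X ^ 2`.
  have amgm : ∀ y : ℝ, μ⁻¹ * (X * y) ≤ μ / 8 * X ^ 2 + 2 / μ ^ 3 * y ^ 2 := by
    intro y
    have : 0 ≤ μ / 8 * (X - 4 / μ ^ 2 * y) ^ 2 := by positivity
    have e : μ / 8 * (X - 4 / μ ^ 2 * y) ^ 2 =
        μ / 8 * X ^ 2 + 2 / μ ^ 3 * y ^ 2 - μ⁻¹ * (X * y) := by field_simp; ring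
    linarith
  have amgm2 : μ⁻¹ * (X * (2 * zz)) ≤ μ / 8 * X ^ 2 + 8 / μ ^ 3 * zz ^ 2 := by
    have := amgm (2 * zz)
    have e : 2 / μ ^ 3 * (2 * zz) ^ 2 = 8 / μ ^ 3 * zz ^ 2 := by ring
    linarith
  have a1 := amgm q
  have a2 := amgm hh
  have hc : 0 < 1 / μ ^ 3 := by positivity
  have e2 : 2 / μ ^ 3 = 2 * (1 / μ ^ 3) := by ring
  have e8 : 8 / μ ^ 3 = 8 * (1 / μ ^ 3) := by ring
  rw [e8] at amgm2 ⊢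
  rw [e2] at a1 a2
  set c := 1 / μ ^ 3
  have key : μ / 2 * X ^ 2 ≤ (z ^ 2 * tensorForm a ξ ξ + z * tensorForm a ξ (z • (η - ξ))
      - z * tensorForm a ξ (z • ζ) + 2 * z * tensorForm a ξ Z - ⟪f, z ^ 2 • φ⟫_ℝ) +
      (8 * c + 1) * (ff + hh ^ 2 + zz ^ 2 + q ^ 2) := by
    nlinarith [mul_nonneg hc.le hff, mul_nonneg hc.le (sq_nonneg hh),
      mul_nonneg hc.le (sq_nonneg q), mul_nonneg hc.le (sq_nonneg zz), sq_nonneg hh, sq_nonneg zz,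
      sq_nonneg q]
  have := mul_le_mul_of_nonneg_left key (by positivity : 0 ≤ 2 / μ)
  have e : 2 / μ * (μ / 2 * X ^ 2) = X ^ 2 := by field_simp
  rw [e] at this
  linarith

end TensorForm

/-! ### Integrated energy inequality. -/

/-- The tensor field `a` is elliptic, `0 ≤ Λ ≤ 1`, and `Du` satisfies the weak form of
`-div (Λ a Du) = Λ f` in the bounded open set `U`, tested with Lipschitz functions that vanish
outside `U`. -/
structure WeakSol {d m : ℕ} (μ : ℝ) (Λ : Eu d → ℝ) (a : Eu d → Tensor d m) (U : Set (Eu d))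
    (Du : Eu d → GradSp d m) (f : Eu d → Eu m) : Prop where
  isOpen : IsOpen U
  bounded : Bornology.IsBounded U
  elliptic : ∀ x, IsElliptic μ (a x)
  measurable_contrast : Measurable Λ
  contrast_mem : ∀ x, 0 ≤ Λ x ∧ Λ x ≤ 1
  memLp_grad : MemLp Du 2 (volume.restrict U)
  memLp_source : MemLp f 2 (volume.restrict U)
  integrable : ∀ (θ : Eu d → Eu m) (K : ℝ≥0), LipschitzWith K θ →
    IntegrableOn (fun x => Λ x * tensorForm (a x) (Du x) (gradArr θ x)) U ∧
      IntegrableOn (fun x => Λ x * ⟪f x, θ x⟫_ℝ) U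
  weak : ∀ (θ : Eu d → Eu m) (K : ℝ≥0), LipschitzWith K θ → (∀ x ∉ U, θ x = 0) →
    ∫ x in U, Λ x * tensorForm (a x) (Du x) (gradArr θ x) = ∫ x in U, Λ x * ⟪f x, θ x⟫_ℝ

/-- In the application `q` is the tested equation, whose integral vanishes. Integrability of `g` is
not required: if its integral is infinite the claim is trivial. -/
lemma lintegral_ofReal_le_of_le_add {α : Type*} [MeasurableSpace α] {ν : Measure α} {p q g : α → ℝ}
    (hp : ∀ᵐ x ∂ν, 0 ≤ p x) (hg : ∀ᵐ x ∂ν, 0 ≤ g x) (hgm : AEStronglyMeasurable g ν)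
    (hq : Integrable q ν) (hq0 : ∫ x, q x ∂ν = 0) (h : ∀ᵐ x ∂ν, p x ≤ q x + g x) :
    ∫⁻ x, ENNReal.ofReal (p x) ∂ν ≤ ∫⁻ x, ENNReal.ofReal (g x) ∂ν := by
  by_cases htop : ∫⁻ x, ENNReal.ofReal (g x) ∂ν = ∞
  · rw [htop]; exact le_top
  have hgi : Integrable g ν := by
    refine ⟨hgm, ?_⟩
    rw [hasFiniteIntegral_iff_ofReal hg]
    exact lt_top_iff_ne_top.2 htop
  calc _ ≤ ∫⁻ x, ENNReal.ofReal (q x + g x) ∂ν := lintegral_mono_ae (by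
        filter_upwards [h] with x hx using ENNReal.ofReal_le_ofReal hx)
    _ = ENNReal.ofReal (∫ x, (q x + g x) ∂ν) := by
        refine (ofReal_integral_eq_lintegral_ofReal (hq.add hgi) ?_).symm
        filter_upwards [h, hp] with x hx hpx using hpx.trans hx
    _ = ENNReal.ofReal (∫ x, g x ∂ν) := by rw [integral_add hq hgi, hq0, zero_add]
    _ = _ := ofReal_integral_eq_lintegral_ofReal hgi hg

/-- The constant in the energy estimate. -/
def energyConst (μ : ℝ) : ℝ≥0 := (2 / μ * (8 / μ ^ 3 + 1)).toNNReal

/-- Multiply `IsElliptic.energy_le` by `Λ` and integrate: the terms containing `θ` form the weak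
equation and cancel. The set `S` is where the test function lives, and the length `s` balances the
product of `f` and `φ`. -/
lemma WeakSol.energy {d m : ℕ} {μ : ℝ} (hμ : 0 < μ) {Λ : Eu d → ℝ} {a : Eu d → Tensor d m}
    {U : Set (Eu d)} {Du : Eu d → GradSp d m} {f : Eu d → Eu m} (h : WeakSol μ Λ a U Du f)
    {S : Set (Eu d)} (hS : MeasurableSet S) (hSU : S ⊆ U) {θ : Eu d → Eu m} {K : ℝ≥0}
    (hθ : LipschitzWith K θ) (h0 : ∀ x ∉ U, θ x = 0) {ζ : Eu d → ℝ} {φ : Eu d → Eu m}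
    {W H Z : Eu d → GradSp d m} (hζ : Measurable ζ) (hφ : Measurable φ) (hW : Measurable W)
    (hH : Measurable H) (hZ : Measurable Z)
    (h1 : ∀ᵐ x ∂volume.restrict S, gradArr θ x = ζ x ^ 2 • (W x - H x) + (2 * ζ x) • Z x)
    (h2 : ∀ x ∈ S, θ x = ζ x ^ 2 • φ x)
    (h3 : ∀ᵐ x ∂volume.restrict (U \ S), gradArr θ x = 0 ∧ θ x = 0) {s : ℝ} (hs : s ≠ 0) :
    ∫⁻ x in S, ENNReal.ofReal (Λ x) * ‖ζ x • Du x‖ₑ ^ 2 ≤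
      energyConst μ * ∫⁻ x in S, ENNReal.ofReal (Λ x) * (ENNReal.ofReal (s ^ 2) * ‖ζ x • f x‖ₑ ^ 2 +
        ENNReal.ofReal (s ^ 2)⁻¹ * ‖ζ x • φ x‖ₑ ^ 2 + ‖ζ x • H x‖ₑ ^ 2 + ‖Z x‖ₑ ^ 2 +
        ‖ζ x • (W x - Du x)‖ₑ ^ 2) := by
  have hUm := h.isOpen.measurableSet
  have hDum : AEStronglyMeasurable Du (volume.restrict S) :=
    h.memLp_grad.1.mono_measure (Measure.restrict_mono hSU le_rfl)
  have hfm : AEStronglyMeasurable f (volume.restrict S) :=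
    h.memLp_source.1.mono_measure (Measure.restrict_mono hSU le_rfl)
  obtain ⟨i1, i2⟩ := h.integrable θ K hθ
  have hw := h.weak θ K hθ h0
  set q : Eu d → ℝ := fun x => 2 / μ * (Λ x * tensorForm (a x) (Du x) (gradArr θ x)
    - Λ x * ⟪f x, θ x⟫_ℝ) with hq
  have hqi : IntegrableOn q U := (i1.sub i2).const_mul _
  have hq0 : ∫ x in S, q x = 0 := by
    have e1 : ∫ x in U, q x = 0 := by
      rw [hq, integral_const_mul, integral_sub i1 i2, hw, sub_self, mul_zero]
    rw [← e1]
    refine (setIntegral_eq_of_subset_of_ae_sdiff_eq_zero hUm.nullMeasurableSet hSU ?_).symm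
    filter_upwards [(ae_restrict_iff' (hUm.diff hS)).1 h3] with x hx hxm
    simp [hq, (hx hxm).1, (hx hxm).2, tensorForm_eq_inner]
  set g : Eu d → ℝ := fun x => (2 / μ * (8 / μ ^ 3 + 1)) * (Λ x * (s ^ 2 * ‖ζ x • f x‖ ^ 2 +
    (s ^ 2)⁻¹ * ‖ζ x • φ x‖ ^ 2 + ‖ζ x • H x‖ ^ 2 + ‖Z x‖ ^ 2 + ‖ζ x • (W x - Du x)‖ ^ 2)) with hg
  have hζm := hζ.aestronglyMeasurable (μ := volume.restrict S)
  have hgm : AEStronglyMeasurable g (volume.restrict S) := by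
    refine AEStronglyMeasurable.const_mul (h.measurable_contrast.aestronglyMeasurable.mul ?_) _
    refine ((((AEStronglyMeasurable.const_mul ?_ _).add (AEStronglyMeasurable.const_mul ?_ _)).add
      ?_).add ?_).add ?_
    · exact (hζm.smul hfm).norm.pow 2
    · exact (hζm.smul hφ.aestronglyMeasurable).norm.pow 2
    · exact (hζm.smul hH.aestronglyMeasurable).norm.pow 2
    · exact hZ.aestronglyMeasurable.norm.pow 2
    · exact (hζm.smul (hW.aestronglyMeasurable.sub hDum)).norm.pow 2
  have key := lintegral_ofReal_le_of_le_add (ν := volume.restrict S)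
    (p := fun x => Λ x * ‖ζ x • Du x‖ ^ 2) (q := q) (g := g)
    (Eventually.of_forall fun x => mul_nonneg (h.contrast_mem x).1 (by positivity))
    (Eventually.of_forall fun x => mul_nonneg (by positivity)
      (mul_nonneg (h.contrast_mem x).1 (by positivity))) hgm (hqi.mono_set hSU) hq0 (by
        filter_upwards [h1, ae_restrict_mem hS] with x hx hxS
        have := mul_le_mul_of_nonneg_left ((h.elliptic x).energy_le hμ hs (z := ζ x) (Du x) (W x)
          (H x) (Z x) (f x) (φ x)) (h.contrast_mem x).1
        rw [← hx, ← h2 x hxS] at this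
        simp only [hq, hg]
        linarith)
  have hsq : ∀ {E : Type} [NormedAddCommGroup E] (v : E), ENNReal.ofReal (‖v‖ ^ 2) = ‖v‖ₑ ^ 2 :=
    fun v => by rw [ENNReal.ofReal_pow (norm_nonneg _), ofReal_norm]
  calc _ = ∫⁻ x in S, ENNReal.ofReal (Λ x * ‖ζ x • Du x‖ ^ 2) := lintegral_congr fun x => by
        rw [ENNReal.ofReal_mul (h.contrast_mem x).1, hsq]
    _ ≤ _ := key
    _ = ∫⁻ x in S, energyConst μ * (ENNReal.ofReal (Λ x) *
        (ENNReal.ofReal (s ^ 2) * ‖ζ x • f x‖ₑ ^ 2 +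
        ENNReal.ofReal (s ^ 2)⁻¹ * ‖ζ x • φ x‖ₑ ^ 2 + ‖ζ x • H x‖ₑ ^ 2 + ‖Z x‖ₑ ^ 2 +
        ‖ζ x • (W x - Du x)‖ₑ ^ 2)) := lintegral_congr fun x => by
        simp only [hg]
        rw [ENNReal.ofReal_mul (p := 2 / μ * (8 / μ ^ 3 + 1)) (by positivity),
          ENNReal.ofReal_mul (h.contrast_mem x).1,
          ENNReal.ofReal_add (by positivity) (by positivity),
          ENNReal.ofReal_add (by positivity) (by positivity),
          ENNReal.ofReal_add (by positivity) (by positivity),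
          ENNReal.ofReal_add (by positivity) (by positivity),
          ENNReal.ofReal_mul (p := s ^ 2) (by positivity),
          ENNReal.ofReal_mul (p := (s ^ 2)⁻¹) (by positivity), hsq, hsq, hsq,
          hsq, hsq]
        rfl
    _ = _ := lintegral_const_mul' _ _ ENNReal.coe_ne_top

/-! ### Geometry of the inclusions and of the contrast. -/

section Cells

variable {d m : ℕ} {Ω ω : Set (Eu d)} {κ ε δ : ℝ}

lemma isOpen_cellInclusion (hω : IsOpen ω) (hε : 0 < ε) (n : Fin d → ℤ) :
    IsOpen (cellInclusion ω ε n) := by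
  rw [cellInclusion_eq ω hε]
  exact (cellMap ε hε _).isOpenMap _ hω

lemma isOpen_inclusions (hω : IsOpen ω) (hε : 0 < ε) : IsOpen (inclusions Ω ω κ ε) :=
  isOpen_biUnion fun n _ => isOpen_cellInclusion hω hε n

lemma measurableSet_background (hΩ : IsOpen Ω) : MeasurableSet (background Ω ω κ ε) :=
  hΩ.measurableSet.diff isClosed_closure.measurableSet

lemma contrast_of_mem_inclusions {x : Eu d} (hx : x ∈ inclusions Ω ω κ ε) :
    contrast Ω ω κ ε δ x = δ := by
  have : x ∉ background Ω ω κ ε := fun h => h.2 (subset_closure hx)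
  simp [contrast, hx, this]

lemma contrast_of_mem_background {x : Eu d} (hx : x ∈ background Ω ω κ ε) :
    contrast Ω ω κ ε δ x = 1 := by
  have : x ∉ inclusions Ω ω κ ε := fun h => hx.2 (subset_closure h)
  simp [contrast, hx, this]

lemma contrast_mem (hδ : 0 < δ) (hδ1 : δ ≤ 1) (x : Eu d) :
    0 ≤ contrast Ω ω κ ε δ x ∧ contrast Ω ω κ ε δ x ≤ 1 := by
  by_cases h1 : x ∈ inclusions Ω ω κ ε
  · rw [contrast_of_mem_inclusions h1]; exact ⟨hδ.le, hδ1⟩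
  by_cases h2 : x ∈ background Ω ω κ ε
  · rw [contrast_of_mem_background h2]; simp
  · simp [contrast, h1, h2]

lemma measurable_contrast (hΩ : IsOpen Ω) (hω : IsOpen ω) (hε : 0 < ε) :
    Measurable (contrast Ω ω κ ε δ) :=
  ((measurable_const.indicator (isOpen_inclusions hω hε).measurableSet).const_mul _).add
    (measurable_const.indicator (measurableSet_background hΩ))

/-- A segment from `ω` to a point outside the unit cell crosses the frontier of the cell, which is
at positive distance from `ω`. -/
lemma InclusionAssumptions.exists_thickening_subset (hω : InclusionAssumptions ω) :
    ∃ r > 0, Metric.thickening r ω ⊆ unitCell d := by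
  obtain ⟨r, hr, hr'⟩ := ENNReal.lt_iff_exists_nnreal_btwn.1 hω.dist_pos
  refine ⟨r, by exact_mod_cast hr, fun y hy => ?_⟩
  obtain ⟨x, hx, hxy⟩ := Metric.mem_thickening_iff.1 hy
  by_contra hyU
  obtain ⟨z, hz, hzf⟩ := exists_mem_segment_frontier (hω.subset_cell hx) hyU
  have h1 : setDist ω (frontier (unitCell d)) ≤ edist x z :=
    (iInf₂_le x hx).trans (Metric.infEDist_le_edist_of_mem hzf)
  have h2 : edist x z < r := by
    rw [edist_dist, ENNReal.ofReal_lt_iff_lt_toReal dist_nonneg ENNReal.coe_ne_top]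
    rw [dist_comm] at hxy
    exact (dist_le_of_mem_segment hz).trans_lt hxy
  exact absurd (hr'.trans_le h1) (not_lt.2 h2.le)

variable {r : ℝ}

lemma mem_thickening_coord (hr : Metric.thickening r ω ⊆ unitCell d) (hε : 0 < ε) {n : Fin d → ℤ}
    {x : Eu d} (hx : x ∈ Metric.thickening (r * ε) (cellInclusion ω ε n)) (i : Fin d) :
    |x i - ε * n i| < ε / 2 := by
  rw [cellInclusion_eq ω hε, ← cellMap_image_thickening] at hx
  exact mem_cellInclusion_coord hr hε hx i

/-- The neighbourhoods of inclusions stay in their own open cells of side `ε`, so two indices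
sharing a point differ by less than `1` in each coordinate. This disjointness is what allows
summation over the inclusions. -/
lemma eq_of_mem_thickening (hr : Metric.thickening r ω ⊆ unitCell d) (hε : 0 < ε)
    {n k : Fin d → ℤ} {x : Eu d} (hx : x ∈ Metric.thickening (r * ε) (cellInclusion ω ε n))
    (hx' : x ∈ Metric.thickening (r * ε) (cellInclusion ω ε k)) : n = k := by
  ext i
  have h1 := abs_lt.1 (mem_thickening_coord hr hε hx i)
  have h2 := abs_lt.1 (mem_thickening_coord hr hε hx' i)
  have h3 : |(n i : ℝ) - k i| < 1 := by
    rw [abs_lt]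
    constructor <;> nlinarith
  have h4 : |n i - k i| < 1 := by exact_mod_cast h3
  rw [Int.abs_lt_one_iff] at h4
  omega

/-- Near a given point at most one inclusion is visible, so the closure of the union is the union of
the closures. -/
lemma exists_mem_closure_of_mem_closure_inclusions (hr : Metric.thickening r ω ⊆ unitCell d)
    (hr0 : 0 < r) (hε : 0 < ε) {x : Eu d} (hx : x ∈ closure (inclusions Ω ω κ ε)) :
    ∃ n ∈ inclusionIndices Ω ω κ ε, x ∈ closure (cellInclusion ω ε n) := by
  obtain ⟨y, hy, hxy⟩ := Metric.mem_closure_iff.1 hx (r * ε) (by positivity)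
  obtain ⟨n, hn, hyn⟩ := mem_iUnion₂.1 hy
  refine ⟨n, hn, ?_⟩
  have hxn : x ∈ Metric.thickening (r * ε) (cellInclusion ω ε n) :=
    Metric.mem_thickening_iff.2 ⟨y, hyn, hxy⟩
  refine mem_closure_iff_nhds.2 fun t ht => ?_
  obtain ⟨z, ⟨hzt, hzn⟩, hzD⟩ := mem_closure_iff_nhds.1 hx _
    (inter_mem ht (Metric.isOpen_thickening.mem_nhds hxn))
  obtain ⟨k, hk, hzk⟩ := mem_iUnion₂.1 hzD
  have := eq_of_mem_thickening hr hε hzn (Metric.self_subset_thickening (by positivity) _ hzk)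
  subst this
  exact ⟨z, hzt, hzk⟩

/-- A collar avoids the closure of its own inclusion by definition and those of the other inclusions
by disjointness of neighbourhoods. On it `Λ = 1`, so Caccioppoli's inequality is not degenerate
there. -/
lemma collar_inter_subset_background (hr : Metric.thickening r ω ⊆ unitCell d) (hr0 : 0 < r)
    (hε : 0 < ε) (n : Fin d → ℤ) :
    collar (cellInclusion ω ε n) (r * ε) ∩ Ω ⊆ background Ω ω κ ε := by
  rintro x ⟨hx, hxΩ⟩
  refine ⟨hxΩ, fun hcl => ?_⟩
  obtain ⟨k, -, hk⟩ := exists_mem_closure_of_mem_closure_inclusions hr hr0 hε hcl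
  have hk' := Metric.closure_subset_thickening (by positivity : 0 < r * ε) _ hk
  have := eq_of_mem_thickening hr hε hx.1 hk'
  subst this
  exact hx.2 hk

lemma volume_frontier_cellInclusion [NeZero d] (hω : IsLipschitzDomain ω) (hε : 0 < ε)
    (n : Fin d → ℤ) : volume (frontier (cellInclusion ω ε n)) = 0 := by
  rw [cellInclusion_eq ω hε, ← (cellMap ε hε _).image_frontier]
  obtain ⟨k, hk0, -, hk⟩ := exists_lintegral_cellMap hε (WithLp.toLp 2 fun i => (n i : ℝ))
  have := hk (frontier ω) 1 isClosed_frontier.measurableSet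
  simp only [Pi.one_apply, lintegral_one, Measure.restrict_apply_univ, hω.volume_frontier] at this
  exact (mul_eq_zero.1 this.symm).resolve_left hk0

/-- Only the countably many frontiers of the cells are missed, and each of them is null. -/
lemma ae_mem_inclusions_or_background [NeZero d] (hω : InclusionAssumptions ω) (hε : 0 < ε) :
    ∀ᵐ x ∂volume, x ∈ Ω → x ∈ inclusions Ω ω κ ε ∨ x ∈ background Ω ω κ ε := by
  obtain ⟨r, hr0, hr⟩ := hω.exists_thickening_subset
  have h0 : ∀ᵐ x ∂(volume : Measure (Eu d)), ∀ n, x ∉ frontier (cellInclusion ω ε n) :=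
    ae_all_iff.2 fun n => measure_eq_zero_iff_ae_notMem.1
      (volume_frontier_cellInclusion hω.lipschitz hε n)
  filter_upwards [h0] with x hx hxΩ
  by_cases hcl : x ∈ closure (inclusions Ω ω κ ε)
  · left
    obtain ⟨n, hn, hxn⟩ := exists_mem_closure_of_mem_closure_inclusions hr hr0 hε hcl
    refine mem_iUnion₂.2 ⟨n, hn, ?_⟩
    by_contra h
    exact hx n ⟨hxn, fun h' => h (interior_subset h')⟩
  · exact Or.inr ⟨hxΩ, hcl⟩

lemma lt_dist_of_mem_cellInclusion {n : Fin d → ℤ} (hn : n ∈ inclusionIndices Ω ω κ ε) {x z : Eu d}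
    (hx : x ∈ cellInclusion ω ε n) (hz : z ∈ frontier Ω) : κ * ε < dist x z := by
  have h := hn.2.trans_le ((iInf₂_le x hx).trans (Metric.infEDist_le_edist_of_mem hz))
  rw [edist_dist] at h
  exact (ENNReal.ofReal_lt_ofReal_iff_of_nonneg' h).resolve_right (by simp)
where
  ENNReal.ofReal_lt_ofReal_iff_of_nonneg' {p q : ℝ} (h : ENNReal.ofReal p < ENNReal.ofReal q) :
      p < q ∨ False := Or.inl (by
    by_contra! h'
    exact absurd h (not_lt.2 (ENNReal.ofReal_le_ofReal h')))

end Cells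

/-! ### The weak equation with Lipschitz test functions. -/

section Weak

variable {d m : ℕ} {μ lam τ : ℝ} {A : Eu d → Tensor d m}

/-- Needed for the measurability of the flux `Λ A Du`. -/
lemma CoeffAssumptions.continuous (hA : CoeffAssumptions μ lam τ A) (hlam : 0 < lam)
    (p q : Fin d × Fin m) : Continuous fun y => A y p q := by
  refine continuous_iff_continuousAt.2 fun y => ?_
  rw [ContinuousAt, tendsto_iff_norm_sub_tendsto_zero]
  have h1 : Tendsto (fun w : Eu d => τ * ‖w - y‖ ^ lam) (𝓝 y) (𝓝 0) := by
    have : Continuous fun w : Eu d => τ * ‖w - y‖ ^ lam :=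
      ((continuous_id.sub continuous_const).norm.rpow_const fun _ => Or.inr hlam.le).const_mul τ
    have h := this.tendsto y
    simpa [Real.zero_rpow hlam.ne'] using h
  refine squeeze_zero (fun _ => norm_nonneg _) (fun w => ?_) h1
  refine le_trans ?_ (hA.holder w y)
  refine Real.le_sqrt_of_sq_le ?_
  rw [Real.norm_eq_abs, sq_abs]
  calc _ ≤ ∑ q', (A w p q' - A y p q') ^ 2 :=
        Finset.single_le_sum (f := fun q' => (A w p q' - A y p q') ^ 2)
          (fun _ _ => sq_nonneg _) (Finset.mem_univ q)
    _ ≤ _ := Finset.single_le_sum (f := fun p' => ∑ q', (A w p' q' - A y p' q') ^ 2)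
          (fun _ _ => Finset.sum_nonneg fun _ _ => sq_nonneg _) (Finset.mem_univ p)

lemma CoeffAssumptions.isElliptic (hA : CoeffAssumptions μ lam τ A) (y : Eu d) :
    IsElliptic μ (A y) :=
  ⟨fun p q => hA.symm y p.1 q.1 p.2 q.2, hA.elliptic y⟩

/-- Restriction of the weak equation to a smaller open set, and passage to Lipschitz test
functions. -/
lemma IsWeakSolution.weakSol [NeZero d] {Ω ω : Set (Eu d)} {κ ε δ : ℝ} (hμ : 0 < μ) (hlam : 0 < lam)
    (hω : InclusionAssumptions ω) (hΩ : IsOpen Ω) (hA : CoeffAssumptions μ lam τ A) (hε : 0 < ε)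
    (hδ : 0 < δ) (hδ1 : δ ≤ 1) {U V : Set (Eu d)} (hUΩ : U ⊆ Ω) (hVU : V ⊆ U)
    (hU : IsOpen U) (hV : IsOpen V) (hVb : Bornology.IsBounded V) {f : Eu d → Eu m}
    {Du : Eu d → GradSp d m} (hf : MemLp f 2 (volume.restrict U))
    (hDu : MemLp Du 2 (volume.restrict U))
    (h : IsWeakSolution Ω ω κ ε δ A U Du (modSource Ω ω κ ε δ f)) :
    WeakSol μ (contrast Ω ω κ ε δ) (fun x => A (ε⁻¹ • x)) V Du f := by
  set Λ := contrast Ω ω κ ε δ with hΛ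
  have hΛm : Measurable Λ := measurable_contrast hΩ hω.lipschitz.isOpen hε
  have hΛ01 : ∀ x, 0 ≤ Λ x ∧ Λ x ≤ 1 := contrast_mem hδ hδ1
  have hVfin : IsFiniteMeasure (volume.restrict V) :=
    ⟨by rw [Measure.restrict_apply_univ]; exact hVb.measure_lt_top⟩
  have hfV : MemLp f 2 (volume.restrict V) := hf.mono_measure (Measure.restrict_mono hVU le_rfl)
  have hDV : MemLp Du 2 (volume.restrict V) := hDu.mono_measure (Measure.restrict_mono hVU le_rfl)
  have hell : ∀ x, IsElliptic μ (A (ε⁻¹ • x)) := fun x => hA.isElliptic _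
  set H : Eu d → GradSp d m := fun x => Λ x • tensApply (A (ε⁻¹ • x)) (Du x) with hH
  have hHform : ∀ x η, Λ x * tensorForm (A (ε⁻¹ • x)) (Du x) η = ⟪H x, η⟫_ℝ := fun x η => by
    rw [tensorForm_eq_inner, hH, real_inner_smul_left]
  have hHi : IntegrableOn H V := by
    refine Integrable.mono' ((hDV.integrable (by norm_num)).norm.const_mul μ⁻¹) ?_ ?_
    · refine hΛm.aestronglyMeasurable.smul ?_
      have hc : ∀ p, AEStronglyMeasurable (fun x => ∑ q, A (ε⁻¹ • x) p q * Du x q)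
          (volume.restrict V) := fun p => by
        refine Finset.aestronglyMeasurable_fun_sum _ fun q _ => ?_
        refine AEStronglyMeasurable.mul ?_ ?_
        · exact ((hA.continuous hlam p q).comp (by fun_prop)).aestronglyMeasurable
        · exact ((EuclideanSpace.proj q : GradSp d m →L[ℝ] ℝ).continuous).comp_aestronglyMeasurable
            hDV.1
      have := (aemeasurable_pi_lambda _ fun p => (hc p).aemeasurable)
      exact ((WithLp.measurable_toLp 2 _).comp_aemeasurable this).aestronglyMeasurable
    · refine Eventually.of_forall fun x => ?_
      rw [hH, norm_smul, Real.norm_of_nonneg (hΛ01 x).1]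
      exact (mul_le_of_le_one_left (norm_nonneg _) (hΛ01 x).2).trans
        ((hell x).norm_tensApply_le hμ _)
  have hΛf : IntegrableOn (fun x => Λ x • f x) V := by
    refine Integrable.mono' (hfV.integrable (by norm_num)).norm
      (hΛm.aestronglyMeasurable.smul hfV.1) (Eventually.of_forall fun x => ?_)
    rw [norm_smul, Real.norm_of_nonneg (hΛ01 x).1]
    exact mul_le_of_le_one_left (norm_nonneg _) (hΛ01 x).2
  -- For `δ = 1` the source is `f` itself, but then `Λ = 1` almost everywhere in `Ω`. Both
  -- definitions of the source thus give `Λ f`.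
  have hsrc : ∀ᵐ x ∂volume.restrict V, modSource Ω ω κ ε δ f x = Λ x • f x := by
    filter_upwards [ae_restrict_mem hV.measurableSet,
      ae_restrict_of_ae (ae_mem_inclusions_or_background (Ω := Ω) (κ := κ) hω hε)] with x hxV hx
    unfold modSource
    split_ifs with hδ2
    · have : Λ x = 1 := by
        rcases hx (hUΩ (hVU hxV)) with h1 | h1
        · rw [hΛ, contrast_of_mem_inclusions h1]; exact le_antisymm hδ1 hδ2
        · rw [hΛ, contrast_of_mem_background h1]
      rw [this, one_smul]
    · rfl
  have hne : V ≠ univ := by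
    rintro rfl
    exact NoncompactSpace.noncompact_univ (X := Eu d)
      (hVb.isCompact_closure.of_isClosed_subset isClosed_univ subset_closure)
  have hweak : ∀ φ : Eu d → Eu m, ContDiff ℝ ((⊤ : ℕ∞) : WithTop ℕ∞) φ → HasCompactSupport φ →
      tsupport φ ⊆ V → ∫ x in V, ⟪H x, gradArr φ x⟫_ℝ = ∫ x in V, ⟪Λ x • f x, φ x⟫_ℝ := by
    intro φ h1 h2 h3
    have h4 := h φ h1 h2 (h3.trans hVU)
    rw [← hΛ] at h4
    simp_rw [hHform] at h4
    have hz : ∀ x ∈ U \ V, φ x = 0 ∧ gradArr φ x = 0 := fun x hx => by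
      have := notMem_tsupport_iff_eventuallyEq.1 fun hx' => hx.2 (h3 hx')
      exact ⟨this.eq_of_nhds, gradArr_zero this⟩
    rw [setIntegral_eq_of_subset_of_forall_sdiff_eq_zero hU.measurableSet hVU
        (fun x hx => by rw [(hz x hx).2, inner_zero_right]),
      setIntegral_eq_of_subset_of_forall_sdiff_eq_zero hU.measurableSet hVU
        (fun x hx => by rw [(hz x hx).1, inner_zero_right])] at h4
    rw [h4]
    refine integral_congr_ae ?_
    filter_upwards [hsrc] with x hx
    rw [hx]
  refine ⟨hV, hVb, hell, hΛm, hΛ01, hDV, hfV, fun θ K hθ => ⟨?_, ?_⟩, fun θ K hθ h0 => ?_⟩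
  · simp_rw [hHform]
    refine Integrable.mono' (hHi.norm.mul_const (Real.sqrt d * K))
      (hHi.1.inner (measurable_gradArr _).aestronglyMeasurable) (Eventually.of_forall fun x => ?_)
    exact (norm_inner_le_norm _ _).trans (by gcongr; exact norm_gradArr_le hθ x)
  · obtain ⟨M, hM⟩ := (hVb.isCompact_closure.exists_bound_of_continuousOn
      hθ.continuous.continuousOn)
    simp_rw [← real_inner_smul_left]
    refine Integrable.mono' (hΛf.norm.mul_const M)
      (hΛf.1.inner hθ.continuous.aestronglyMeasurable) ?_
    filter_upwards [ae_restrict_mem hV.measurableSet] with x hx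
    exact (norm_inner_le_norm _ _).trans (by gcongr; exact hM x (subset_closure hx))
  · simp_rw [hHform, ← real_inner_smul_left]
    exact weak_eq_of_lipschitz hV hVb hne hHi hΛf hweak hθ h0

end Weak

/-! ### Caccioppoli's inequality with the contrast as weight. -/

lemma tensArr_smul {d m : ℕ} (ℓ : Eu d →L[ℝ] ℝ) (c : ℝ) (v : Eu m) :
    tensArr ℓ (c • v) = c • tensArr ℓ v := by
  rw [tensArr, tensArr, ← map_smul]
  congr 1
  ext1 x
  exact smul_comm (ℓ x) c v

lemma tensArr_zero_left {d m : ℕ} (v : Eu m) : tensArr (0 : Eu d →L[ℝ] ℝ) v = 0 := by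
  rw [← norm_le_zero_iff]
  simpa using norm_tensArr_le (d := d) 0 v

lemma gradArr_smul_smul {d m : ℕ} {η : Eu d → ℝ} {φ : Eu d → Eu m} {x : Eu d}
    (hη : DifferentiableAt ℝ η x) (hφ : DifferentiableAt ℝ φ x) :
    gradArr (fun y => η y • η y • φ y) x =
      η x ^ 2 • gradArr φ x + (2 * η x) • tensArr (fderiv ℝ η x) (φ x) := by
  rw [gradArr_smul (φ := fun y => η y • φ y) hη (by exact hη.smul hφ), gradArr_smul hη hφ, tensArr_smul, smul_add, smul_smul, ← sq,
    add_assoc, ← add_smul, two_mul]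

lemma measurable_tensArr {d m : ℕ} (η : Eu d → ℝ) {φ : Eu d → Eu m} (hφ : Measurable φ) :
    Measurable fun x => tensArr (fderiv ℝ η x) (φ x) := by
  have hc : Continuous fun p : (Eu d →L[ℝ] ℝ) × Eu m => tensArr p.1 p.2 :=
    (arrL d m).continuous.comp
      ((ContinuousLinearMap.smulRightL ℝ (Eu d) (Eu m)).continuous₂)
  exact hc.measurable.comp ((measurable_fderiv ℝ η).prodMk hφ)

lemma LipschitzWith.smul_of_bounded {E F : Type*} [NormedAddCommGroup E]
    [NormedAddCommGroup F] [NormedSpace ℝ F] {K L M N : ℝ≥0} {η : E → ℝ} {v : E → F}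
    (hη : LipschitzWith K η) (hv : LipschitzWith L v) (hM : ∀ x, ‖η x‖ ≤ M) (hN : ∀ x, ‖v x‖ ≤ N) :
    LipschitzWith (M * L + K * N) fun x => η x • v x := by
  refine LipschitzWith.of_dist_le_mul fun x y => ?_
  have h1 := hη.dist_le_mul x y
  have h2 := hv.dist_le_mul x y
  rw [dist_eq_norm] at h1 h2 ⊢
  have e : η x • v x - η y • v y = η x • (v x - v y) + (η x - η y) • v y := by
    rw [smul_sub, sub_smul]; abel
  rw [e]
  refine (norm_add_le _ _).trans ?_
  rw [norm_smul, norm_smul]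
  push_cast
  calc _ ≤ M * (L * dist x y) + (K * dist x y) * N := by
        gcongr
        · exact hM x
        · exact hN y
    _ = _ := by ring

lemma ENNReal.le_of_forall_le_add_of_tendsto {X Y T : ℝ≥0∞} {e : ℕ → ℝ≥0∞} (hT : T ≠ ∞)
    (he : Tendsto e atTop (𝓝 0)) (h : ∀ k, X ≤ Y + T * e k) : X ≤ Y := by
  have h1 : Tendsto (fun k => Y + T * e k) atTop (𝓝 (Y + T * 0)) :=
    tendsto_const_nhds.add (ENNReal.Tendsto.const_mul he (Or.inr hT))
  rw [mul_zero, add_zero] at h1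
  exact ge_of_tendsto' h1 h

/-- Absorption of half of the left side, legitimate because it is finite. -/
lemma ENNReal.le_two_mul_of_le_add_half {X Y : ℝ≥0∞} (hX : X ≠ ∞) (h : X ≤ Y + X / 2) :
    X ≤ 2 * Y := by
  have h1 : X / 2 + X / 2 ≤ Y + X / 2 := by rwa [ENNReal.add_halves]
  have h2 : X / 2 ≤ Y := (ENNReal.add_le_add_iff_right (by finiteness)).1 h1
  rw [← ENNReal.add_halves X, two_mul]
  gcongr

lemma HasBoundaryValue.exists_approx {d m : ℕ} {U S : Set (Eu d)} {u : Eu d → Eu m}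
    {Du : Eu d → GradSp d m} {g : Eu d → Eu m} (h : HasBoundaryValue U S u Du g) :
    ∃ w : ℕ → Eu d → Eu m, (∀ k, ∃ K, LipschitzWith K (w k)) ∧ (∀ k, EqOn (w k) g S) ∧
      Tendsto (fun k => (∫⁻ x in U, ‖w k x - u x‖ₑ ^ 2) +
        ∫⁻ x in U, ‖gradArr (w k) x - Du x‖ₑ ^ 2) atTop (𝓝 0) := by
  obtain ⟨w, h1, h2, h3, h4⟩ := h
  refine ⟨w, h1, h2, ?_⟩
  have h5 := (ENNReal.Tendsto.pow (n := 2) h3).add (ENNReal.Tendsto.pow (n := 2) h4)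
  simp_rw [eLpNorm_two_sq] at h5
  simpa using h5

lemma enorm_smul_le_of_abs_le {F : Type*} [NormedAddCommGroup F] [NormedSpace ℝ F] {c : ℝ}
    (hc : |c| ≤ 1) (v : F) : ‖c • v‖ₑ ≤ ‖v‖ₑ := by
  rw [enorm_smul]
  refine mul_le_of_le_one_left zero_le ?_
  rw [Real.enorm_eq_ofReal_abs]
  exact ENNReal.ofReal_le_one.2 hc

lemma enorm_tensArr_sq_le {d m : ℕ} {η : Eu d → ℝ} {L : ℝ≥0} (hη : LipschitzWith L η) (x : Eu d)
    (v : Eu m) : ‖tensArr (fderiv ℝ η x) v‖ₑ ^ 2 ≤ (d * L ^ 2 : ℝ≥0) * ‖v‖ₑ ^ 2 := by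
  have h : ‖tensArr (fderiv ℝ η x) v‖ ≤ Real.sqrt d * L * ‖v‖ :=
    (norm_tensArr_le _ _).trans (by gcongr; exact norm_fderiv_le_of_lipschitz ℝ hη)
  have h2 : ‖tensArr (fderiv ℝ η x) v‖ ^ 2 ≤ (d * L ^ 2) * ‖v‖ ^ 2 := by
    calc _ ≤ (Real.sqrt d * L * ‖v‖) ^ 2 := by gcongr
      _ = _ := by rw [mul_pow, mul_pow, Real.sq_sqrt (by positivity)]
  have h3 := ENNReal.ofReal_le_ofReal h2
  rw [ENNReal.ofReal_mul (by positivity), ENNReal.ofReal_pow (norm_nonneg _),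
    ENNReal.ofReal_pow (norm_nonneg _), ofReal_norm, ofReal_norm] at h3
  refine h3.trans (le_of_eq ?_)
  congr 1
  rw [← ENNReal.ofReal_coe_nnreal]
  push_cast
  rfl

/-- Caccioppoli's inequality up to the part of the boundary where Dirichlet data are given. -/
lemma WeakSol.caccioppoli {d m : ℕ} {μ : ℝ} (hμ : 0 < μ) {Λ : Eu d → ℝ} {a : Eu d → Tensor d m}
    {U S : Set (Eu d)} {u : Eu d → Eu m} {Du : Eu d → GradSp d m} {f g : Eu d → Eu m}
    (h : WeakSol μ Λ a U Du f) (hu : AEStronglyMeasurable u (volume.restrict U))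
    (hbv : HasBoundaryValue U S u Du g) {η : Eu d → ℝ} {L : ℝ≥0} (hη : LipschitzWith L η)
    (hη1 : ∀ x, |η x| ≤ 1) {B : Set (Eu d)} (hB : Bornology.IsBounded B) (hηB : ∀ x ∉ B, η x = 0)
    {G : Eu d → Eu m} {KG : ℝ≥0} (hG : LipschitzWith KG G)
    (hGS : ∀ x ∈ frontier U, η x ≠ 0 → x ∈ S ∧ G x = g x) {s : ℝ} (hs : s ≠ 0) :
    ∫⁻ x in U, ENNReal.ofReal (Λ x) * ‖η x • Du x‖ₑ ^ 2 ≤ energyConst μ *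
      (ENNReal.ofReal (s ^ 2) * (∫⁻ x in U, ‖f x‖ₑ ^ 2) +
        ((ENNReal.ofReal (s ^ 2)⁻¹ + (d * L ^ 2 : ℝ≥0)) *
          (4 * (∫⁻ x in U, ‖u x‖ₑ ^ 2) + 4 * ∫⁻ x in U, ‖G x‖ₑ ^ 2) +
        ∫⁻ x in U, ‖gradArr G x‖ₑ ^ 2)) := by
  have hUm := h.isOpen.measurableSet
  obtain ⟨w, hwL, hwS, he⟩ := hbv.exists_approx
  set b : ℝ≥0∞ := ENNReal.ofReal (s ^ 2)⁻¹ + (d * L ^ 2 : ℝ≥0) with hb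
  have hbtop : b ≠ ∞ := by finiteness
  refine ENNReal.le_of_forall_le_add_of_tendsto (T := energyConst μ * (2 * b + 1)) (by finiteness)
    he fun k => ?_
  obtain ⟨K, hw⟩ := hwL k
  set φ : Eu d → Eu m := fun x => w k x - G x with hφ
  have hφL : LipschitzWith (K + KG) φ := hw.sub hG
  obtain ⟨K1, hK1⟩ := hη.exists_smul_of_bounded hφL hB hηB
  obtain ⟨K2, hK2⟩ := hη.exists_smul_of_bounded hK1 hB hηB
  -- On the frontier of `U` either the cutoff vanishes or the point lies in `S`, where `w k = g =
  -- G`. So `η² (w k - G)`, extended by zero, is an admissible Lipschitz test function.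
  have hind := hK2.indicator_of_frontier (U := U) fun x hx => by
    by_cases h0 : η x = 0
    · simp [h0]
    · obtain ⟨h1, h2⟩ := hGS x hx h0
      simp [hφ, hwS k h1, h2]
  have hen := h.energy hμ hUm Subset.rfl hind (fun x hx => indicator_of_notMem hx _)
    (ζ := η) (φ := φ) (W := gradArr (w k)) (H := gradArr G)
    (Z := fun x => tensArr (fderiv ℝ η x) (φ x)) hη.continuous.measurable hφL.continuous.measurable
    (measurable_gradArr _) (measurable_gradArr _) (measurable_tensArr _ hφL.continuous.measurable)
    (by
      filter_upwards [ae_restrict_mem hUm, ae_restrict_of_ae hη.ae_differentiableAt,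
        ae_restrict_of_ae hw.ae_differentiableAt, ae_restrict_of_ae hG.ae_differentiableAt]
        with x hx h1 h2 h3
      have : U.indicator (fun y => η y • η y • φ y) =ᶠ[𝓝 x] fun y => η y • η y • φ y := by
        filter_upwards [h.isOpen.mem_nhds hx] with y hy
        rw [indicator_of_mem hy]
      have e : gradArr φ x = gradArr (w k) x - gradArr G x := gradArr_sub h2 h3
      rw [gradArr_congr this, gradArr_smul_smul h1 (by exact h2.sub h3), e])
    (fun x hx => by rw [indicator_of_mem hx, smul_smul, sq]) (by simp) hs
  refine hen.trans ?_
  rw [mul_assoc, ← mul_add]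
  refine mul_le_mul' le_rfl ?_
  have hgm : Measurable fun x => ‖gradArr G x‖ₑ ^ 2 := (measurable_gradArr G).enorm.pow_const 2
  have hGm : Measurable fun x => ‖G x‖ₑ ^ 2 := hG.continuous.measurable.enorm.pow_const 2
  have hum : AEMeasurable (fun x => ‖u x‖ₑ ^ 2) (volume.restrict U) := hu.enorm.pow_const 2
  have hfm : AEMeasurable (fun x => ‖f x‖ₑ ^ 2) (volume.restrict U) :=
    h.memLp_source.1.enorm.pow_const 2
  have hwm : AEMeasurable (fun x => ‖w k x - u x‖ₑ ^ 2) (volume.restrict U) :=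
    (hw.continuous.aestronglyMeasurable.sub hu).enorm.pow_const 2
  have hbm : AEMeasurable (fun x => b * (4 * ‖u x‖ₑ ^ 2 + 4 * ‖G x‖ₑ ^ 2)) (volume.restrict U) :=
    ((hum.const_mul 4).add (hGm.const_mul 4).aemeasurable).const_mul _
  calc _ ≤ ∫⁻ x in U, (ENNReal.ofReal (s ^ 2) * ‖f x‖ₑ ^ 2 + (b * (4 * ‖u x‖ₑ ^ 2 + 4 * ‖G x‖ₑ ^ 2) +
        (‖gradArr G x‖ₑ ^ 2 + (2 * b * ‖w k x - u x‖ₑ ^ 2 + ‖gradArr (w k) x - Du x‖ₑ ^ 2)))) := by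
        refine lintegral_mono fun x => ?_
        refine (mul_le_of_le_one_left zero_le (ENNReal.ofReal_le_one.2 (h.contrast_mem x).2)).trans ?_
        have hφe : ‖φ x‖ₑ ^ 2 ≤ (4 * ‖u x‖ₑ ^ 2 + 4 * ‖G x‖ₑ ^ 2) + 2 * ‖w k x - u x‖ₑ ^ 2 := by
          have e : φ x = (u x - G x) + (w k x - u x) := by simp [hφ]
          rw [e]
          refine (enorm_add_sq_le _ _).trans ?_
          gcongr
          refine (mul_le_mul' le_rfl (enorm_sub_sq_le _ _)).trans (le_of_eq ?_)
          ring
        calc _ ≤ ENNReal.ofReal (s ^ 2) * ‖f x‖ₑ ^ 2 + ENNReal.ofReal (s ^ 2)⁻¹ * ‖φ x‖ₑ ^ 2 +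
              ‖gradArr G x‖ₑ ^ 2 + (d * L ^ 2 : ℝ≥0) * ‖φ x‖ₑ ^ 2 +
              ‖gradArr (w k) x - Du x‖ₑ ^ 2 := by
              gcongr
              · exact enorm_smul_le_of_abs_le (hη1 x) _
              · exact enorm_smul_le_of_abs_le (hη1 x) _
              · exact enorm_smul_le_of_abs_le (hη1 x) _
              · exact enorm_tensArr_sq_le hη x _
              · exact enorm_smul_le_of_abs_le (hη1 x) _
          _ = ENNReal.ofReal (s ^ 2) * ‖f x‖ₑ ^ 2 + (b * ‖φ x‖ₑ ^ 2 +
              (‖gradArr G x‖ₑ ^ 2 + ‖gradArr (w k) x - Du x‖ₑ ^ 2)) := by rw [hb]; ring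
          _ ≤ ENNReal.ofReal (s ^ 2) * ‖f x‖ₑ ^ 2 + (b * ((4 * ‖u x‖ₑ ^ 2 + 4 * ‖G x‖ₑ ^ 2) +
              2 * ‖w k x - u x‖ₑ ^ 2) +
              (‖gradArr G x‖ₑ ^ 2 + ‖gradArr (w k) x - Du x‖ₑ ^ 2)) := by gcongr
          _ = _ := by ring
    _ = ENNReal.ofReal (s ^ 2) * (∫⁻ x in U, ‖f x‖ₑ ^ 2) +
        (b * (4 * (∫⁻ x in U, ‖u x‖ₑ ^ 2) + 4 * ∫⁻ x in U, ‖G x‖ₑ ^ 2) +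
        ((∫⁻ x in U, ‖gradArr G x‖ₑ ^ 2) + (2 * b * (∫⁻ x in U, ‖w k x - u x‖ₑ ^ 2) +
          ∫⁻ x in U, ‖gradArr (w k) x - Du x‖ₑ ^ 2))) := by
        rw [lintegral_add_left' (hfm.const_mul _), lintegral_const_mul'' _ hfm,
          lintegral_add_left' hbm,
          lintegral_const_mul' _ _ hbtop, lintegral_add_left' (hum.const_mul _),
          lintegral_const_mul'' _ hum, lintegral_const_mul _ hGm, lintegral_add_left hgm,
          lintegral_add_left' (hwm.const_mul _), lintegral_const_mul'' _ hwm]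
    _ ≤ ENNReal.ofReal (s ^ 2) * (∫⁻ x in U, ‖f x‖ₑ ^ 2) +
        (b * (4 * (∫⁻ x in U, ‖u x‖ₑ ^ 2) + 4 * ∫⁻ x in U, ‖G x‖ₑ ^ 2) +
        ((∫⁻ x in U, ‖gradArr G x‖ₑ ^ 2) + ((2 * b + 1) * (∫⁻ x in U, ‖w k x - u x‖ₑ ^ 2) +
          (2 * b + 1) * ∫⁻ x in U, ‖gradArr (w k) x - Du x‖ₑ ^ 2))) := by
        refine add_le_add le_rfl (add_le_add le_rfl (add_le_add le_rfl (add_le_add ?_ ?_)))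
        · exact mul_le_mul' le_self_add le_rfl
        · exact le_mul_of_one_le_left zero_le le_add_self
    _ = _ := by ring

/-! ### Energy estimates in one inclusion. -/

/-- The constant in the energy estimate for one inclusion. -/
def cellConst (μ : ℝ) : ℝ≥0 := 16 * (energyConst μ + 1) ^ 2

/-- The energy estimate in one inclusion: `v` is an admissible approximation of the solution and `E`
has the same boundary values on the inclusion. -/
lemma WeakSol.cell_energy {d m : ℕ} [NeZero d] {μ : ℝ} (hμ : 0 < μ) {Ω ω : Set (Eu d)} {κ ε δ : ℝ}
    (hω : InclusionAssumptions ω) (hε : 0 < ε) (hδ : 0 < δ)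
    {a : Eu d → Tensor d m} {U : Set (Eu d)} {Du : Eu d → GradSp d m} {f : Eu d → Eu m}
    (h : WeakSol μ (contrast Ω ω κ ε δ) a U Du f) {n : Fin d → ℤ}
    (hn : n ∈ inclusionIndices Ω ω κ ε) {v E : Eu d → Eu m} {K K' : ℝ≥0}
    (hv : LipschitzWith K v) (hE : LipschitzWith K' E)
    (hvE : ∀ x ∈ frontier (cellInclusion ω ε n), E x = v x) {ζ : Eu d → ℝ} {L : ℝ≥0}
    (hζ : LipschitzWith L ζ) (hζ0 : ∀ x, 0 ≤ ζ x) (hζ1 : ∀ x, ζ x ≤ 1)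
    (hζU : ∀ x ∈ cellInclusion ω ε n, x ∉ U → ζ x = 0) :
    ∫⁻ x in cellInclusion ω ε n ∩ U, ‖ζ x • Du x‖ₑ ^ 2 ≤ cellConst μ *
      ∫⁻ x in cellInclusion ω ε n ∩ U, (ENNReal.ofReal ε ^ 2 * ‖f x‖ₑ ^ 2 +
        (‖ζ x • gradArr E x‖ₑ ^ 2 + ‖tensArr (fderiv ℝ ζ x) (v x - E x)‖ₑ ^ 2 +
          ‖gradArr v x - Du x‖ₑ ^ 2)) := by
  set O := cellInclusion ω ε n with hO
  have hOo : IsOpen O := isOpen_cellInclusion hω.lipschitz.isOpen hε n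
  have hOb : Bornology.IsBounded O := by
    refine (Metric.isBounded_iff_subset_closedBall
      (WithLp.toLp 2 fun i => ε * (n i : ℝ))).2 ⟨Real.sqrt (∑ _i : Fin d, (ε / 2) ^ 2), fun x hx => ?_⟩
    rw [Metric.mem_closedBall, EuclideanSpace.dist_eq]
    refine Real.sqrt_le_sqrt (Finset.sum_le_sum fun i _ => ?_)
    rw [Real.dist_eq]
    exact pow_le_pow_left₀ (abs_nonneg _) (mem_cellInclusion_coord hω.subset_cell hε hx i).le 2
  set S := O ∩ U with hS
  have hSo : IsOpen S := hOo.inter h.isOpen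
  have hSm := hSo.measurableSet
  set φ : Eu d → Eu m := fun x => v x - E x with hφ
  have hφL : LipschitzWith (K + K') φ := hv.sub hE
  -- The boundary values of `E` and `v` agree, so `v - E` can be extended by zero outside the
  -- inclusion.
  have hφ0 : LipschitzWith (K + K') (O.indicator φ) :=
    hφL.indicator_of_frontier fun x hx => by simp [hφ, hvE x hx]
  obtain ⟨N, hN⟩ : ∃ N : ℝ≥0, ∀ x, ‖O.indicator φ x‖ ≤ N := by
    obtain ⟨r, hr⟩ := hOb.subset_closedBall (0 : Eu d)
    obtain ⟨N, hN⟩ := (HasCompactSupport.intro (isCompact_closedBall (0 : Eu d) r)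
      fun x hx => indicator_of_notMem (fun hxO => hx (hr hxO)) φ).exists_bound_of_continuous
      hφ0.continuous
    exact ⟨N.toNNReal, fun x => (hN x).trans (Real.le_coe_toNNReal N)⟩
  have hζn : ∀ x, ‖ζ x‖ ≤ (1 : ℝ≥0) := fun x => by
    rw [Real.norm_of_nonneg (hζ0 x)]; exact hζ1 x
  have hψL := hζ.smul_of_bounded hφ0 hζn hN
  set ψ : Eu d → Eu m := fun x => ζ x • O.indicator φ x with hψ
  have hψN : ∀ x, ‖ψ x‖ ≤ N := fun x => by
    rw [hψ, norm_smul]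
    exact (mul_le_of_le_one_left (norm_nonneg _) (hζn x)).trans (hN x)
  have hθL := hζ.smul_of_bounded hψL hζn hψN
  have hloc : ∀ x ∈ S, O.indicator φ =ᶠ[𝓝 x] φ := fun x hx => by
    filter_upwards [hOo.mem_nhds hx.1] with y hy
    rw [indicator_of_mem hy]
  have hoff : ∀ᵐ x : Eu d, x ∉ S → gradArr ψ x = 0 ∧ ψ x = 0 ∧
      gradArr (fun x => ζ x • ψ x) x = 0 := by
    filter_upwards [measure_eq_zero_iff_ae_notMem.1
      (volume_frontier_cellInclusion hω.lipschitz hε n), hζ.ae_differentiableAt,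
      hφ0.ae_differentiableAt, hψL.ae_differentiableAt] with x h1 h2 h3 h4 hxS
    by_cases hxO : x ∈ O
    -- At a zero of the nonnegative `ζ` its derivative vanishes too, so the test function and its
    -- gradient vanish on the part of the inclusion outside `U`.
    · have hz : ζ x = 0 := hζU x hxO fun hxU => hxS ⟨hxO, hxU⟩
      have hf : fderiv ℝ ζ x = 0 := by
        refine IsLocalMin.fderiv_eq_zero (Eventually.of_forall fun y => ?_)
        rw [hz]; exact hζ0 y
      refine ⟨?_, ?_, ?_⟩
      · rw [hψ, gradArr_smul h2 h3, hz, hf, tensArr_zero_left, zero_smul, add_zero]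
      · rw [hψ]; simp [hz]
      · rw [gradArr_smul h2 h4, hz, hf, tensArr_zero_left, zero_smul, add_zero]
    · have hcl : x ∉ closure O := fun hcl => h1 ⟨hcl, fun hi => hxO (interior_subset hi)⟩
      have he : ψ =ᶠ[𝓝 x] fun _ => 0 := by
        filter_upwards [isClosed_closure.isOpen_compl.mem_nhds hcl] with y hy
        have : y ∉ O := fun h => hy (subset_closure h)
        simp [hψ, this]
      refine ⟨gradArr_zero he, he.eq_of_nhds, gradArr_zero ?_⟩
      filter_upwards [he] with y hy
      rw [hy, smul_zero]
  have hdiff : ∀ᵐ x : Eu d, DifferentiableAt ℝ ζ x ∧ DifferentiableAt ℝ φ x ∧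
      gradArr φ x = gradArr v x - gradArr E x := by
    filter_upwards [hζ.ae_differentiableAt, hv.ae_differentiableAt, hE.ae_differentiableAt]
      with x h1 h2 h3
    exact ⟨h1, h2.sub h3, gradArr_sub h2 h3⟩
  set c : ℝ≥0 := energyConst μ with hc
  -- The factor is chosen so that `c * s⁻² * ε² * 8 ≤ 1`. The lower order term, after Friedrichs'
  -- inequality, then returns at most half of the left side.
  set s : ℝ := Real.sqrt (8 * (c + 1)) * ε with hs
  have hs2 : s ^ 2 = 8 * (c + 1) * ε ^ 2 := by
    rw [hs, mul_pow, Real.sq_sqrt (by positivity)]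
  have hs0 : s ≠ 0 := by positivity
  have hen := h.energy hμ hSm inter_subset_right hθL (θ := fun x => ζ x • ψ x)
    (fun x hx => by
      by_cases hxO : x ∈ O
      · simp [hζU x hxO hx]
      · simp [hψ, hxO])
    (ζ := ζ) (φ := φ) (W := gradArr v) (H := gradArr E)
    (Z := fun x => tensArr (fderiv ℝ ζ x) (φ x)) hζ.continuous.measurable hφL.continuous.measurable
    (measurable_gradArr _) (measurable_gradArr _) (measurable_tensArr _ hφL.continuous.measurable)
    (by
      filter_upwards [ae_restrict_mem hSm, ae_restrict_of_ae hdiff] with x hx ⟨h1, h2, h3⟩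
      have : (fun y => ζ y • ψ y) =ᶠ[𝓝 x] fun y => ζ y • ζ y • φ y := by
        filter_upwards [hloc x hx] with y hy
        simp only [hψ, hy]
      rw [gradArr_congr this, gradArr_smul_smul h1 h2, h3])
    (fun x hx => by simp only [hψ, indicator_of_mem hx.1, smul_smul, sq])
    (by
      filter_upwards [ae_restrict_mem (h.isOpen.measurableSet.diff hSm),
        ae_restrict_of_ae hoff] with x hx h1
      obtain ⟨-, h2, h3⟩ := h1 hx.2
      exact ⟨h3, by rw [h2, smul_zero]⟩) hs0
  have hδ0 : ENNReal.ofReal δ ≠ 0 := by simpa using hδ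
  have hΛ : ∀ x ∈ S, contrast Ω ω κ ε δ x = δ := fun x hx =>
    contrast_of_mem_inclusions (mem_iUnion₂.2 ⟨n, hn, hx.1⟩)
  -- The decisive point: on the inclusion the weight is the constant `δ` on both sides and cancels,
  -- which removes all dependence on the contrast.
  have hpull : ∀ F : Eu d → ℝ≥0∞, ∫⁻ x in S, ENNReal.ofReal (contrast Ω ω κ ε δ x) * F x =
      ENNReal.ofReal δ * ∫⁻ x in S, F x := fun F => by
    rw [← lintegral_const_mul' _ _ ENNReal.ofReal_ne_top]
    exact setLIntegral_congr_fun hSm fun x hx => by simp only [hΛ x hx]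
  rw [hpull, hpull, mul_left_comm, ENNReal.mul_le_mul_iff_right hδ0 ENNReal.ofReal_ne_top] at hen
  have hDum : AEStronglyMeasurable Du (volume.restrict S) :=
    h.memLp_grad.1.mono_measure (Measure.restrict_mono inter_subset_right le_rfl)
  have hfm : AEMeasurable (fun x => ‖f x‖ₑ ^ 2) (volume.restrict S) :=
    (h.memLp_source.1.mono_measure (Measure.restrict_mono inter_subset_right le_rfl)).enorm.pow_const 2
  have hζm := hζ.continuous.aestronglyMeasurable (μ := volume.restrict S)
  set X := ∫⁻ x in S, ‖ζ x • Du x‖ₑ ^ 2 with hX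
  have hXtop : X ≠ ∞ := by
    refine ((lintegral_mono fun x => pow_le_pow_left₀ zero_le
      (enorm_smul_le_of_abs_le (c := ζ x) (hζn x) (Du x)) 2).trans
      (lintegral_mono_set inter_subset_right)).trans_lt ?_ |>.ne
    rw [← eLpNorm_two_sq]
    exact ENNReal.pow_lt_top h.memLp_grad.2
  set R : Eu d → ℝ≥0∞ := fun x => ‖ζ x • gradArr E x‖ₑ ^ 2 +
    ‖tensArr (fderiv ℝ ζ x) (φ x)‖ₑ ^ 2 + ‖gradArr v x - Du x‖ₑ ^ 2 with hR
  have hXm : AEMeasurable (fun x => ‖ζ x • Du x‖ₑ ^ 2) (volume.restrict S) :=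
    (hζm.smul hDum).enorm.pow_const 2
  have hRm : AEMeasurable R (volume.restrict S) :=
    (((hζ.continuous.measurable.smul (measurable_gradArr E)).enorm.pow_const 2).aemeasurable.add
      ((measurable_tensArr _ hφL.continuous.measurable).enorm.pow_const 2).aemeasurable).add
      (((measurable_gradArr v).aestronglyMeasurable.sub hDum).enorm.pow_const 2)
  have hFr : ∫⁻ x in S, ‖ζ x • φ x‖ₑ ^ 2 ≤ ENNReal.ofReal ε ^ 2 * (4 * X + 4 * ∫⁻ x in S, R x) := by
    calc _ = ∫⁻ x in S, ‖ψ x‖ₑ ^ 2 := setLIntegral_congr_fun hSm fun x hx => by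
          simp only [hψ, indicator_of_mem hx.1]
      _ ≤ ∫⁻ x, ‖ψ x‖ₑ ^ 2 := setLIntegral_le_lintegral _ _
      _ ≤ ENNReal.ofReal ε ^ 2 * ∫⁻ x, ‖gradArr ψ x‖ₑ ^ 2 :=
          lintegral_le_of_eq_zero_off_cell hω.subset_cell hε n hψL fun x hx => by
            simp only [hψ]
            rw [indicator_of_notMem hx, smul_zero]
      _ = ENNReal.ofReal ε ^ 2 * ∫⁻ x in S, ‖gradArr ψ x‖ₑ ^ 2 := by
          rw [← lintegral_indicator hSm]
          congr 1
          refine lintegral_congr_ae ?_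
          filter_upwards [hoff] with x hx
          by_cases hxS : x ∈ S
          · simp [hxS]
          · simp [hxS, (hx hxS).1]
      _ ≤ ENNReal.ofReal ε ^ 2 * ∫⁻ x in S, (4 * ‖ζ x • Du x‖ₑ ^ 2 + 4 * R x) := by
          refine mul_le_mul' le_rfl (lintegral_mono_ae ?_)
          filter_upwards [ae_restrict_mem hSm, ae_restrict_of_ae hdiff] with x hx ⟨h1, h2, h3⟩
          have : ψ =ᶠ[𝓝 x] fun y => ζ y • φ y := by
            filter_upwards [hloc x hx] with y hy
            simp only [hψ, hy]
          -- The gradient of `ζ (v - E)` is split into `ζ Du`, to be absorbed, and terms already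
          -- collected in `R`.
          have e : gradArr ψ x = (ζ x • Du x + ζ x • (gradArr v x - Du x)) +
              (tensArr (fderiv ℝ ζ x) (φ x) - ζ x • gradArr E x) := by
            rw [gradArr_congr this, gradArr_smul h1 h2, h3]
            simp only [smul_sub]
            abel
          rw [e]
          calc _ ≤ 2 * (2 * ‖ζ x • Du x‖ₑ ^ 2 + 2 * ‖ζ x • (gradArr v x - Du x)‖ₑ ^ 2) +
                2 * (2 * ‖tensArr (fderiv ℝ ζ x) (φ x)‖ₑ ^ 2 + 2 * ‖ζ x • gradArr E x‖ₑ ^ 2) :=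
                (enorm_add_sq_le _ _).trans (add_le_add (mul_le_mul' le_rfl (enorm_add_sq_le _ _))
                  (mul_le_mul' le_rfl (enorm_sub_sq_le _ _)))
            _ ≤ 2 * (2 * ‖ζ x • Du x‖ₑ ^ 2 + 2 * ‖gradArr v x - Du x‖ₑ ^ 2) +
                2 * (2 * ‖tensArr (fderiv ℝ ζ x) (φ x)‖ₑ ^ 2 + 2 * ‖ζ x • gradArr E x‖ₑ ^ 2) := by
                gcongr
                exact enorm_smul_le_of_abs_le (hζn x) _
            _ = _ := by simp only [hR]; ring
      _ = _ := by
          rw [lintegral_add_left' (hXm.const_mul _), lintegral_const_mul'' _ hXm,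
            lintegral_const_mul'' _ hRm]
  set F := ∫⁻ x in S, ‖f x‖ₑ ^ 2 with hF
  have hes : ENNReal.ofReal (s ^ 2) = 8 * (c + 1) * ENNReal.ofReal ε ^ 2 := by
    rw [hs2, ENNReal.ofReal_mul (by positivity), ENNReal.ofReal_pow hε.le,
      ENNReal.ofReal_mul (by norm_num), ENNReal.ofReal_add (by positivity) (by norm_num)]
    simp
  have hes' : c * (ENNReal.ofReal (s ^ 2)⁻¹ * ENNReal.ofReal ε ^ 2 * 8) ≤ 1 := by
    rw [← ENNReal.ofReal_pow hε.le, ← ENNReal.ofReal_mul (by positivity), hs2,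
      ← ENNReal.ofReal_coe_nnreal (p := c)]
    have : (8 : ℝ≥0∞) = ENNReal.ofReal 8 := by simp
    rw [this, ← ENNReal.ofReal_mul (by positivity), ← ENNReal.ofReal_mul (by positivity)]
    refine ENNReal.ofReal_le_one.2 ?_
    have hc0 : (0 : ℝ) ≤ c := c.2
    have : (c : ℝ) * ((8 * (c + 1) * ε ^ 2)⁻¹ * ε ^ 2 * 8) = c / (c + 1) := by field_simp
    rw [this, div_le_one (by positivity)]
    linarith
  have h1 : X ≤ c * (8 * (c + 1) * ENNReal.ofReal ε ^ 2 * F + ENNReal.ofReal (s ^ 2)⁻¹ *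
      (∫⁻ x in S, ‖ζ x • φ x‖ₑ ^ 2) + ∫⁻ x in S, R x) := by
    refine hen.trans (mul_le_mul' le_rfl ?_)
    have hzm : Measurable fun x => ‖ζ x • φ x‖ₑ ^ 2 :=
      (hζ.continuous.measurable.smul hφL.continuous.measurable).enorm.pow_const 2
    have hfc : AEMeasurable (fun x => ENNReal.ofReal (s ^ 2) * ‖f x‖ₑ ^ 2) (volume.restrict S) :=
      hfm.const_mul _
    have hzc : Measurable fun x => ENNReal.ofReal (s ^ 2)⁻¹ * ‖ζ x • φ x‖ₑ ^ 2 := hzm.const_mul _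
    rw [← hes, ← lintegral_const_mul'' _ hfm, ← lintegral_const_mul _ hzm,
      ← lintegral_add_left' hfc, ← lintegral_add_left' (by exact hfc.add hzc.aemeasurable)]
    refine lintegral_mono fun x => ?_
    simp only [hR]
    calc _ ≤ ENNReal.ofReal (s ^ 2) * ‖f x‖ₑ ^ 2 + ENNReal.ofReal (s ^ 2)⁻¹ * ‖ζ x • φ x‖ₑ ^ 2 +
          ‖ζ x • gradArr E x‖ₑ ^ 2 + ‖tensArr (fderiv ℝ ζ x) (φ x)‖ₑ ^ 2 +
          ‖gradArr v x - Du x‖ₑ ^ 2 := by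
          gcongr
          · exact enorm_smul_le_of_abs_le (hζn x) _
          · exact enorm_smul_le_of_abs_le (hζn x) _
      _ = _ := by ring
  set Q := ∫⁻ x in S, R x with hQ
  set e2 := ENNReal.ofReal (s ^ 2)⁻¹ with he2
  have h2 : X ≤ (c * (8 * (c + 1) * ENNReal.ofReal ε ^ 2 * F + Q) + Q / 2) + X / 2 := by
    refine h1.trans ?_
    have h3 : c * (e2 * (ENNReal.ofReal ε ^ 2 * (4 * X + 4 * Q))) ≤ (X + Q) / 2 := by
      have : c * (e2 * (ENNReal.ofReal ε ^ 2 * (4 * X + 4 * Q))) =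
          c * (e2 * ENNReal.ofReal ε ^ 2 * 8) * ((X + Q) / 2) := by
        have h8 : (8 : ℝ≥0∞) * ((X + Q) / 2) = 4 * X + 4 * Q := by
          rw [← mul_div_assoc, ENNReal.div_eq_inv_mul, ← mul_assoc]
          have : (2 : ℝ≥0∞)⁻¹ * 8 = 4 := by
            rw [show (8 : ℝ≥0∞) = 2 * 4 by norm_num, ← mul_assoc,
              ENNReal.inv_mul_cancel (by norm_num) (by norm_num), one_mul]
          rw [this, mul_add]
        rw [← h8]; ring
      rw [this]
      exact mul_le_of_le_one_left zero_le hes'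
    calc _ ≤ c * (8 * (c + 1) * ENNReal.ofReal ε ^ 2 * F + Q) +
          c * (e2 * (ENNReal.ofReal ε ^ 2 * (4 * X + 4 * Q))) := by
          calc _ ≤ c * (8 * (c + 1) * ENNReal.ofReal ε ^ 2 * F +
              e2 * (ENNReal.ofReal ε ^ 2 * (4 * X + 4 * Q)) + Q) :=
                mul_le_mul' le_rfl (add_le_add (add_le_add le_rfl (mul_le_mul' le_rfl hFr)) le_rfl)
            _ = _ := by ring
      _ ≤ _ := by
          rw [add_assoc (c * _ : ℝ≥0∞) (Q / 2), ← ENNReal.add_div, add_comm Q X]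
          exact add_le_add le_rfl h3
  refine (ENNReal.le_two_mul_of_le_add_half hXtop h2).trans ?_
  have hcc : (cellConst μ : ℝ≥0∞) = 16 * (c + 1) ^ 2 := by
    simp [cellConst, hc]
  have hfc : AEMeasurable (fun x => ENNReal.ofReal ε ^ 2 * ‖f x‖ₑ ^ 2) (volume.restrict S) :=
    hfm.const_mul _
  rw [lintegral_add_left' hfc, lintegral_const_mul'' _ hfm, hcc]
  have hq2 : Q / 2 ≤ Q := ENNReal.half_le_self
  calc _ ≤ 2 * (c * (8 * (c + 1) * ENNReal.ofReal ε ^ 2 * F + Q) + Q) := by gcongr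
    _ = 16 * (c * (c + 1)) * (ENNReal.ofReal ε ^ 2 * F) + (2 * (c + 1)) * Q := by ring
    _ ≤ 16 * (c + 1) ^ 2 * (ENNReal.ofReal ε ^ 2 * F) + (16 * (c + 1) ^ 2) * Q := by
        have h1c : (1 : ℝ≥0∞) ≤ c + 1 := le_add_self
        have hcc1 : (c : ℝ≥0∞) ≤ c + 1 := le_self_add
        refine add_le_add (mul_le_mul' ?_ le_rfl) (mul_le_mul' ?_ le_rfl)
        · rw [sq]; gcongr
        · calc (2 : ℝ≥0∞) * (c + 1) = 2 * ((c + 1) * 1) := by ring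
            _ ≤ 16 * ((c + 1) * (c + 1)) := by gcongr; norm_num
            _ = _ := by ring
    _ = _ := by rw [← mul_add]

lemma isBounded_unitCell (d : ℕ) : Bornology.IsBounded (unitCell d) := by
  refine (Metric.isBounded_iff_subset_closedBall (0 : Eu d)).2
    ⟨Real.sqrt (∑ _i : Fin d, (1 / 2) ^ 2), fun x hx => ?_⟩
  rw [Metric.mem_closedBall, EuclideanSpace.dist_eq]
  refine Real.sqrt_le_sqrt (Finset.sum_le_sum fun i _ => ?_)
  rw [Real.dist_eq]
  exact pow_le_pow_left₀ (abs_nonneg _) (hx i).le 2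

lemma collar_mono {d : ℕ} (S : Set (Eu d)) {r r' : ℝ} (h : r ≤ r') : collar S r ⊆ collar S r' :=
  sdiff_subset_sdiff_left (Metric.thickening_mono h S)

lemma lintegral_enorm_sq_le_add_sub {d : ℕ} {F : Type*} [NormedAddCommGroup F] {S U : Set (Eu d)}
    (hSU : S ⊆ U) {w u : Eu d → F} (hu : AEStronglyMeasurable u (volume.restrict U)) :
    ∫⁻ x in S, ‖w x‖ₑ ^ 2 ≤ 2 * (∫⁻ x in S, ‖u x‖ₑ ^ 2) + 2 * ∫⁻ x in U, ‖w x - u x‖ₑ ^ 2 := by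
  have hm : AEMeasurable (fun x => ‖u x‖ₑ ^ 2) (volume.restrict S) :=
    (hu.mono_measure (Measure.restrict_mono hSU le_rfl)).enorm.pow_const 2
  calc _ ≤ ∫⁻ x in S, (2 * ‖u x‖ₑ ^ 2 + 2 * ‖w x - u x‖ₑ ^ 2) :=
        lintegral_mono fun x => enorm_sq_le_add_sub _ _
    _ = 2 * (∫⁻ x in S, ‖u x‖ₑ ^ 2) + 2 * ∫⁻ x in S, ‖w x - u x‖ₑ ^ 2 := by
        rw [lintegral_add_left' (hm.const_mul _), lintegral_const_mul'' _ hm,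
          lintegral_const_mul' _ _ (by simp)]
    _ ≤ _ := by
        refine add_le_add le_rfl (mul_le_mul' le_rfl (lintegral_mono_set hSU))

/-- The gradient in an inclusion whose neighbourhood lies in the domain of the solution is controlled
by the gradient around the inclusion. -/
lemma exists_cell_estimate {d : ℕ} [NeZero d] (m : ℕ) {μ : ℝ} (hμ : 0 < μ) {ω : Set (Eu d)}
    (hω : InclusionAssumptions ω) {r₀ : ℝ} (hr₀ : 0 < r₀) :
    ∃ C : ℝ≥0, ∀ {Ω : Set (Eu d)} {κ ε δ : ℝ}, 0 < ε → 0 < δ →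
      ∀ {a : Eu d → Tensor d m} {U S : Set (Eu d)} {u : Eu d → Eu m} {Du : Eu d → GradSp d m}
        {f g : Eu d → Eu m}, WeakSol μ (contrast Ω ω κ ε δ) a U Du f →
      HasBoundaryValue U S u Du g → ∀ {n : Fin d → ℤ}, n ∈ inclusionIndices Ω ω κ ε →
      Metric.thickening (r₀ * ε) (cellInclusion ω ε n) ⊆ U →
      ∫⁻ x in cellInclusion ω ε n, ‖Du x‖ₑ ^ 2 ≤
        C * (ENNReal.ofReal ε ^ 2 * (∫⁻ x in cellInclusion ω ε n, ‖f x‖ₑ ^ 2) +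
          ∫⁻ x in collar (cellInclusion ω ε n) (r₀ * ε), ‖Du x‖ₑ ^ 2) := by
  obtain ⟨r₁, hr₁, hle, C₁, hC₁⟩ := exists_cell_extension m hω.lipschitz
    ((isBounded_unitCell d).subset hω.subset_cell) hω.connected_frontier hr₀
  set C₂ : ℝ≥0 := C₁ * (C₁ + 1) with hC₂
  refine ⟨cellConst μ * (2 * C₂ + 1), fun {Ω κ ε δ} hε hδ {a U S u Du f g} h hbv {n} hn hU => ?_⟩
  obtain ⟨w, hwL, -, he⟩ := hbv.exists_approx
  set O := cellInclusion ω ε n with hO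
  have hOU : O ⊆ U := (Metric.self_subset_thickening (by positivity) _).trans hU
  have hcU : collar O (r₀ * ε) ⊆ U := sdiff_subset.trans hU
  have hOi : O ∩ U = O := inter_eq_left.2 hOU
  refine ENNReal.le_of_forall_le_add_of_tendsto (T := cellConst μ * (2 * C₂ + 1)) (by finiteness)
    he fun k => ?_
  obtain ⟨K, hw⟩ := hwL k
  -- The Poincaré constant `b` of the collar is subtracted before extending. The gradient is
  -- unchanged, and the `L²` term in the extension bound becomes `ε²` times the gradient on the
  -- larger collar.
  obtain ⟨⟨b, hb⟩, -⟩ := hC₁ ε hε n (w k) K hw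
  have hwb : LipschitzWith (K + 0) fun x => w k x - b := hw.sub (LipschitzWith.const b)
  obtain ⟨-, E, ⟨K', hE⟩, hEw, hEP⟩ := hC₁ ε hε n _ _ hwb
  have hen := h.cell_energy hμ hω hε hδ hn hwb hE hEw (ζ := fun _ => 1) (LipschitzWith.const 1)
    (fun _ => zero_le_one) (fun _ => le_rfl) (fun x hx hxU => absurd (hOU hx) hxU)
  simp only [one_smul, gradArr_sub_const, fderiv_fun_const, Pi.zero_apply, tensArr_zero_left,
    enorm_zero, ne_eq, OfNat.ofNat_ne_zero, not_false_eq_true, zero_pow, add_zero] at hen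
  rw [← hO, hOi] at hen
  have hEP' := hEP univ MeasurableSet.univ
  simp only [gradArr_sub_const, inter_univ] at hEP'
  set e := ENNReal.ofReal ε ^ 2 with he'
  have he0 : e ≠ 0 := by simpa [he'] using hε
  have hetop : e ≠ ∞ := by finiteness
  have hwm : Measurable fun x => ‖w k x - b‖ₑ ^ 2 := hwb.continuous.measurable.enorm.pow_const 2
  have hEm : ∫⁻ x in O, ‖gradArr E x‖ₑ ^ 2 ≤ C₂ * ∫⁻ x in collar O (r₀ * ε), ‖gradArr (w k) x‖ₑ ^ 2 := by
    refine (ENNReal.mul_le_mul_iff_right he0 hetop).1 ?_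
    calc _ = ∫⁻ x in O, e * ‖gradArr E x‖ₑ ^ 2 := (lintegral_const_mul' _ _ hetop).symm
      _ ≤ ∫⁻ x in O, (‖E x‖ₑ ^ 2 + e * ‖gradArr E x‖ₑ ^ 2) := lintegral_mono fun x => le_add_self
      _ ≤ C₁ * ∫⁻ x in collar O (r₁ * ε) ∩ Metric.thickening (r₁ * ε) univ,
            (‖w k x - b‖ₑ ^ 2 + e * ‖gradArr (w k) x‖ₑ ^ 2) := hEP'
      _ ≤ C₁ * ∫⁻ x in collar O (r₁ * ε), (‖w k x - b‖ₑ ^ 2 + e * ‖gradArr (w k) x‖ₑ ^ 2) :=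
          mul_le_mul' le_rfl (lintegral_mono_set inter_subset_left)
      _ = C₁ * ((∫⁻ x in collar O (r₁ * ε), ‖w k x - b‖ₑ ^ 2) +
            e * ∫⁻ x in collar O (r₁ * ε), ‖gradArr (w k) x‖ₑ ^ 2) := by
          rw [lintegral_add_left hwm, lintegral_const_mul' _ _ hetop]
      _ ≤ C₁ * (C₁ * e * (∫⁻ x in collar O (r₀ * ε), ‖gradArr (w k) x‖ₑ ^ 2) +
            e * ∫⁻ x in collar O (r₀ * ε), ‖gradArr (w k) x‖ₑ ^ 2) := by
          refine mul_le_mul' le_rfl (add_le_add hb (mul_le_mul' le_rfl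
            (lintegral_mono_set (collar_mono _ ?_))))
          gcongr
      _ = _ := by rw [hC₂]; push_cast; ring
  have hfm : AEMeasurable (fun x => ‖f x‖ₑ ^ 2) (volume.restrict O) :=
    (h.memLp_source.1.mono_measure (Measure.restrict_mono hOU le_rfl)).enorm.pow_const 2
  have hfm' : AEMeasurable (fun x => e * ‖f x‖ₑ ^ 2) (volume.restrict O) := hfm.const_mul _
  have hEm' : Measurable fun x => ‖gradArr E x‖ₑ ^ 2 := (measurable_gradArr E).enorm.pow_const 2
  rw [lintegral_add_left' hfm', lintegral_const_mul'' _ hfm, lintegral_add_left hEm'] at hen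
  have hgr := lintegral_enorm_sq_le_add_sub hcU (w := gradArr (w k)) h.memLp_grad.1
  set F := ∫⁻ x in O, ‖f x‖ₑ ^ 2
  set Y := ∫⁻ x in collar O (r₀ * ε), ‖Du x‖ₑ ^ 2
  set Q := ∫⁻ x in U, ‖gradArr (w k) x - Du x‖ₑ ^ 2
  calc _ ≤ cellConst μ * (e * F + ((∫⁻ x in O, ‖gradArr E x‖ₑ ^ 2) +
        ∫⁻ x in O, ‖gradArr (w k) x - Du x‖ₑ ^ 2)) := hen
    _ ≤ cellConst μ * (e * F + (C₂ * (2 * Y + 2 * Q) + Q)) :=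
        mul_le_mul' le_rfl (add_le_add le_rfl (add_le_add (hEm.trans (mul_le_mul' le_rfl hgr))
          (lintegral_mono_set hOU)))
    _ = cellConst μ * (1 * (e * F) + (2 * C₂) * Y) + cellConst μ * (2 * C₂ + 1) * Q := by ring
    _ ≤ cellConst μ * ((2 * C₂ + 1) * (e * F) + (2 * C₂ + 1) * Y) +
        cellConst μ * (2 * C₂ + 1) * ((∫⁻ x in U, ‖w k x - u x‖ₑ ^ 2) + Q) :=
        add_le_add (mul_le_mul' le_rfl (add_le_add (mul_le_mul' le_add_self le_rfl)
          (mul_le_mul' le_self_add le_rfl))) (mul_le_mul' le_rfl le_add_self)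
    _ = _ := by push_cast; ring

/-- The localized version of the estimate in one inclusion, with a cutoff function on the scale of
the inclusion. -/
lemma exists_cell_estimate_cutoff {d : ℕ} [NeZero d] (m : ℕ) {μ : ℝ} (hμ : 0 < μ) {ω : Set (Eu d)}
    (hω : InclusionAssumptions ω) {r₀ : ℝ} (hr₀ : 0 < r₀) (N : ℝ≥0) :
    ∃ C : ℝ≥0, ∀ {Ω : Set (Eu d)} {κ ε δ : ℝ}, 0 < ε → 0 < δ →
      ∀ {a : Eu d → Tensor d m} {U S : Set (Eu d)} {u : Eu d → Eu m} {Du : Eu d → GradSp d m}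
        {f g : Eu d → Eu m}, WeakSol μ (contrast Ω ω κ ε δ) a U Du f →
      AEStronglyMeasurable u (volume.restrict U) →
      HasBoundaryValue U S u Du g → ∀ {n : Fin d → ℤ}, n ∈ inclusionIndices Ω ω κ ε →
      ∀ {ζ : Eu d → ℝ} {L : ℝ≥0}, LipschitzWith L ζ → (∀ x, 0 ≤ ζ x) → (∀ x, ζ x ≤ 1) →
      L * ε ≤ N → (∀ x, ζ x ≠ 0 → x ∈ U) →
      Metric.thickening (r₀ * ε) {x | ζ x ≠ 0} ⊆ U →
      ∫⁻ x in cellInclusion ω ε n ∩ U, ‖ζ x • Du x‖ₑ ^ 2 ≤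
        C * (ENNReal.ofReal ε ^ 2 * (∫⁻ x in cellInclusion ω ε n ∩ U, ‖f x‖ₑ ^ 2) +
          ENNReal.ofReal (ε ^ 2)⁻¹ *
            (∫⁻ x in Metric.thickening (r₀ * ε) (cellInclusion ω ε n) ∩ U, ‖u x‖ₑ ^ 2) +
          ∫⁻ x in collar (cellInclusion ω ε n) (r₀ * ε) ∩ Metric.thickening (r₀ * ε) {x | ζ x ≠ 0},
            ‖Du x‖ₑ ^ 2) := by
  obtain ⟨r₁, hr₁, hle, C₁, hC₁⟩ := exists_cell_extension m hω.lipschitz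
    ((isBounded_unitCell d).subset hω.subset_cell) hω.connected_frontier hr₀
  set D : ℝ≥0 := 2 * (d * N ^ 2) + 1 with hD
  set T : ℝ≥0 := 2 * (D * C₁) + 2 * D + 1 with hT
  refine ⟨cellConst μ * T, fun {Ω κ ε δ} hε hδ {a U S u Du f g} h hu hbv {n} hn {ζ L} hζ hζ0 hζ1 hL
    hζU hζT => ?_⟩
  obtain ⟨w, hwL, -, he⟩ := hbv.exists_approx
  set O := cellInclusion ω ε n with hO
  set P : Set (Eu d) := {x | ζ x ≠ 0} with hP
  have hPm : MeasurableSet P := (isOpen_ne_fun hζ.continuous continuous_const).measurableSet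
  set i := ENNReal.ofReal (ε ^ 2)⁻¹ with hi
  refine ENNReal.le_of_forall_le_add_of_tendsto (T := cellConst μ * (T * (i + 1)))
    (by finiteness) he fun k => ?_
  obtain ⟨K, hw⟩ := hwL k
  -- The collar may now leave `U`, so Poincaré's inequality on it is not available. No constant is
  -- subtracted, and the `L²` norm of the function appears with weight `ε⁻²`.
  obtain ⟨-, E, ⟨K', hE⟩, hEw, hEP⟩ := hC₁ ε hε n _ _ hw
  have hen := h.cell_energy hμ hω hε hδ hn hw hE hEw hζ hζ0 hζ1
    (fun x hx hxU => by by_contra h0; exact hxU (hζU x h0))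
  have hEP' := hEP P hPm
  set e := ENNReal.ofReal ε ^ 2 with he'
  have hetop : e ≠ ∞ := by finiteness
  have hitop : i ≠ ∞ := by finiteness
  have hie : i * e = 1 := by
    rw [hi, he', ← ENNReal.ofReal_pow hε.le, ← ENNReal.ofReal_mul (by positivity),
      inv_mul_cancel₀ (by positivity), ENNReal.ofReal_one]
  have hLi : ((d * L ^ 2 : ℝ≥0) : ℝ≥0∞) ≤ (d * N ^ 2 : ℝ≥0) * i := by
    have h1 : ((d * L ^ 2 : ℝ≥0) : ℝ) ≤ (d * N ^ 2 : ℝ≥0) * (ε ^ 2)⁻¹ := by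
      rw [← div_eq_mul_inv, le_div_iff₀ (by positivity)]
      push_cast
      rw [mul_assoc, ← mul_pow]
      gcongr
    have h2 := ENNReal.ofReal_le_ofReal h1
    rwa [ENNReal.ofReal_mul (by positivity), ENNReal.ofReal_coe_nnreal,
      ENNReal.ofReal_coe_nnreal] at h2
  have hwm : Measurable fun x => ‖w k x‖ₑ ^ 2 := hw.continuous.measurable.enorm.pow_const 2
  have hfm : AEMeasurable (fun x => ‖f x‖ₑ ^ 2) (volume.restrict (O ∩ U)) :=
    (h.memLp_source.1.mono_measure (Measure.restrict_mono inter_subset_right le_rfl)).enorm.pow_const 2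
  have hfm' : AEMeasurable (fun x => e * ‖f x‖ₑ ^ 2) (volume.restrict (O ∩ U)) := hfm.const_mul _
  have hOm : MeasurableSet O := (isOpen_cellInclusion hω.lipschitz.isOpen hε n).measurableSet
  set Ψ : Eu d → ℝ≥0∞ := fun x => ‖E x‖ₑ ^ 2 + e * ‖gradArr E x‖ₑ ^ 2 with hΨ
  have hΨm : Measurable Ψ := (hE.continuous.measurable.enorm.pow_const 2).add
    (((measurable_gradArr E).enorm.pow_const 2).const_mul _)
  -- Where `ζ` vanishes so does its derivative, hence `E` matters only on `P`. By the local
  -- extension bound, only values near `P`, inside `U`, are used.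
  have hpt : ∀ x, ‖ζ x • gradArr E x‖ₑ ^ 2 + ‖tensArr (fderiv ℝ ζ x) (w k x - E x)‖ₑ ^ 2 +
      ‖gradArr (w k) x - Du x‖ₑ ^ 2 ≤ P.indicator (fun x => D * i * Ψ x) x +
        (D * i * ‖w k x‖ₑ ^ 2 + ‖gradArr (w k) x - Du x‖ₑ ^ 2) := by
    intro x
    by_cases hx : ζ x = 0
    · have hf : fderiv ℝ ζ x = 0 := by
        refine IsLocalMin.fderiv_eq_zero (Eventually.of_forall fun y => ?_)
        rw [hx]; exact hζ0 y
      rw [hx, hf, tensArr_zero_left]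
      simp only [zero_smul, enorm_zero, ne_eq, OfNat.ofNat_ne_zero, not_false_eq_true, zero_pow,
        zero_add]
      exact le_add_left le_add_self
    · rw [indicator_of_mem (show x ∈ P from hx), ← add_assoc]
      refine add_le_add ?_ le_rfl
      have h1 : ‖ζ x • gradArr E x‖ₑ ^ 2 ≤ i * (e * ‖gradArr E x‖ₑ ^ 2) := by
        rw [← mul_assoc, hie, one_mul]
        gcongr
        refine enorm_smul_le_of_abs_le ?_ _
        rw [abs_of_nonneg (hζ0 x)]; exact hζ1 x
      have h2 : ‖tensArr (fderiv ℝ ζ x) (w k x - E x)‖ₑ ^ 2 ≤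
          (d * N ^ 2 : ℝ≥0) * i * (2 * ‖w k x‖ₑ ^ 2 + 2 * ‖E x‖ₑ ^ 2) :=
        (enorm_tensArr_sq_le hζ x _).trans (mul_le_mul' hLi (enorm_sub_sq_le _ _))
      refine (add_le_add h1 h2).trans ?_
      have hDc : (D : ℝ≥0∞) = 2 * (d * N ^ 2 : ℝ≥0) + 1 := by rw [hD]; push_cast; ring
      rw [hDc]
      set c := ((d * N ^ 2 : ℝ≥0) : ℝ≥0∞)
      simp only [hΨ]
      calc _ = i * (e * ‖gradArr E x‖ₑ ^ 2) + (2 * c) * i * ‖E x‖ₑ ^ 2 +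
            (2 * c) * i * ‖w k x‖ₑ ^ 2 := by ring
        _ ≤ (2 * c + 1) * (i * (e * ‖gradArr E x‖ₑ ^ 2)) + (2 * c + 1) * i * ‖E x‖ₑ ^ 2 +
            (2 * c + 1) * i * ‖w k x‖ₑ ^ 2 := by
            refine add_le_add (add_le_add (le_mul_of_one_le_left zero_le le_add_self) ?_) ?_ <;>
            · refine mul_le_mul' (mul_le_mul' le_self_add le_rfl) le_rfl
        _ = _ := by ring
  set W := collar O (r₀ * ε) ∩ Metric.thickening (r₀ * ε) P with hW
  set V := Metric.thickening (r₀ * ε) O ∩ U with hV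
  have hWV : W ⊆ V := fun x hx => ⟨hx.1.1, hζT hx.2⟩
  have hOV : O ∩ U ⊆ V :=
    inter_subset_inter_left _ (Metric.self_subset_thickening (by positivity) _)
  have hgr := lintegral_enorm_sq_le_add_sub (S := W) (U := U) (fun x hx => hζT hx.2)
    (w := gradArr (w k)) h.memLp_grad.1
  have hwu := lintegral_enorm_sq_le_add_sub (S := V) (U := U) inter_subset_right (w := w k) hu
  set F := ∫⁻ x in O ∩ U, ‖f x‖ₑ ^ 2 with hF
  set Y := ∫⁻ x in W, ‖Du x‖ₑ ^ 2 with hY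
  set Q := ∫⁻ x in U, ‖gradArr (w k) x - Du x‖ₑ ^ 2 with hQ
  set B := ∫⁻ x in V, ‖u x‖ₑ ^ 2 with hB
  set Q' := ∫⁻ x in U, ‖w k x - u x‖ₑ ^ 2 with hQ'
  have hE2 : ∫⁻ x in O ∩ U, P.indicator (fun x => D * i * Ψ x) x ≤
      D * i * (C₁ * ((2 * B + 2 * Q') + e * (2 * Y + 2 * Q))) := by
    calc _ ≤ ∫⁻ x in O, P.indicator (fun x => D * i * Ψ x) x := lintegral_mono_set inter_subset_left
      _ = ∫⁻ x in O ∩ P, D * i * Ψ x := by rw [setLIntegral_indicator hPm, inter_comm]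
      _ = D * i * ∫⁻ x in O ∩ P, Ψ x := lintegral_const_mul _ hΨm
      _ ≤ D * i * (C₁ * ∫⁻ x in W, (‖w k x‖ₑ ^ 2 + e * ‖gradArr (w k) x‖ₑ ^ 2)) := by
          refine mul_le_mul' le_rfl (hEP'.trans (mul_le_mul' le_rfl (lintegral_mono_set ?_)))
          exact inter_subset_inter (collar_mono _ (by gcongr))
            (Metric.thickening_mono (by gcongr) _)
      _ = D * i * (C₁ * ((∫⁻ x in W, ‖w k x‖ₑ ^ 2) + e * ∫⁻ x in W, ‖gradArr (w k) x‖ₑ ^ 2)) := by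
          rw [lintegral_add_left hwm, lintegral_const_mul' _ _ hetop]
      _ ≤ _ := mul_le_mul' le_rfl (mul_le_mul' le_rfl (add_le_add
          ((lintegral_mono_set hWV).trans hwu) (mul_le_mul' le_rfl hgr)))
  have hsum : ∫⁻ x in O ∩ U, (e * ‖f x‖ₑ ^ 2 + (‖ζ x • gradArr E x‖ₑ ^ 2 +
      ‖tensArr (fderiv ℝ ζ x) (w k x - E x)‖ₑ ^ 2 + ‖gradArr (w k) x - Du x‖ₑ ^ 2)) ≤
      e * F + (D * i * (C₁ * ((2 * B + 2 * Q') + e * (2 * Y + 2 * Q))) +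
        (D * i * (2 * B + 2 * Q') + Q)) := by
    have hind : Measurable (P.indicator fun x => (D : ℝ≥0∞) * i * Ψ x) :=
      (hΨm.const_mul _).indicator hPm
    calc _ ≤ ∫⁻ x in O ∩ U, (e * ‖f x‖ₑ ^ 2 + (P.indicator (fun x => D * i * Ψ x) x +
          (D * i * ‖w k x‖ₑ ^ 2 + ‖gradArr (w k) x - Du x‖ₑ ^ 2))) :=
          lintegral_mono fun x => add_le_add le_rfl (hpt x)
      _ = e * F + ((∫⁻ x in O ∩ U, P.indicator (fun x => D * i * Ψ x) x) +
          (D * i * (∫⁻ x in O ∩ U, ‖w k x‖ₑ ^ 2) +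
            ∫⁻ x in O ∩ U, ‖gradArr (w k) x - Du x‖ₑ ^ 2)) := by
          rw [lintegral_add_left' hfm', lintegral_const_mul'' _ hfm, lintegral_add_left hind,
            lintegral_add_left (hwm.const_mul _), lintegral_const_mul _ hwm]
      _ ≤ _ := add_le_add le_rfl (add_le_add hE2 (add_le_add (mul_le_mul' le_rfl
          ((lintegral_mono_set hOV).trans hwu)) (lintegral_mono_set inter_subset_right)))
  refine (hen.trans (mul_le_mul' le_rfl hsum)).trans ?_
  have hTc : (T : ℝ≥0∞) = 2 * (D * C₁) + 2 * D + 1 := by rw [hT]; push_cast; ring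
  refine le_trans (b := cellConst μ * ((T : ℝ≥0∞) * (e * F) + T * (i * B) + T * Y +
    (T * ((i + 1) * Q') + T * ((i + 1) * Q)))) (mul_le_mul' le_rfl ?_)
    (le_of_eq (by push_cast; ring))
  rw [hTc]
  calc _ = 1 * (e * F) + (2 * (D * C₁) + 2 * D) * (i * B) + (2 * (D * C₁)) * ((i * e) * Y) +
        ((2 * (D * C₁) + 2 * D) * (i * Q') + (2 * (D * C₁) * (i * e) + 1) * Q) := by ring
    _ ≤ (2 * (D * C₁) + 2 * D + 1) * (e * F) + (2 * (D * C₁) + 2 * D + 1) * (i * B) +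
        (2 * (D * C₁) + 2 * D + 1) * Y +
        ((2 * (D * C₁) + 2 * D + 1) * ((i + 1) * Q') +
          (2 * (D * C₁) + 2 * D + 1) * ((i + 1) * Q)) := by
        have : (2 * (D * C₁) + 1 : ℝ≥0∞) ≤ 2 * (D * C₁) + 2 * D + 1 :=
          add_le_add le_self_add le_rfl
        rw [hie, one_mul Y, mul_one]
        refine add_le_add (add_le_add (add_le_add ?_ ?_) ?_) (add_le_add ?_ ?_)
        · exact mul_le_mul' le_add_self le_rfl
        · exact mul_le_mul' le_self_add le_rfl
        · refine mul_le_mul' ?_ le_rfl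
          rw [add_assoc]; exact le_self_add
        · exact mul_le_mul' le_self_add (mul_le_mul' le_self_add le_rfl)
        · refine mul_le_mul' ?_ (le_mul_of_one_le_left zero_le le_add_self)
          exact this

/-! ### Summation over the inclusions. -/

/-- The right sides of the cell estimates live on pairwise disjoint neighbourhoods, so the sum over
all inclusions costs no more than one integral over `U`, whatever the number of cells. -/
lemma lintegral_le_background_add_cells {d : ℕ} [NeZero d] {Ω ω : Set (Eu d)} {κ ε r : ℝ}
    (hω : InclusionAssumptions ω) (hr : Metric.thickening r ω ⊆ unitCell d) (hε : 0 < ε)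
    {U V : Set (Eu d)} (hU : MeasurableSet U)
    (hVΩ : V ⊆ Ω) {Ψ Φ : Eu d → ℝ≥0∞} {C : ℝ≥0}
    (h : ∀ n ∈ inclusionIndices Ω ω κ ε, (cellInclusion ω ε n ∩ V).Nonempty →
      ∫⁻ x in cellInclusion ω ε n ∩ V, Ψ x ≤
        C * ∫⁻ x in Metric.thickening (r * ε) (cellInclusion ω ε n) ∩ U, Φ x) :
    ∫⁻ x in V, Ψ x ≤ (∫⁻ x in V ∩ background Ω ω κ ε, Ψ x) + C * ∫⁻ x in U, Φ x := by
  set I := inclusionIndices Ω ω κ ε with hI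
  have hcov : (V : Set (Eu d)) ≤ᵐ[volume]
      ((V ∩ background Ω ω κ ε) ∪ ⋃ n : I, cellInclusion ω ε n ∩ V : Set (Eu d)) := by
    filter_upwards [ae_mem_inclusions_or_background (Ω := Ω) (κ := κ) hω hε] with x hx hxV
    rcases hx (hVΩ hxV) with h1 | h1
    · obtain ⟨n, hn, hxn⟩ := mem_iUnion₂.1 h1
      exact Or.inr (mem_iUnion.2 ⟨⟨n, hn⟩, hxn, hxV⟩)
    · exact Or.inl ⟨hxV, h1⟩
  have hdisj : Pairwise (Function.onFun Disjoint fun n : I =>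
      Metric.thickening (r * ε) (cellInclusion ω ε n) ∩ U) := fun n k hnk =>
    disjoint_left.2 fun x hx hx' => hnk (Subtype.ext (eq_of_mem_thickening hr hε hx.1 hx'.1))
  calc _ ≤ ∫⁻ x in (V ∩ background Ω ω κ ε) ∪ ⋃ n : I, cellInclusion ω ε n ∩ V, Ψ x :=
        lintegral_mono' (Measure.restrict_mono_ae hcov) le_rfl
    _ ≤ (∫⁻ x in V ∩ background Ω ω κ ε, Ψ x) + ∫⁻ x in ⋃ n : I, cellInclusion ω ε n ∩ V, Ψ x :=
        lintegral_union_le _ _ _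
    _ ≤ (∫⁻ x in V ∩ background Ω ω κ ε, Ψ x) + ∑' n : I, ∫⁻ x in cellInclusion ω ε n ∩ V, Ψ x :=
        add_le_add le_rfl (lintegral_iUnion_le _ _)
    _ ≤ (∫⁻ x in V ∩ background Ω ω κ ε, Ψ x) + ∑' n : I,
          C * ∫⁻ x in Metric.thickening (r * ε) (cellInclusion ω ε n) ∩ U, Φ x := by
        refine add_le_add le_rfl (ENNReal.tsum_le_tsum fun n => ?_)
        by_cases hne : (cellInclusion ω ε n ∩ V).Nonempty
        · exact h n n.2 hne
        · rw [not_nonempty_iff_eq_empty.1 hne]; simp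
    _ = (∫⁻ x in V ∩ background Ω ω κ ε, Ψ x) + C * ∫⁻ x in ⋃ n : I,
          Metric.thickening (r * ε) (cellInclusion ω ε n) ∩ U, Φ x := by
        rw [ENNReal.tsum_mul_left, lintegral_iUnion
          (fun n => Metric.isOpen_thickening.measurableSet.inter hU) hdisj]
    _ ≤ _ := add_le_add le_rfl (mul_le_mul' le_rfl (lintegral_mono_set
        (iUnion_subset fun n => inter_subset_right)))

/-- If all inclusions that meet `V` have their neighbourhoods in `W`, the gradient in `V` is controlled
by the gradient in the background part of `W`. -/
lemma exists_estimate_of_thickening_subset {d : ℕ} [NeZero d] (m : ℕ) {μ : ℝ} (hμ : 0 < μ)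
    {ω : Set (Eu d)} (hω : InclusionAssumptions ω) {r : ℝ} (hr0 : 0 < r)
    (hr : Metric.thickening r ω ⊆ unitCell d) :
    ∃ C : ℝ≥0, ∀ {Ω : Set (Eu d)} {κ ε δ : ℝ}, 0 < ε → 0 < δ → IsOpen Ω →
      ∀ {a : Eu d → Tensor d m} {U S V W : Set (Eu d)} {u : Eu d → Eu m} {Du : Eu d → GradSp d m}
        {f g : Eu d → Eu m}, WeakSol μ (contrast Ω ω κ ε δ) a U Du f →
      HasBoundaryValue U S u Du g → MeasurableSet V → MeasurableSet W → V ⊆ W → W ⊆ U → U ⊆ Ω →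
      (∀ n ∈ inclusionIndices Ω ω κ ε, (cellInclusion ω ε n ∩ V).Nonempty →
        Metric.thickening (r * ε) (cellInclusion ω ε n) ⊆ W) →
      ∫⁻ x in V, ‖Du x‖ₑ ^ 2 ≤ C * ((∫⁻ x in W ∩ background Ω ω κ ε, ‖Du x‖ₑ ^ 2) +
        ENNReal.ofReal ε ^ 2 * ∫⁻ x in U, ‖f x‖ₑ ^ 2) := by
  obtain ⟨C, hC⟩ := exists_cell_estimate m hμ hω hr0
  refine ⟨C + 1, fun {Ω κ ε δ} hε hδ hΩ {a U S V W u Du f g} h hbv hV hW hVW hWU hUΩ hcell => ?_⟩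
  set b := background Ω ω κ ε with hb
  have hbm : MeasurableSet (W ∩ b) := hW.inter (measurableSet_background hΩ)
  have hUm := h.isOpen.measurableSet
  set Φ : Eu d → ℝ≥0∞ := fun x => ENNReal.ofReal ε ^ 2 * ‖f x‖ₑ ^ 2 +
    (W ∩ b).indicator (fun x => ‖Du x‖ₑ ^ 2) x with hΦ
  have hfm : AEMeasurable (fun x => ‖f x‖ₑ ^ 2) (volume.restrict U) :=
    h.memLp_source.1.enorm.pow_const 2
  have hfc : AEMeasurable (fun x => ENNReal.ofReal ε ^ 2 * ‖f x‖ₑ ^ 2) (volume.restrict U) :=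
    hfm.const_mul _
  have key := lintegral_le_background_add_cells (Ω := Ω) (κ := κ) hω hr hε hUm
    (hVW.trans (hWU.trans hUΩ)) (Ψ := fun x => ‖Du x‖ₑ ^ 2) (Φ := Φ) (C := C) (by
      intro n hn hne
      have hth := hcell n hn hne
      set T := Metric.thickening (r * ε) (cellInclusion ω ε n) with hT
      have hOT : cellInclusion ω ε n ⊆ T := Metric.self_subset_thickening (by positivity) _
      have hTU : T ⊆ U := hth.trans hWU
      have hTi : T ∩ U = T := inter_eq_left.2 hTU
      have hcol : collar (cellInclusion ω ε n) (r * ε) ⊆ W ∩ b := fun x hx =>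
        ⟨hth hx.1, collar_inter_subset_background hr hr0 hε n ⟨hx, hUΩ (hTU hx.1)⟩⟩
      calc _ ≤ ∫⁻ x in cellInclusion ω ε n, ‖Du x‖ₑ ^ 2 := lintegral_mono_set inter_subset_left
        _ ≤ _ := hC hε hδ h hbv hn hTU
        _ ≤ C * ((∫⁻ x in T, ENNReal.ofReal ε ^ 2 * ‖f x‖ₑ ^ 2) +
              ∫⁻ x in T, (W ∩ b).indicator (fun x => ‖Du x‖ₑ ^ 2) x) := by
            refine mul_le_mul' le_rfl (add_le_add ?_ ?_)
            · rw [lintegral_const_mul' _ _ (by finiteness)]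
              exact mul_le_mul' le_rfl (lintegral_mono_set hOT)
            · rw [setLIntegral_indicator hbm]
              exact lintegral_mono_set fun x hx => ⟨hcol hx, hx.1⟩
        _ = C * ∫⁻ x in T ∩ U, Φ x := by
            rw [hTi, lintegral_add_left' (hfc.mono_measure (Measure.restrict_mono hTU le_rfl))])
  refine key.trans ?_
  have hΦi : ∫⁻ x in U, Φ x ≤ ENNReal.ofReal ε ^ 2 * (∫⁻ x in U, ‖f x‖ₑ ^ 2) +
      ∫⁻ x in W ∩ b, ‖Du x‖ₑ ^ 2 := by
    rw [lintegral_add_left' hfc, lintegral_const_mul'' _ hfm, setLIntegral_indicator hbm]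
    exact add_le_add le_rfl (lintegral_mono_set inter_subset_left)
  set F := ENNReal.ofReal ε ^ 2 * ∫⁻ x in U, ‖f x‖ₑ ^ 2
  set Y := ∫⁻ x in W ∩ b, ‖Du x‖ₑ ^ 2
  calc _ ≤ Y + C * (F + Y) :=
        add_le_add (lintegral_mono_set (inter_subset_inter_left _ hVW)) (mul_le_mul' le_rfl hΦi)
    _ ≤ (Y + F) + C * (F + Y) := add_le_add le_self_add le_rfl
    _ = _ := by push_cast; ring

lemma exists_cutoff {X : Type*} [PseudoMetricSpace X] (S : Set X) {ρ : ℝ} (hρ : 0 < ρ) :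
    ∃ η : X → ℝ, LipschitzWith (ρ⁻¹).toNNReal η ∧ (∀ x, 0 ≤ η x) ∧ (∀ x, η x ≤ 1) ∧
      (∀ x ∈ S, η x = 1) ∧ ∀ x, η x ≠ 0 → x ∈ Metric.thickening ρ S := by
  refine ⟨fun x => thickenedIndicator hρ S x, ?_, fun x => NNReal.coe_nonneg _, fun x => ?_,
    fun x hx => ?_, fun x hx => ?_⟩
  · have := (lipschitzWith_thickenedIndicator hρ S)
    rw [Real.toNNReal_inv]
    exact this
  · exact_mod_cast thickenedIndicator_le_one hρ S x
  · change ((thickenedIndicator hρ S x : ℝ≥0) : ℝ) = 1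
    rw [thickenedIndicator_one hρ S hx, NNReal.coe_one]
  · by_contra h
    refine hx ?_
    change ((thickenedIndicator hρ S x : ℝ≥0) : ℝ) = 0
    rw [thickenedIndicator_zero hρ S h, NNReal.coe_zero]

/-- The version of `exists_estimate_of_thickening_subset` in which the inclusions may leave `W`, at
the cost of the `L²` norm of the solution on the scale of the inclusions. -/
lemma exists_estimate_of_cutoff {d : ℕ} [NeZero d] (m : ℕ) {μ : ℝ} (hμ : 0 < μ)
    {ω : Set (Eu d)} (hω : InclusionAssumptions ω) {r : ℝ} (hr0 : 0 < r)
    (hr : Metric.thickening r ω ⊆ unitCell d) :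
    ∃ C : ℝ≥0, ∀ {Ω : Set (Eu d)} {κ ε δ : ℝ}, 0 < ε → 0 < δ → IsOpen Ω →
      ∀ {a : Eu d → Tensor d m} {U S V W T : Set (Eu d)} {u : Eu d → Eu m} {Du : Eu d → GradSp d m}
        {f g : Eu d → Eu m}, WeakSol μ (contrast Ω ω κ ε δ) a U Du f →
      AEStronglyMeasurable u (volume.restrict U) →
      HasBoundaryValue U S u Du g → MeasurableSet V → MeasurableSet W → V ⊆ W → W ⊆ U → U ⊆ Ω →
      (∀ n ∈ inclusionIndices Ω ω κ ε, cellInclusion ω ε n ∩ V ⊆ T) →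
      Metric.thickening (2 * r * ε) T ⊆ W →
      ∫⁻ x in V, ‖Du x‖ₑ ^ 2 ≤ C * ((∫⁻ x in W ∩ background Ω ω κ ε, ‖Du x‖ₑ ^ 2) +
        ENNReal.ofReal ε ^ 2 * (∫⁻ x in U, ‖f x‖ₑ ^ 2) +
        ENNReal.ofReal (ε ^ 2)⁻¹ * ∫⁻ x in U, ‖u x‖ₑ ^ 2) := by
  obtain ⟨C, hC⟩ := exists_cell_estimate_cutoff m hμ hω hr0 (r⁻¹).toNNReal
  refine ⟨C + 1, fun {Ω κ ε δ} hε hδ hΩ {a U S V W T u Du f g} h hu hbv hV hW hVW hWU hUΩ hVT hTW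
    => ?_⟩
  obtain ⟨ζ, hζL, hζ0, hζ1, hζS, hζT⟩ := exists_cutoff T (mul_pos hr0 hε)
  set b := background Ω ω κ ε with hb
  have hbm : MeasurableSet (W ∩ b) := hW.inter (measurableSet_background hΩ)
  have hUm := h.isOpen.measurableSet
  set e := ENNReal.ofReal ε ^ 2 with he
  set i := ENNReal.ofReal (ε ^ 2)⁻¹ with hi
  set Φ : Eu d → ℝ≥0∞ := fun x => e * ‖f x‖ₑ ^ 2 + (i * ‖u x‖ₑ ^ 2 +
    (W ∩ b).indicator (fun x => ‖Du x‖ₑ ^ 2) x) with hΦ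
  have hfm : AEMeasurable (fun x => ‖f x‖ₑ ^ 2) (volume.restrict U) :=
    h.memLp_source.1.enorm.pow_const 2
  have hfc : AEMeasurable (fun x => e * ‖f x‖ₑ ^ 2) (volume.restrict U) := hfm.const_mul _
  have hum : AEMeasurable (fun x => ‖u x‖ₑ ^ 2) (volume.restrict U) := hu.enorm.pow_const 2
  have huc : AEMeasurable (fun x => i * ‖u x‖ₑ ^ 2) (volume.restrict U) := hum.const_mul _
  -- The radius `2 r ε` in the hypothesis is used up in two steps: `r ε` for the support of the
  -- cutoff and `r ε` for the reach of the extension.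
  have hζW : Metric.thickening (r * ε) {x | ζ x ≠ 0} ⊆ W := by
    refine (Metric.thickening_subset_of_subset _ hζT).trans
      ((Metric.thickening_thickening_subset _ _ _).trans (Subset.trans (le_of_eq ?_) hTW))
    congr 1; ring
  have hL : ((r * ε)⁻¹.toNNReal : ℝ) * ε ≤ (r⁻¹).toNNReal := by
    rw [Real.coe_toNNReal _ (by positivity), Real.coe_toNNReal _ (by positivity)]
    apply le_of_eq; field_simp
  have key := lintegral_le_background_add_cells (Ω := Ω) (κ := κ) hω hr hε hUm
    (hVW.trans (hWU.trans hUΩ)) (Ψ := fun x => ‖Du x‖ₑ ^ 2) (Φ := Φ) (C := C) (by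
      intro n hn hne
      have hcl := hC hε hδ h hu hbv hn hζL hζ0 hζ1 hL
        (fun x hx => hWU (hζW (Metric.self_subset_thickening (by positivity) _ hx)))
        (hζW.trans hWU)
      have hOm : MeasurableSet (cellInclusion ω ε n) :=
        (isOpen_cellInclusion hω.lipschitz.isOpen hε n).measurableSet
      set O := cellInclusion ω ε n with hO
      set X := Metric.thickening (r * ε) O with hX
      have hOX : O ⊆ X := Metric.self_subset_thickening (by positivity) _
      calc _ = ∫⁻ x in O ∩ V, ‖ζ x • Du x‖ₑ ^ 2 :=
            setLIntegral_congr_fun (hOm.inter hV) fun x hx => by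
              simp only [hζS x (hVT n hn hx), one_smul]
        _ ≤ ∫⁻ x in O ∩ U, ‖ζ x • Du x‖ₑ ^ 2 :=
            lintegral_mono_set (inter_subset_inter_right _ (hVW.trans hWU))
        _ ≤ _ := hcl
        _ ≤ C * ((∫⁻ x in X ∩ U, e * ‖f x‖ₑ ^ 2) + ((∫⁻ x in X ∩ U, i * ‖u x‖ₑ ^ 2) +
              ∫⁻ x in X ∩ U, (W ∩ b).indicator (fun x => ‖Du x‖ₑ ^ 2) x)) := by
            rw [add_assoc]
            refine mul_le_mul' le_rfl (add_le_add ?_ (add_le_add ?_ ?_))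
            · rw [lintegral_const_mul' _ _ (by finiteness)]
              exact mul_le_mul' le_rfl (lintegral_mono_set (inter_subset_inter_left _ hOX))
            · rw [lintegral_const_mul' _ _ (by finiteness)]
            · rw [setLIntegral_indicator hbm]
              refine lintegral_mono_set fun x hx => ?_
              have hxW := hζW hx.2
              exact ⟨⟨hxW, collar_inter_subset_background hr hr0 hε n ⟨hx.1, hUΩ (hWU hxW)⟩⟩,
                hx.1.1, hWU hxW⟩
        _ = C * ∫⁻ x in X ∩ U, Φ x := by
            rw [lintegral_add_left'
                (hfc.mono_measure (Measure.restrict_mono inter_subset_right le_rfl)),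
              lintegral_add_left'
                (huc.mono_measure (Measure.restrict_mono inter_subset_right le_rfl))])
  refine key.trans ?_
  have hΦi : ∫⁻ x in U, Φ x ≤ e * (∫⁻ x in U, ‖f x‖ₑ ^ 2) + (i * (∫⁻ x in U, ‖u x‖ₑ ^ 2) +
      ∫⁻ x in W ∩ b, ‖Du x‖ₑ ^ 2) := by
    rw [lintegral_add_left' hfc, lintegral_const_mul'' _ hfm, lintegral_add_left' huc,
      lintegral_const_mul'' _ hum, setLIntegral_indicator hbm]
    exact add_le_add le_rfl (add_le_add le_rfl (lintegral_mono_set inter_subset_left))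
  set F := e * ∫⁻ x in U, ‖f x‖ₑ ^ 2
  set B := i * ∫⁻ x in U, ‖u x‖ₑ ^ 2
  set Y := ∫⁻ x in W ∩ b, ‖Du x‖ₑ ^ 2
  calc _ ≤ Y + C * (F + (B + Y)) :=
        add_le_add (lintegral_mono_set (inter_subset_inter_left _ hVW)) (mul_le_mul' le_rfl hΦi)
    _ ≤ (Y + F + B) + C * (F + (B + Y)) :=
        add_le_add (by rw [add_assoc]; exact le_self_add) le_rfl
    _ = _ := by push_cast; ring

/-- Caccioppoli's inequality in the background. -/
lemma WeakSol.background_le {d m : ℕ} {μ : ℝ} (hμ : 0 < μ) {Ω ω : Set (Eu d)} {κ ε δ : ℝ}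
    (hΩ : IsOpen Ω) {a : Eu d → Tensor d m} {U S W : Set (Eu d)} {u : Eu d → Eu m}
    {Du : Eu d → GradSp d m} {f g : Eu d → Eu m}
    (h : WeakSol μ (contrast Ω ω κ ε δ) a U Du f)
    (hu : AEStronglyMeasurable u (volume.restrict U)) (hbv : HasBoundaryValue U S u Du g)
    (hW : MeasurableSet W) (hWU : W ⊆ U) {ρ : ℝ} (hρ : 0 < ρ) {G : Eu d → Eu m} {K : ℝ≥0}
    (hG : LipschitzWith K G)
    (hGS : ∀ x ∈ frontier U, x ∈ Metric.thickening ρ W → x ∈ S ∧ G x = g x) :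
    ∫⁻ x in W ∩ background Ω ω κ ε, ‖Du x‖ₑ ^ 2 ≤ (4 * (d + 1) * energyConst μ : ℝ≥0) *
      (ENNReal.ofReal (ρ ^ 2) * (∫⁻ x in U, ‖f x‖ₑ ^ 2) + ENNReal.ofReal (ρ ^ 2)⁻¹ *
        ((∫⁻ x in U, ‖u x‖ₑ ^ 2) + ∫⁻ x in U, ‖G x‖ₑ ^ 2) + ∫⁻ x in U, ‖gradArr G x‖ₑ ^ 2) := by
  obtain ⟨η, hηL, hη0, hη1, hηW, hηT⟩ := exists_cutoff W hρ
  have hηa : ∀ x, |η x| ≤ 1 := fun x => by rw [abs_of_nonneg (hη0 x)]; exact hη1 x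
  have hB : Bornology.IsBounded (Metric.thickening ρ W) := (h.bounded.subset hWU).thickening
  have key := h.caccioppoli hμ hu hbv hηL hηa hB
    (fun x hx => by by_contra h0; exact hx (hηT x h0)) hG
    (fun x hx hx' => hGS x hx (hηT x hx')) hρ.ne'
  have hL : ((d * (ρ⁻¹).toNNReal ^ 2 : ℝ≥0) : ℝ≥0∞) = d * ENNReal.ofReal (ρ ^ 2)⁻¹ := by
    rw [← inv_pow, ENNReal.ofReal_pow (by positivity)]
    push_cast
    rfl
  rw [hL] at key
  set i := ENNReal.ofReal (ρ ^ 2)⁻¹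
  set F := ENNReal.ofReal (ρ ^ 2) * ∫⁻ x in U, ‖f x‖ₑ ^ 2
  set B := ∫⁻ x in U, ‖u x‖ₑ ^ 2
  set B' := ∫⁻ x in U, ‖G x‖ₑ ^ 2
  set Y := ∫⁻ x in U, ‖gradArr G x‖ₑ ^ 2
  have hd : (1 : ℝ≥0∞) ≤ 4 * (d + 1) := by
    have : (1 : ℝ≥0∞) ≤ ((4 * (d + 1) : ℕ) : ℝ≥0∞) := by
      exact_mod_cast (by omega : 1 ≤ 4 * (d + 1))
    simpa using this
  calc _ = ∫⁻ x in W ∩ background Ω ω κ ε,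
        ENNReal.ofReal (contrast Ω ω κ ε δ x) * ‖η x • Du x‖ₑ ^ 2 :=
        setLIntegral_congr_fun (hW.inter (measurableSet_background hΩ)) fun x hx => by
          simp only [contrast_of_mem_background hx.2, hηW x hx.1, one_smul, ENNReal.ofReal_one,
            one_mul]
    _ ≤ _ := (lintegral_mono_set (inter_subset_left.trans hWU)).trans key
    _ = energyConst μ * (1 * F + 4 * (d + 1) * (i * (B + B')) + 1 * Y) := by ring
    _ ≤ energyConst μ * (4 * (d + 1) * F + 4 * (d + 1) * (i * (B + B')) + 4 * (d + 1) * Y) := by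
        gcongr
    _ = _ := by push_cast; ring

/-! ### Mean values, cubes and the interior estimate. -/

lemma setIntegral_norm_sq {d : ℕ} {F : Type*} [NormedAddCommGroup F] {S : Set (Eu d)} {w : Eu d → F}
    (hw : AEStronglyMeasurable w (volume.restrict S)) :
    ∫ x in S, ‖w x‖ ^ 2 = (∫⁻ x in S, ‖w x‖ₑ ^ 2).toReal := by
  have hm : AEStronglyMeasurable (fun x => ‖w x‖ ^ 2) (volume.restrict S) := hw.norm.pow 2
  rw [integral_eq_lintegral_of_nonneg_ae (Eventually.of_forall fun x => by positivity) hm]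
  congr 1
  refine lintegral_congr fun x => ?_
  rw [ENNReal.ofReal_pow (norm_nonneg _), ofReal_norm]

/-- Conversion from lower integrals to mean values: `c` bounds the ratio of the volumes, and the
term with `t` accounts for pointwise bounded boundary data. The extra `1` is harmless since the
bracket is nonnegative. -/
lemma average_norm_sq_le {d : ℕ} {E F G : Type*} [NormedAddCommGroup E] [NormedAddCommGroup F]
    [NormedAddCommGroup G] {V U : Set (Eu d)} (hVU : V ⊆ U) (hV0 : volume V ≠ 0)
    (hU : volume U ≠ ∞) {c : ℝ} (hc : (volume U).toReal ≤ c * (volume V).toReal)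
    {D : Eu d → E} {u : Eu d → F} {f : Eu d → G} (hD : MemLp D 2 (volume.restrict U))
    (hu : MemLp u 2 (volume.restrict U)) (hf : MemLp f 2 (volume.restrict U)) {C : ℝ≥0} {p q t : ℝ}
    (hp : 0 ≤ p) (hq : 0 ≤ q) (ht : 0 ≤ t)
    (h : ∫⁻ x in V, ‖D x‖ₑ ^ 2 ≤ C * (ENNReal.ofReal p * (∫⁻ x in U, ‖u x‖ₑ ^ 2) +
      ENNReal.ofReal q * (∫⁻ x in U, ‖f x‖ₑ ^ 2) + ENNReal.ofReal t * volume U)) :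
    ⨍ x in V, ‖D x‖ ^ 2 ≤
      (c * C + 1) * (p * (⨍ x in U, ‖u x‖ ^ 2) + q * (⨍ x in U, ‖f x‖ ^ 2) + t) := by
  have hub : ∫⁻ x in U, ‖u x‖ₑ ^ 2 ≠ ∞ := by
    rw [← eLpNorm_two_sq]; exact (ENNReal.pow_lt_top hu.2).ne
  have hfb : ∫⁻ x in U, ‖f x‖ₑ ^ 2 ≠ ∞ := by
    rw [← eLpNorm_two_sq]; exact (ENNReal.pow_lt_top hf.2).ne
  have h2 := ENNReal.toReal_mono (by finiteness) h
  rw [ENNReal.toReal_mul, ENNReal.toReal_add (by finiteness) (by finiteness),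
    ENNReal.toReal_add (by finiteness) (by finiteness), ENNReal.toReal_mul, ENNReal.toReal_mul,
    ENNReal.toReal_mul, ENNReal.toReal_ofReal hp, ENNReal.toReal_ofReal hq, ENNReal.toReal_ofReal ht,
    ENNReal.coe_toReal, ← setIntegral_norm_sq (hD.1.mono_measure (Measure.restrict_mono hVU le_rfl)),
    ← setIntegral_norm_sq hu.1, ← setIntegral_norm_sq hf.1] at h2
  have ha : 0 < (volume V).toReal :=
    ENNReal.toReal_pos hV0 ((measure_mono hVU).trans_lt hU.lt_top).ne
  have hb : 0 < (volume U).toReal :=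
    ENNReal.toReal_pos (fun h0 => hV0 (measure_mono_null hVU h0)) hU
  rw [setAverage_eq, setAverage_eq, setAverage_eq, smul_eq_mul, smul_eq_mul, smul_eq_mul,
    measureReal_def, measureReal_def]
  set X := ∫ x in V, ‖D x‖ ^ 2
  have hB : 0 ≤ ∫ x in U, ‖u x‖ ^ 2 := integral_nonneg fun x => by positivity
  have hF : 0 ≤ ∫ x in U, ‖f x‖ ^ 2 := integral_nonneg fun x => by positivity
  set B := ∫ x in U, ‖u x‖ ^ 2
  set F := ∫ x in U, ‖f x‖ ^ 2
  set a := (volume V).toReal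
  set b := (volume U).toReal
  have hC : (0 : ℝ) ≤ C := C.2
  have hs : 0 ≤ p * (b⁻¹ * B) + q * (b⁻¹ * F) + t := by positivity
  have hsb : p * B + q * F + t * b = b * (p * (b⁻¹ * B) + q * (b⁻¹ * F) + t) := by
    field_simp
  rw [hsb] at h2
  set s := p * (b⁻¹ * B) + q * (b⁻¹ * F) + t
  have h3 : a⁻¹ * X ≤ c * C * s := by
    rw [inv_mul_le_iff₀ ha]
    calc X ≤ C * (b * s) := h2
      _ ≤ C * ((c * a) * s) := by gcongr
      _ = _ := by ring
  linarith

section Cube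

variable {d : ℕ} (x₀ : Eu d)

lemma cube_eq_preimage {R : ℝ} (hR : 0 < R) :
    cube x₀ R = (WithLp.ofLp : Eu d → Fin d → ℝ) ⁻¹' Metric.ball (WithLp.ofLp x₀) R := by
  ext x
  simp only [cube, mem_ofPred_eq, mem_preimage, Metric.mem_ball, dist_pi_lt_iff hR, Real.dist_eq]

lemma isOpen_cube {R : ℝ} (hR : 0 < R) : IsOpen (cube x₀ R) := by
  rw [cube_eq_preimage x₀ hR]
  exact Metric.isOpen_ball.preimage (PiLp.continuous_ofLp 2 _)

lemma volume_cube {R : ℝ} (hR : 0 < R) : volume (cube x₀ R) = ENNReal.ofReal ((2 * R) ^ d) := by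
  rw [cube_eq_preimage x₀ hR, (PiLp.volume_preserving_ofLp (Fin d)).measure_preimage
    Metric.isOpen_ball.measurableSet.nullMeasurableSet, Real.volume_pi_ball _ hR, Fintype.card_fin]

lemma isBounded_cube (R : ℝ) : Bornology.IsBounded (cube x₀ R) := by
  refine (Metric.isBounded_iff_subset_closedBall x₀).2
    ⟨Real.sqrt (∑ _i : Fin d, R ^ 2), fun x hx => ?_⟩
  rw [Metric.mem_closedBall, EuclideanSpace.dist_eq]
  refine Real.sqrt_le_sqrt (Finset.sum_le_sum fun i _ => ?_)
  rw [Real.dist_eq]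
  exact pow_le_pow_left₀ (abs_nonneg _) (hx i).le 2

lemma cube_mono {R R' : ℝ} (h : R ≤ R') : cube x₀ R ⊆ cube x₀ R' := fun _ hx i => (hx i).trans_le h

lemma thickening_cube_subset (ρ R : ℝ) : Metric.thickening ρ (cube x₀ R) ⊆ cube x₀ (R + ρ) := by
  intro x hx i
  obtain ⟨y, hy, hxy⟩ := Metric.mem_thickening_iff.1 hx
  have h1 := hy i
  have h2 : |x i - y i| ≤ dist x y := by
    rw [dist_eq_norm, ← Real.norm_eq_abs]
    exact PiLp.norm_apply_le (x - y) i
  have h3 := abs_sub_le (x i) (y i) (x₀ i)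
  linarith

end Cube

lemma gradArr_const {d m : ℕ} (v : Eu m) (x : Eu d) : gradArr (fun _ : Eu d => v) x = 0 := by
  rw [gradArr_eq]; simp

/-- The interior Caccioppoli inequality, uniform in the contrast. -/
theorem exists_interior_estimate {d m : ℕ} [NeZero d] {κ μ lam τ : ℝ} (hμ : 0 < μ) (hlam : 0 < lam)
    {ω : Set (Eu d)} (hω : InclusionAssumptions ω) {Ω : Set (Eu d)} (hΩ : IsOpen Ω) :
    ∃ C > 0, ∀ A : Eu d → Tensor d m, CoeffAssumptions μ lam τ A →
      ∀ ε δ : ℝ, 0 < ε → ε < 1 → 0 < δ → δ ≤ 1 →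
      ∀ (x₀ : Eu d) (R : ℝ), 4 * ε ≤ R → cube x₀ (2 * R) ⊆ Ω →
      ∀ (f u : Eu d → Eu m) (Du : Eu d → GradSp d m),
        MemLp f 2 (volume.restrict (cube x₀ (2 * R))) →
        IsH1 (cube x₀ (2 * R)) u Du →
        IsWeakSolution Ω ω κ ε δ A (cube x₀ (2 * R)) Du (modSource Ω ω κ ε δ f) →
        ⨍ x in cube x₀ R, ‖Du x‖ ^ 2 ≤
          C * ((1 / R ^ 2) * (⨍ x in cube x₀ (2 * R), ‖u x‖ ^ 2)
            + R ^ 2 * (⨍ x in cube x₀ (2 * R), ‖f x‖ ^ 2)) := by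
  obtain ⟨r, hr0, hr⟩ := hω.exists_thickening_subset
  obtain ⟨C₁, hC₁⟩ := exists_estimate_of_thickening_subset m hμ hω hr0 hr
  set C₂ : ℝ≥0 := 4 * (d + 1) * energyConst μ with hC₂
  set C₃ : ℝ≥0 := C₁ * (64 * C₂ + 1) with hC₃
  refine ⟨2 ^ d * C₃ + 1, by positivity, fun A hA ε δ hε _ hδ hδ1 x₀ R hR hQ f u Du hf hu hw => ?_⟩
  have hR0 : 0 < R := by linarith
  have hUo := isOpen_cube x₀ (show 0 < 2 * R by linarith)
  have hUb := isBounded_cube x₀ (2 * R)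
  set U := cube x₀ (7 * R / 4) with hU
  set W := cube x₀ (3 * R / 2) with hW
  have hUs : IsOpen U := isOpen_cube x₀ (by linarith)
  have hWo : IsOpen W := isOpen_cube x₀ (by linarith)
  have hVo : IsOpen (cube x₀ R) := isOpen_cube x₀ hR0
  have hU2 : U ⊆ cube x₀ (2 * R) := cube_mono x₀ (by linarith)
  have hWU : W ⊆ U := cube_mono x₀ (by linarith)
  have hVW : cube x₀ R ⊆ W := cube_mono x₀ (by linarith)
  have hsol := hw.weakSol hμ hlam hω hΩ hA hε hδ hδ1 hQ hU2 hUo hUs (hUb.subset hU2) hf hu.memLp_grad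
  have hbv := hu.hasBoundaryValue_empty hUo hUb (show 0 < R / 4 by linarith) hUs.measurableSet
    ((thickening_cube_subset x₀ _ _).trans (cube_mono x₀ (by linarith))) (fun _ => 0)
  have huU : AEStronglyMeasurable u (volume.restrict U) :=
    hu.memLp.1.mono_measure (Measure.restrict_mono hU2 le_rfl)
  -- An inclusion and its neighbourhood lie in one cell of side `ε ≤ R / 4`. A neighbourhood whose
  -- inclusion meets `Q_R` thus stays in `Q_{R + ε}`, inside `Q_{3R/2}`.
  have h1 := hC₁ hε hδ hΩ hsol hbv hVo.measurableSet hWo.measurableSet hVW hWU (hU2.trans hQ)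
    (fun n hn ⟨x, hxn, hxV⟩ y hy i => by
      have e1 := abs_lt.1 (mem_thickening_coord hr hε hy i)
      have e2 := abs_lt.1 (mem_cellInclusion_coord hω.subset_cell hε hxn i)
      have e3 := abs_lt.1 (hxV i)
      rw [abs_lt]
      constructor <;> linarith)
  -- The cutoff is supported within `R / 8` of `Q_{3R/2}` and never reaches the frontier of
  -- `Q_{7R/4}`. The boundary datum is vacuous and `G = 0` will do.
  have h2 := hsol.background_le hμ hΩ huU hbv hWo.measurableSet hWU (show 0 < R / 8 by linarith)
    (LipschitzWith.const (0 : Eu m)) (fun x hx hxT => by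
      have hxU : x ∈ U := cube_mono x₀ (by linarith) (thickening_cube_subset x₀ _ _ hxT)
      rw [hUs.frontier_eq] at hx
      exact absurd hxU hx.2)
  simp only [gradArr_const, enorm_zero, ne_eq, OfNat.ofNat_ne_zero, not_false_eq_true, zero_pow,
    lintegral_zero, add_zero, ← hC₂] at h2
  have hvol : ∀ {r : ℝ}, 0 < r → (volume (cube x₀ r)).toReal = (2 * r) ^ d := fun hr' => by
    rw [volume_cube x₀ hr', ENNReal.toReal_ofReal (by positivity)]
  have := average_norm_sq_le (V := cube x₀ R) (U := cube x₀ (2 * R)) (cube_mono x₀ (by linarith))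
    (by rw [volume_cube x₀ hR0]; simp; positivity) hUb.measure_lt_top.ne (c := 2 ^ d)
    (by rw [hvol hR0, hvol (by linarith), ← mul_pow]) hu.memLp_grad hu.memLp hf (C := C₃)
    (p := 1 / R ^ 2) (q := R ^ 2) (t := 0) (by positivity) (by positivity) le_rfl (by
      rw [ENNReal.ofReal_zero, zero_mul, add_zero]
      have hF : ∫⁻ x in U, ‖f x‖ₑ ^ 2 ≤ ∫⁻ x in cube x₀ (2 * R), ‖f x‖ₑ ^ 2 := lintegral_mono_set hU2
      have hB : ∫⁻ x in U, ‖u x‖ₑ ^ 2 ≤ ∫⁻ x in cube x₀ (2 * R), ‖u x‖ₑ ^ 2 := lintegral_mono_set hU2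
      set F := ∫⁻ x in cube x₀ (2 * R), ‖f x‖ₑ ^ 2
      set B := ∫⁻ x in cube x₀ (2 * R), ‖u x‖ₑ ^ 2
      have e1 : ENNReal.ofReal ((R / 8) ^ 2) ≤ ENNReal.ofReal (R ^ 2) :=
        ENNReal.ofReal_le_ofReal (by nlinarith)
      have e2 : ENNReal.ofReal ((R / 8) ^ 2)⁻¹ = 64 * ENNReal.ofReal (1 / R ^ 2) := by
        rw [show (64 : ℝ≥0∞) = ENNReal.ofReal 64 by simp, ← ENNReal.ofReal_mul (by norm_num)]
        congr 1; field_simp; norm_num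
      have e3 : ENNReal.ofReal ε ^ 2 ≤ ENNReal.ofReal (R ^ 2) := by
        rw [← ENNReal.ofReal_pow hε.le]
        exact ENNReal.ofReal_le_ofReal (by nlinarith)
      set p := ENNReal.ofReal (1 / R ^ 2)
      set q := ENNReal.ofReal (R ^ 2)
      calc _ ≤ C₁ * (C₂ * (q * F + 64 * p * B) + q * F) := by
            refine h1.trans (mul_le_mul' le_rfl (add_le_add (h2.trans (mul_le_mul' le_rfl
              (add_le_add (mul_le_mul' e1 hF) ?_))) (mul_le_mul' e3 hF)))
            rw [e2]
            exact mul_le_mul' le_rfl hB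
        _ = C₁ * ((64 * C₂) * (p * B) + (1 * C₂ + 1) * (q * F)) := by ring
        _ ≤ C₁ * ((64 * C₂ + 1) * (p * B) + (64 * C₂ + 1) * (q * F)) := by
            gcongr
            · exact le_self_add
            · norm_num
        _ = _ := by rw [hC₃]; push_cast; ring)
  simpa using this

/-! ### Extension of the boundary data. -/

/-- Some a priori bound is required because `toReal` sends an infinite norm to `0`. Its value does
not enter the conclusion. -/
lemma ae_norm_le_eLpNorm_top {α F : Type*} [MeasurableSpace α] [NormedAddCommGroup F]
    {ν : Measure α} {f : α → F} {B : ℝ} (h : ∀ᵐ x ∂ν, ‖f x‖ ≤ B) :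
    ∀ᵐ x ∂ν, ‖f x‖ ≤ (eLpNorm f ∞ ν).toReal := by
  rw [eLpNorm_exponent_top]
  have hfin : eLpNormEssSup f ν ≠ ∞ :=
    ((eLpNormEssSup_le_of_ae_bound h).trans_lt ENNReal.ofReal_lt_top).ne
  filter_upwards [ae_le_eLpNormEssSup (f := f) (μ := ν)] with x hx
  rw [← toReal_enorm]
  exact ENNReal.toReal_mono hfin hx

section TangentialPart

variable {E : Type*} [NormedAddCommGroup E] [InnerProductSpace ℝ E] (p k : E)

/-- The metric of the graph in the coordinates `x'` is `1 + p pᵀ`, with inverse `1 - p pᵀ / (1 +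
‖p‖²)`. The left side is the squared length of the tangential gradient and the right side is the
quadratic form of this inverse at `k`; its eigenvalues lie between `1 / (1 + ‖p‖²)` and `1`. -/
lemma norm_sq_tangential_part :
    ‖k - (⟪p, k⟫_ℝ / (1 + ‖p‖ ^ 2)) • p‖ ^ 2 + ⟪p, k - (⟪p, k⟫_ℝ / (1 + ‖p‖ ^ 2)) • p⟫_ℝ ^ 2 =
      ‖k‖ ^ 2 - ⟪p, k⟫_ℝ ^ 2 / (1 + ‖p‖ ^ 2) := by
  have h : (1 + ‖p‖ ^ 2 : ℝ) ≠ 0 := by positivity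
  rw [norm_sub_sq_real, norm_smul, mul_pow, Real.norm_eq_abs, sq_abs, inner_sub_right,
    inner_smul_right, inner_smul_right, real_inner_self_eq_norm_sq, real_inner_comm p k]
  field_simp
  ring

lemma norm_sq_tangential_part_le :
    ‖k - (⟪p, k⟫_ℝ / (1 + ‖p‖ ^ 2)) • p‖ ^ 2 + ⟪p, k - (⟪p, k⟫_ℝ / (1 + ‖p‖ ^ 2)) • p⟫_ℝ ^ 2 ≤
      ‖k‖ ^ 2 := by
  rw [norm_sq_tangential_part]
  linarith [show (0 : ℝ) ≤ ⟪p, k⟫_ℝ ^ 2 / (1 + ‖p‖ ^ 2) by positivity]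

lemma norm_sq_le_tangential_part :
    ‖k‖ ^ 2 ≤ (1 + ‖p‖ ^ 2) * (‖k - (⟪p, k⟫_ℝ / (1 + ‖p‖ ^ 2)) • p‖ ^ 2 +
      ⟪p, k - (⟪p, k⟫_ℝ / (1 + ‖p‖ ^ 2)) • p⟫_ℝ ^ 2) := by
  have h : (0 : ℝ) < 1 + ‖p‖ ^ 2 := by positivity
  rw [norm_sq_tangential_part, mul_sub, mul_div_cancel₀ _ h.ne']
  have h1 := abs_real_inner_le_norm p k
  have h2 : ⟪p, k⟫_ℝ ^ 2 ≤ (‖p‖ * ‖k‖) ^ 2 := by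
    rw [← sq_abs]; exact pow_le_pow_left₀ (abs_nonneg _) h1 2
  nlinarith

end TangentialPart

lemma norm_gradient_le_of_lipschitz {E : Type*} [NormedAddCommGroup E] [InnerProductSpace ℝ E]
    [CompleteSpace E] {f : E → ℝ} {K : ℝ≥0} (h : LipschitzWith K f) (x : E) :
    ‖gradient f x‖ ≤ K := by
  rw [gradient, LinearIsometryEquiv.norm_map]
  exact norm_fderiv_le_of_lipschitz ℝ h

/-- The operator norm is at most the Hilbert–Schmidt norm, row by row. -/
lemma norm_fderiv_sq_le_sum_gradient {E : Type*} [NormedAddCommGroup E] [InnerProductSpace ℝ E]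
    [CompleteSpace E] {m : ℕ} {f : E → Eu m} {x : E} (hf : DifferentiableAt ℝ f x) :
    ‖fderiv ℝ f x‖ ^ 2 ≤ ∑ α, ‖gradient (fun y => f y α) x‖ ^ 2 := by
  have h0 : 0 ≤ ∑ α, ‖gradient (fun y => f y α) x‖ ^ 2 := Finset.sum_nonneg fun _ _ => by positivity
  refine (Real.le_sqrt (norm_nonneg _) h0).1 ?_
  refine ContinuousLinearMap.opNorm_le_bound _ (Real.sqrt_nonneg _) fun v => ?_
  rw [EuclideanSpace.norm_eq, ← Real.sqrt_sq (norm_nonneg v), ← Real.sqrt_mul h0, Finset.sum_mul]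
  refine Real.sqrt_le_sqrt (Finset.sum_le_sum fun α _ => ?_)
  have hc : HasFDerivAt (fun y => f y α) ((EuclideanSpace.proj α).comp (fderiv ℝ f x)) x :=
    (EuclideanSpace.proj (𝕜 := ℝ) α).hasFDerivAt.comp x hf.hasFDerivAt
  have : fderiv ℝ f x v α = ⟪gradient (fun y => f y α) x, v⟫_ℝ := by
    rw [gradient, InnerProductSpace.toDual_symm_apply, hc.fderiv]; rfl
  rw [this, ← mul_pow, Real.norm_eq_abs]
  exact pow_le_pow_left₀ (abs_nonneg _) (abs_real_inner_le_norm _ _) 2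

namespace GraphChart

variable {d : ℕ} (c : GraphChart d)

lemma lipschitz_graphPt {K : ℝ≥0} (h : LipschitzWith K c.ψ) : LipschitzWith (1 + K) c.graphPt := by
  refine LipschitzWith.of_dist_le_mul fun x y => ?_
  refine (c.dist_pt_le _ _ _ _).trans ?_
  push_cast
  linarith [h.dist_le_mul x y]

lemma differentiable_proj : Differentiable ℝ c.proj := by
  have h : c.proj = fun x => (WithLp.prodContinuousLinearEquiv 2 ℝ (Eu (d - 1)) ℝ
      (c.Φ.symm.linearIsometryEquiv x + c.Φ.symm 0)).1 := by
    ext x : 1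
    have := c.Φ.symm.map_vadd 0 x
    rw [proj]
    simp only [vadd_eq_add, add_zero] at this
    rw [this]; rfl
  rw [h]
  fun_prop

lemma quasiMeasurePreserving_proj [NeZero d] (hψ : Measurable c.ψ) :
    Measure.QuasiMeasurePreserving c.proj volume volume := by
  have h := (Measure.quasiMeasurePreserving_fst (μ := (volume : Measure (Eu (d - 1))))
    (ν := (volume : Measure ℝ))).comp (c.measurePreserving_flat hψ).quasiMeasurePreserving
  exact h

lemma norm_sq_tanGrad {m : ℕ} (g : Eu d → Eu m) (x' : Eu (d - 1)) :
    ‖c.tanGrad g x'‖ ^ 2 ≤ ∑ α, ‖gradient (fun y => g (c.graphPt y) α) x'‖ ^ 2 := by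
  rw [PiLp.norm_sq_eq_of_L2]
  refine Finset.sum_le_sum fun α _ => ?_
  rw [WithLp.prod_norm_sq_eq_of_L2, Real.norm_eq_abs, sq_abs]
  exact norm_sq_tangential_part_le _ _

lemma sum_norm_sq_gradient_le {m : ℕ} (g : Eu d → Eu m) {K : ℝ≥0} (h : LipschitzWith K c.ψ)
    (x' : Eu (d - 1)) :
    ∑ α, ‖gradient (fun y => g (c.graphPt y) α) x'‖ ^ 2 ≤ (1 + K ^ 2) * ‖c.tanGrad g x'‖ ^ 2 := by
  rw [PiLp.norm_sq_eq_of_L2, Finset.mul_sum]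
  refine Finset.sum_le_sum fun α _ => ?_
  rw [WithLp.prod_norm_sq_eq_of_L2, Real.norm_eq_abs, sq_abs]
  refine (norm_sq_le_tangential_part (gradient c.ψ x') _).trans
    (mul_le_mul_of_nonneg_right ?_ (by positivity))
  have := norm_gradient_le_of_lipschitz h x'
  gcongr

/-- Lipschitz boundary data on the base of a cylinder extend, constantly in the vertical direction,
with bounds by the norms of the data. -/
lemma exists_boundary_extension [NeZero d] {m : ℕ} {K : ℝ≥0} (hψ : LipschitzWith K c.ψ)
    {g : Eu d → Eu m} {r : ℝ} (hg : ∃ L, LipschitzOnWith L g (c.base r)) :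
    ∃ G : Eu d → Eu m, (∃ L, LipschitzWith L G) ∧ (∀ x ∈ c.base r, G x = g x) ∧
      ∀ᵐ x, ‖c.proj x‖ < r → ‖G x‖ ≤ c.supNorm g r ∧
        ‖gradArr G x‖ ^ 2 ≤ (d * (1 + K ^ 2)) * c.tanGradSupNorm g r ^ 2 := by
  obtain ⟨L, hL⟩ := hg
  have hb : LipschitzOnWith (L * (1 + K)) (fun x' => g (c.graphPt x')) (Metric.ball 0 r) :=
    hL.comp (c.lipschitz_graphPt hψ).lipschitzOnWith fun x' hx' => ⟨x', hx', rfl⟩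
  -- The Lipschitz constant of this extension is not controlled by the norms of `g`. It only
  -- guarantees that those norms are finite; the final bounds come from `g` itself on the ball.
  obtain ⟨H, hH, hHe'⟩ := hb.extend_finite_dimension
  have hHe : ∀ {x'}, x' ∈ Metric.ball (0 : Eu (d - 1)) r → g (c.graphPt x') = H x' :=
    fun hx' => hHe' hx'
  set L' := lipschitzExtensionConstant (Eu m) * (L * (1 + K)) with hL'
  have hGp : ∀ x' ∈ Metric.ball (0 : Eu (d - 1)) r, ‖g (c.graphPt x')‖ ≤ ‖H 0‖ + L' * r := by
    intro x' hx'
    rw [hHe hx']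
    have h1 := hH.dist_le_mul x' 0
    have h2 : (L' : ℝ) * dist x' 0 ≤ L' * r := by
      gcongr; exact (Metric.mem_ball.1 hx').le
    have h3 := norm_le_norm_add_norm_sub' (H x') (H 0)
    rw [← dist_eq_norm] at h3
    linarith
  have hgrad : ∀ x' ∈ Metric.ball (0 : Eu (d - 1)) r, ∀ α,
      gradient (fun y => g (c.graphPt y) α) x' = gradient (fun y => H y α) x' := by
    intro x' hx' α
    refine Filter.EventuallyEq.gradient_eq ?_
    filter_upwards [Metric.isOpen_ball.mem_nhds hx'] with y hy
    rw [hHe hy]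
  have hHα : ∀ α, LipschitzWith L' fun y => H y α := fun α => by
    refine LipschitzWith.of_dist_le_mul fun x y => le_trans ?_ (hH.dist_le_mul x y)
    rw [dist_eq_norm, dist_eq_norm]
    exact PiLp.norm_apply_le (H x - H y) α
  have htan : ∀ x' ∈ Metric.ball (0 : Eu (d - 1)) r, ‖c.tanGrad g x'‖ ≤ Real.sqrt (m * L' ^ 2) := by
    intro x' hx'
    refine Real.le_sqrt_of_sq_le ((c.norm_sq_tanGrad g x').trans ?_)
    calc _ ≤ ∑ _α : Fin m, (L' : ℝ) ^ 2 := Finset.sum_le_sum fun α _ => by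
          rw [hgrad x' hx' α]
          exact pow_le_pow_left₀ (norm_nonneg _) (norm_gradient_le_of_lipschitz (hHα α) x') 2
      _ = _ := by simp
  have a1 := ae_norm_le_eLpNorm_top (ν := volume.restrict (Metric.ball (0 : Eu (d - 1)) r))
    ((ae_restrict_iff' measurableSet_ball).2 (Eventually.of_forall hGp))
  have a2 := ae_norm_le_eLpNorm_top (ν := volume.restrict (Metric.ball (0 : Eu (d - 1)) r))
    ((ae_restrict_iff' measurableSet_ball).2 (Eventually.of_forall htan))
  rw [ae_restrict_iff' measurableSet_ball] at a1 a2
  refine ⟨fun x => H (c.proj x), ⟨_, hH.comp c.lipschitz_proj⟩, ?_, ?_⟩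
  · rintro _ ⟨x', hx', rfl⟩
    simp only [graphPt, proj_pt]
    exact (hHe hx').symm
  · have hq := c.quasiMeasurePreserving_proj hψ.continuous.measurable
    filter_upwards [hq.ae a1, hq.ae a2, hq.ae hH.ae_differentiableAt] with x h1 h2 h3 hx
    have hxb : c.proj x ∈ Metric.ball (0 : Eu (d - 1)) r := by simpa using hx
    refine ⟨by simpa [supNorm, hHe hxb] using h1 hxb, ?_⟩
    have hd : HasFDerivAt (fun x => H (c.proj x))
        ((fderiv ℝ H (c.proj x)).comp (fderiv ℝ c.proj x)) x :=
      h3.hasFDerivAt.comp x (c.differentiable_proj x).hasFDerivAt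
    have h4 : ‖(fderiv ℝ H (c.proj x)).comp (fderiv ℝ c.proj x)‖ ≤ ‖fderiv ℝ H (c.proj x)‖ := by
      refine (ContinuousLinearMap.opNorm_comp_le _ _).trans (mul_le_of_le_one_right (norm_nonneg _) ?_)
      simpa using norm_fderiv_le_of_lipschitz ℝ c.lipschitz_proj (x₀ := x)
    have h5 : ‖fderiv ℝ H (c.proj x)‖ ^ 2 ≤ (1 + K ^ 2) * c.tanGradSupNorm g r ^ 2 := by
      refine (norm_fderiv_sq_le_sum_gradient h3).trans ?_
      simp only [← hgrad _ hxb]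
      refine (c.sum_norm_sq_gradient_le g hψ _).trans ?_
      gcongr
      exact h2 hxb
    rw [gradArr_eq, hd.fderiv]
    calc _ ≤ (Real.sqrt d * ‖fderiv ℝ H (c.proj x)‖) ^ 2 :=
          pow_le_pow_left₀ (norm_nonneg _) ((norm_arrL_le _).trans (by gcongr)) 2
      _ = d * ‖fderiv ℝ H (c.proj x)‖ ^ 2 := by rw [mul_pow, Real.sq_sqrt (Nat.cast_nonneg d)]
      _ ≤ _ := by rw [mul_assoc]; gcongr

end GraphChart

/-! ### Boundary cylinders and the inclusions near them. -/

namespace GraphChart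

variable {d : ℕ} (c : GraphChart d)

lemma norm_proj_lt {x y : Eu d} {s ρ : ℝ} (hy : ‖c.proj y‖ < s) (h : dist x y ≤ ρ) :
    ‖c.proj x‖ < s + ρ := by
  have h1 := c.dist_proj_le x y
  have h2 := norm_le_norm_add_norm_sub' (c.proj x) (c.proj y)
  rw [← dist_eq_norm] at h2
  linarith

lemma abs_ht_sub_le {K : ℝ≥0} (hψ : LipschitzWith K c.ψ) {x y : Eu d} {ρ : ℝ} (h : dist x y ≤ ρ) :
    |c.ht x - c.ht y| ≤ (1 + K) * ρ := by
  have h1 := (c.lipschitz_ht hψ).dist_le_mul x y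
  rw [Real.dist_eq] at h1
  push_cast at h1
  exact h1.trans (by gcongr)

/-- A limit of points of the cylinder has `ht ≥ 0`. With the side and the top excluded, `ht > 0`
would put it inside the open cylinder. -/
lemma mem_base_of_mem_frontier_cyl {K : ℝ≥0} (hψ : LipschitzWith K c.ψ) {M r : ℝ} {x : Eu d}
    (hx : x ∈ frontier (c.cyl M r)) (h1 : ‖c.proj x‖ < r) (h2 : c.ht x < M * r) : x ∈ c.base r := by
  rw [(c.isOpen_cyl hψ M r).frontier_eq] at hx
  have h0 : 0 ≤ c.ht x := closure_minimal (t := {y | 0 ≤ c.ht y})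
    (fun y hy => (c.mem_cyl.1 hy).2.1.le)
    (isClosed_le continuous_const (c.lipschitz_ht hψ).continuous) hx.1
  refine c.mem_base.2 ⟨h1, h0.antisymm' (not_lt.1 fun hpos => hx.2 (c.mem_cyl.2 ⟨h1, hpos, h2⟩))⟩

/-- The foot of `x` on the graph, at vertical distance `|ht x|`, is a point of the frontier of `Ω`,
so the inclusion is more than `κ ε` away from it. -/
lemma lt_abs_ht_of_mem_cellInclusion {Ω ω : Set (Eu d)} {κ ε r : ℝ} (hb : c.base r ⊆ frontier Ω)
    {n : Fin d → ℤ} (hn : n ∈ inclusionIndices Ω ω κ ε) {x : Eu d} (hx : x ∈ cellInclusion ω ε n)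
    (hr : ‖c.proj x‖ < r) : κ * ε < |c.ht x| := by
  have h1 := lt_dist_of_mem_cellInclusion hn hx (hb ⟨c.proj x, by simpa using hr, rfl⟩)
  have h2 := c.dist_pt (c.proj x) (c.proj x) (c.ψ (c.proj x) + c.ht x) (c.ψ (c.proj x))
  rw [pt_proj, dist_self, Real.dist_eq, add_sub_cancel_left, zero_pow two_ne_zero, zero_add,
    sq_eq_sq₀ dist_nonneg (abs_nonneg _)] at h2
  rwa [graphPt, h2] at h1

/-- A connected set at positive distance from the graph, in the vertical direction, lies on one side. -/
lemma lt_ht_of_isPreconnected {K : ℝ≥0} (hψ : LipschitzWith K c.ψ) {s : Set (Eu d)}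
    (hs : IsPreconnected s) {a : ℝ} (ha : 0 ≤ a) (h : ∀ x ∈ s, a < |c.ht x|) {x₀ : Eu d} (hx₀ : x₀ ∈ s)
    (h0 : 0 < c.ht x₀) {x : Eu d} (hx : x ∈ s) : a < c.ht x := by
  rcases le_or_gt 0 (c.ht x) with hp | hneg
  · simpa [abs_of_nonneg hp] using h x hx
  · obtain ⟨y, hy, hy0⟩ := hs.intermediate_value hx hx₀ (c.lipschitz_ht hψ).continuous.continuousOn
      ⟨hneg.le, h0.le⟩
    have := h y hy
    rw [hy0, abs_zero] at this
    linarith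

lemma cyl_mono {M r r' : ℝ} (hM : 0 ≤ M) (h : r ≤ r') : c.cyl M r ⊆ c.cyl M r' := fun x hx => by
  obtain ⟨h1, h2, h3⟩ := c.mem_cyl.1 hx
  exact c.mem_cyl.2 ⟨h1.trans_le h, h2, h3.trans_le (by gcongr)⟩

lemma toReal_volume_cyl [NeZero d] (hψ : Measurable c.ψ) {M r : ℝ} (hM : 0 ≤ M) (hr : 0 < r) :
    (volume (c.cyl M r)).toReal =
      r ^ (d - 1) * (volume (Metric.ball (0 : Eu (d - 1)) 1)).toReal * (M * r) := by
  rw [c.volume_cyl hψ, Measure.addHaar_ball_of_pos _ _ hr, ENNReal.toReal_mul, ENNReal.toReal_mul,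
    finrank_euclideanSpace_fin, ENNReal.toReal_ofReal (by positivity),
    ENNReal.toReal_ofReal (by positivity)]

end GraphChart

lemma dist_le_of_mem_cellInclusion {d : ℕ} {ω : Set (Eu d)} (hω : ω ⊆ unitCell d) {ε : ℝ}
    (hε : 0 < ε) {n : Fin d → ℤ} {x y : Eu d} (hx : x ∈ cellInclusion ω ε n)
    (hy : y ∈ cellInclusion ω ε n) : dist x y ≤ Real.sqrt d * ε := by
  rw [EuclideanSpace.dist_eq, ← Real.sqrt_sq hε.le, ← Real.sqrt_mul (Nat.cast_nonneg d)]
  refine Real.sqrt_le_sqrt ?_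
  calc _ ≤ ∑ _i : Fin d, ε ^ 2 := Finset.sum_le_sum fun i _ => by
        have h1 := abs_lt.1 (mem_cellInclusion_coord hω hε hx i)
        have h2 := abs_lt.1 (mem_cellInclusion_coord hω hε hy i)
        rw [Real.dist_eq]
        refine pow_le_pow_left₀ (abs_nonneg _) (abs_le.2 ⟨?_, ?_⟩) 2 <;> linarith
    _ = _ := by simp

lemma isPreconnected_cellInclusion {d : ℕ} {ω : Set (Eu d)} (hω : IsPreconnected ω) (ε : ℝ)
    (n : Fin d → ℤ) : IsPreconnected (cellInclusion ω ε n) :=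
  hω.image _ (by fun_prop)

lemma setLIntegral_norm_sq_le_of_ae {d : ℕ} {F : Type*} [NormedAddCommGroup F] {U : Set (Eu d)}
    (hU : MeasurableSet U) {w : Eu d → F} {b : ℝ} (h : ∀ᵐ x, x ∈ U → ‖w x‖ ^ 2 ≤ b) :
    ∫⁻ x in U, ‖w x‖ₑ ^ 2 ≤ ENNReal.ofReal b * volume U := by
  rw [← setLIntegral_const]
  refine setLIntegral_mono_ae' hU (h.mono fun x hx hxU => ?_)
  rw [← ofReal_norm, ← ENNReal.ofReal_pow (norm_nonneg _)]
  exact ENNReal.ofReal_le_ofReal (hx hxU)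

/-! ### The boundary estimate. -/

/-- The gradient in the smaller cylinder is controlled by the gradient in the background part of the
larger one. If the inclusions are small in comparison with the cylinder, those that meet the smaller
one lie in the larger one; otherwise the `L²` norm of the solution is used. -/
lemma exists_boundary_cell_estimate {d : ℕ} [NeZero d] (m : ℕ) {κ μ : ℝ} (hκ : 0 < κ) (hμ : 0 < μ)
    {ω : Set (Eu d)} (hω : InclusionAssumptions ω) (K : ℝ≥0) {M : ℝ} (hM : 0 < M) :
    ∃ C : ℝ≥0, ∀ {Ω : Set (Eu d)} {ε δ : ℝ}, 0 < ε → 0 < δ → IsOpen Ω →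
      ∀ {c : GraphChart d} {R : ℝ}, 4 * ε ≤ R → LipschitzWith K c.ψ →
        c.IsBoundaryCyl Ω M (2 * R) →
      ∀ {a : Eu d → Tensor d m} {S : Set (Eu d)} {u : Eu d → Eu m} {Du : Eu d → GradSp d m}
        {f g : Eu d → Eu m},
        WeakSol μ (contrast Ω ω κ ε δ) a (c.cyl M (2 * R)) Du f →
        AEStronglyMeasurable u (volume.restrict (c.cyl M (2 * R))) →
        HasBoundaryValue (c.cyl M (2 * R)) S u Du g →
        ∫⁻ x in c.cyl M (3 * R / 2), ‖Du x‖ₑ ^ 2 ≤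
          C * ((∫⁻ x in c.cyl M (7 * R / 4) ∩ background Ω ω κ ε, ‖Du x‖ₑ ^ 2) +
            ENNReal.ofReal (R ^ 2) * (∫⁻ x in c.cyl M (2 * R), ‖f x‖ₑ ^ 2) +
            ENNReal.ofReal (1 / R ^ 2) * ∫⁻ x in c.cyl M (2 * R), ‖u x‖ₑ ^ 2) := by
  obtain ⟨r₀, hr₀, hr₀ω⟩ := hω.exists_thickening_subset
  set L : ℝ := 1 + K with hL
  have hL1 : 1 ≤ L := by rw [hL]; simp
  have hL0 : 0 < L := by linarith
  set k : ℝ := min 1 M with hk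
  have hk0 : 0 < k := by positivity
  have hk1 : k ≤ 1 := min_le_left _ _
  have hkM : k ≤ M := min_le_right _ _
  -- Heights have Lipschitz constant `L`, so even a displacement by `2 r ε` changes them by at most
  -- `κ ε`, which keeps points above the graph, and by at most `k ε ≤ M R / 4`, which keeps them
  -- below the top.
  set r : ℝ := min r₀ (min k κ / (2 * L)) with hr
  have hr0 : 0 < r := by positivity
  have hrL : r * (2 * L) ≤ min k κ := (le_div_iff₀ (by positivity)).1 (min_le_right _ _)
  have hrk : L * (2 * r) ≤ k := by linarith [min_le_left k κ]
  have hrκ : L * (2 * r) ≤ κ := by linarith [min_le_right k κ]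
  have hr1 : 2 * r ≤ 1 := by nlinarith
  have hrω : Metric.thickening r ω ⊆ unitCell d :=
    (Metric.thickening_mono (min_le_left _ _) _).trans hr₀ω
  obtain ⟨C₁, hC₁⟩ := exists_estimate_of_thickening_subset m hμ hω hr0 hrω
  obtain ⟨C₂, hC₂⟩ := exists_estimate_of_cutoff m hμ hω hr0 hrω
  -- For `R ≥ N ε`, an inclusion of diameter at most `√d ε` and its collar of width at most `ε`
  -- change heights by at most `M R / 4`, the gap between the cylinders of sizes `3R/2` and `7R/4`.
  set N : ℝ := 4 * L * (Real.sqrt d + 1) / k with hN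
  refine ⟨C₁ + C₂ * (1 + (N ^ 2).toNNReal), fun {Ω ε δ} hε hδ hΩ {c R} hR hψ hcyl {a S u Du f g}
    h hu hbv => ?_⟩
  have hR0 : 0 < R := by linarith
  have hkR : k * R ≤ M * R := by gcongr
  have hMR : 0 < M * R := by positivity
  have hV : MeasurableSet (c.cyl M (3 * R / 2)) := (c.isOpen_cyl hψ _ _).measurableSet
  have hW : MeasurableSet (c.cyl M (7 * R / 4)) := (c.isOpen_cyl hψ _ _).measurableSet
  have hVW : c.cyl M (3 * R / 2) ⊆ c.cyl M (7 * R / 4) := c.cyl_mono hM.le (by linarith)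
  have hWU : c.cyl M (7 * R / 4) ⊆ c.cyl M (2 * R) := c.cyl_mono hM.le (by linarith)
  have he : ENNReal.ofReal ε ^ 2 ≤ ENNReal.ofReal (R ^ 2) := by
    rw [← ENNReal.ofReal_pow hε.le]
    exact ENNReal.ofReal_le_ofReal (by nlinarith)
  set Y := ∫⁻ x in c.cyl M (7 * R / 4) ∩ background Ω ω κ ε, ‖Du x‖ₑ ^ 2
  set F := ∫⁻ x in c.cyl M (2 * R), ‖f x‖ₑ ^ 2
  set B := ∫⁻ x in c.cyl M (2 * R), ‖u x‖ₑ ^ 2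
  set p := ENNReal.ofReal (1 / R ^ 2) with hp
  set q := ENNReal.ofReal (R ^ 2)
  have hκε : 0 < κ * ε := by positivity
  rcases le_or_gt (N * ε) R with hlarge | hsmall
  · have key := hC₁ hε hδ hΩ h hbv hV hW hVW hWU hcyl.1 (fun n hn ⟨x, hxn, hxV⟩ y hy => by
      obtain ⟨y', hy', hyy⟩ := Metric.mem_thickening_iff.1 hy
      obtain ⟨x1, x2, x3⟩ := c.mem_cyl.1 hxV
      have hsε : L * (Real.sqrt d * ε + ε) * 4 ≤ k * R := by
        have : k * (N * ε) ≤ k * R := by gcongr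
        rw [hN] at this
        calc _ = k * (4 * L * (Real.sqrt d + 1) / k * ε) := by field_simp
          _ ≤ _ := this
      have hsd : 0 ≤ Real.sqrt d * ε := by positivity
      have hsR : (Real.sqrt d * ε + ε) * 4 ≤ R := by nlinarith
      have hrε : r * ε ≤ ε := by nlinarith
      have hdist : ∀ {z}, z ∈ cellInclusion ω ε n → dist z x ≤ Real.sqrt d * ε := fun hz =>
        dist_le_of_mem_cellInclusion hω.subset_cell hε hz hxn
      have hz : ∀ z ∈ cellInclusion ω ε n, κ * ε < |c.ht z| := fun z hz =>
        c.lt_abs_ht_of_mem_cellInclusion hcyl.2 hn hz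
          ((c.norm_proj_lt x1 (hdist hz)).trans_le (by linarith))
      -- The inclusion never comes within vertical distance `κ ε` of the graph and is connected, so
      -- it lies entirely on the side of the point `x` inside the cylinder.
      have h1 := c.lt_ht_of_isPreconnected hψ
        (isPreconnected_cellInclusion hω.lipschitz.isConnected.isPreconnected ε n) hκε.le hz hxn x2 hy'
      have h2 := c.norm_proj_lt (c.norm_proj_lt x1 (hdist hy')) hyy.le
      have h3 := abs_le.1 (c.abs_ht_sub_le hψ (hdist hy'))
      have h4 := abs_le.1 (c.abs_ht_sub_le hψ hyy.le)
      rw [← hL] at h3 h4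
      have h5 : L * (r * ε) < κ * ε := by nlinarith
      have h6 : L * (r * ε) ≤ L * ε := by gcongr
      exact c.mem_cyl.2 ⟨by linarith, by linarith, by linarith⟩)
    calc _ ≤ C₁ * (Y + q * F) :=
          key.trans (mul_le_mul' le_rfl (add_le_add le_rfl (mul_le_mul' he le_rfl)))
      _ ≤ C₁ * (Y + q * F) + (C₁ * (p * B) + (C₂ * (1 + (N ^ 2).toNNReal) : ℝ≥0) *
            (Y + q * F + p * B)) := le_self_add
      _ = _ := by push_cast; ring
  -- The set `T` keeps only points at height above `κ ε`, where the inclusions can be. A cutoff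
  -- around it stays away from the graph and therefore sees no boundary data.
  · have key := hC₂ hε hδ hΩ h hu hbv hV hW hVW hWU hcyl.1
      (T := {x | ‖c.proj x‖ < 3 * R / 2 ∧ κ * ε < c.ht x ∧ c.ht x < M * (3 * R / 2)})
      (fun n hn x ⟨hxn, hxV⟩ => by
        obtain ⟨x1, x2, x3⟩ := c.mem_cyl.1 hxV
        have h1 := c.lt_abs_ht_of_mem_cellInclusion hcyl.2 hn hxn (x1.trans_le (by linarith))
        rw [abs_of_pos x2] at h1
        exact ⟨x1, h1, x3⟩)
      (fun y hy => by
        obtain ⟨x, ⟨x1, x2, x3⟩, hyx⟩ := Metric.mem_thickening_iff.1 hy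
        have h1 := c.norm_proj_lt x1 hyx.le
        have h2 := abs_le.1 (c.abs_ht_sub_le hψ hyx.le)
        rw [← hL] at h2
        have h3 : L * (2 * r * ε) ≤ κ * ε := by nlinarith
        have h4 : L * (2 * r * ε) ≤ k * ε := by nlinarith
        have h5 : 2 * r * ε ≤ ε := by nlinarith
        have h6 : k * (4 * ε) ≤ k * R := by gcongr
        exact c.mem_cyl.2 ⟨by linarith, by linarith, by linarith⟩)
    -- In this case `R < N ε`, so the weight `ε⁻²` is at most `N² R⁻²`.
    have hi : ENNReal.ofReal (ε ^ 2)⁻¹ ≤ (N ^ 2).toNNReal * p := by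
      rw [hp, ← ENNReal.ofReal_coe_nnreal, Real.coe_toNNReal _ (sq_nonneg N),
        ← ENNReal.ofReal_mul (sq_nonneg N)]
      refine ENNReal.ofReal_le_ofReal ?_
      rw [mul_one_div, inv_le_comm₀ (by positivity) (by positivity), inv_div,
        div_le_iff₀ (by positivity), ← mul_pow, mul_comm]
      exact pow_le_pow_left₀ hR0.le hsmall.le 2
    set n₂ : ℝ≥0 := (N ^ 2).toNNReal
    calc _ ≤ C₂ * (Y + q * F + n₂ * p * B) :=
          key.trans (mul_le_mul' le_rfl (add_le_add (add_le_add le_rfl (mul_le_mul' he le_rfl))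
            (mul_le_mul' hi le_rfl)))
      _ ≤ C₂ * (Y + q * F + n₂ * p * B) + (C₁ * (Y + q * F + p * B) +
            C₂ * (n₂ * Y + n₂ * (q * F) + p * B)) := le_self_add
      _ = _ := by push_cast; ring

/-- The boundary Caccioppoli inequality, uniform in the contrast. -/
theorem exists_boundary_estimate {d m : ℕ} [NeZero d] {κ μ lam τ : ℝ} (hκ : 0 < κ) (hμ : 0 < μ)
    (hlam : 0 < lam) {ω : Set (Eu d)} (hω : InclusionAssumptions ω) {Ω : Set (Eu d)} (hΩ : IsOpen Ω)
    (hΩb : Bornology.IsBounded Ω) (K₀ : ℝ≥0) {M₀ : ℝ} (hM : 0 < M₀) :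
    ∃ C > 0, ∀ A : Eu d → Tensor d m, CoeffAssumptions μ lam τ A →
      ∀ ε δ : ℝ, 0 < ε → ε < 1 → 0 < δ → δ ≤ 1 →
      ∀ (c : GraphChart d) (R : ℝ), 4 * ε ≤ R → LipschitzWith K₀ c.ψ →
        c.IsBoundaryCyl Ω M₀ (2 * R) →
      ∀ (f u g : Eu d → Eu m) (Du : Eu d → GradSp d m),
        MemLp f 2 (volume.restrict (c.cyl M₀ (2 * R))) →
        (∃ K, LipschitzOnWith K g (c.base (2 * R))) →
        IsH1 (c.cyl M₀ (2 * R)) u Du →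
        IsWeakSolution Ω ω κ ε δ A (c.cyl M₀ (2 * R)) Du (modSource Ω ω κ ε δ f) →
        HasBoundaryValue (c.cyl M₀ (2 * R)) (c.base (2 * R)) u Du g →
        ⨍ x in c.cyl M₀ (3 * R / 2), ‖Du x‖ ^ 2 ≤
          C * ((1 / R ^ 2) * (⨍ x in c.cyl M₀ (2 * R), ‖u x‖ ^ 2)
            + R ^ 2 * (⨍ x in c.cyl M₀ (2 * R), ‖f x‖ ^ 2)
            + (1 / R ^ 2) * c.supNorm g (2 * R) ^ 2
            + c.tanGradSupNorm g (2 * R) ^ 2) := by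
  obtain ⟨C₁, hC₁⟩ := exists_boundary_cell_estimate m hκ hμ hω K₀ hM
  set L : ℝ := 1 + K₀ with hL
  have hL1 : 1 ≤ L := by rw [hL]; simp
  have hL0 : 0 < L := by linarith
  set k : ℝ := min 1 M₀ with hk
  have hk0 : 0 < k := by positivity
  have hk1 : k ≤ 1 := min_le_left _ _
  have hkM : k ≤ M₀ := min_le_right _ _
  -- A cutoff of width `b R` around the cylinder of size `7R/4` changes the radius by at most `R /
  -- 8` and the height by at most `M₀ R / 8`. It therefore meets the frontier of the largest
  -- cylinder only on the base, where the data are prescribed.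
  set b : ℝ := k / (8 * L) with hb
  have hb0 : 0 < b := by positivity
  have hbL : b * (8 * L) = k := div_mul_cancel₀ _ (by positivity)
  have hb1 : b * 8 ≤ 1 := by nlinarith
  set C₂ : ℝ≥0 := 4 * (d + 1) * energyConst μ with hC₂
  set i : ℝ≥0 := ((b ^ 2)⁻¹).toNNReal with hi
  set D : ℝ≥0 := d * (1 + K₀ ^ 2) with hD
  set C₃ : ℝ≥0 := C₁ * (C₂ * (1 + i + D) + 1) with hC₃
  refine ⟨(4 / 3) ^ (d - 1) * (4 / 3) * C₃ + 1, by positivity,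
    fun A hA ε δ hε _ hδ hδ1 c R hR hψ hcyl f u g Du hf hg hu hw hbv => ?_⟩
  have hR0 : 0 < R := by linarith
  have hkR : k * R ≤ M₀ * R := by gcongr
  have hMR : 0 < M₀ * R := by positivity
  have hUo : IsOpen (c.cyl M₀ (2 * R)) := c.isOpen_cyl hψ _ _
  have hUb : Bornology.IsBounded (c.cyl M₀ (2 * R)) := hΩb.subset hcyl.1
  have hW : MeasurableSet (c.cyl M₀ (7 * R / 4)) := (c.isOpen_cyl hψ _ _).measurableSet
  have hsol := hw.weakSol hμ hlam hω hΩ hA hε hδ hδ1 hcyl.1 Subset.rfl hUo hUo hUb hf hu.memLp_grad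
  have h1 := hC₁ hε hδ hΩ hR hψ hcyl hsol hu.memLp.1 hbv
  obtain ⟨G, ⟨_, hG⟩, hGg, hGae⟩ := c.exists_boundary_extension hψ hg
  have h2 := hsol.background_le hμ hΩ hu.memLp.1 hbv hW (c.cyl_mono hM.le (by linarith))
    (mul_pos hb0 hR0) hG (fun x hx hxW => by
      obtain ⟨y, hy, hxy⟩ := Metric.mem_thickening_iff.1 hxW
      obtain ⟨y1, -, y3⟩ := c.mem_cyl.1 hy
      have e1 := c.norm_proj_lt y1 hxy.le
      have e2 := abs_le.1 (c.abs_ht_sub_le hψ hxy.le)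
      rw [← hL] at e2
      have e3 : b * R * 8 ≤ R := by nlinarith
      have e4 : L * (b * R) * 8 = k * R := by rw [← hbL]; ring
      have := c.mem_base_of_mem_frontier_cyl hψ hx (by linarith) (by linarith)
      exact ⟨this, hGg x this⟩)
  rw [← hC₂] at h2
  have hG1 := setLIntegral_norm_sq_le_of_ae hUo.measurableSet (w := G)
    (b := c.supNorm g (2 * R) ^ 2) (hGae.mono fun x hx hxU =>
      pow_le_pow_left₀ (norm_nonneg _) (hx (c.mem_cyl.1 hxU).1).1 2)
  have hG2 := setLIntegral_norm_sq_le_of_ae hUo.measurableSet (w := gradArr G)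
    (b := D * c.tanGradSupNorm g (2 * R) ^ 2) (hGae.mono fun x hx hxU => by
      simpa [hD] using (hx (c.mem_cyl.1 hxU).1).2)
  have hvol := fun {s : ℝ} (hs : 0 < s) =>
    c.toReal_volume_cyl hψ.continuous.measurable hM.le hs
  have := average_norm_sq_le (V := c.cyl M₀ (3 * R / 2)) (U := c.cyl M₀ (2 * R))
    (c.cyl_mono hM.le (by linarith))
    (by
      rw [c.volume_cyl hψ.continuous.measurable]
      exact mul_ne_zero (Metric.measure_ball_pos _ _ (by positivity)).ne'
        (ENNReal.ofReal_pos.2 (by positivity)).ne')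
    -- The exact volume ratio of the cylinders of sizes `2R` and `3R/2`: the radial and the vertical
    -- factors are both `4 / 3` per dimension.
    hUb.measure_lt_top.ne (c := (4 / 3) ^ (d - 1) * (4 / 3))
    (by
      rw [hvol (by positivity), hvol (by positivity), show 2 * R = 4 / 3 * (3 * R / 2) by ring,
        mul_pow]
      apply le_of_eq; ring) hu.memLp_grad hu.memLp hf (C := C₃)
    (p := 1 / R ^ 2) (q := R ^ 2)
    (t := (1 / R ^ 2) * c.supNorm g (2 * R) ^ 2 + c.tanGradSupNorm g (2 * R) ^ 2)
    (by positivity) (by positivity) (by positivity) (by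
      rw [ENNReal.ofReal_add (by positivity) (by positivity), ENNReal.ofReal_mul (by positivity)]
      rw [ENNReal.ofReal_mul (by positivity), ENNReal.ofReal_coe_nnreal] at hG2
      set F := ∫⁻ x in c.cyl M₀ (2 * R), ‖f x‖ₑ ^ 2
      set B := ∫⁻ x in c.cyl M₀ (2 * R), ‖u x‖ₑ ^ 2
      have e1 : ENNReal.ofReal ((b * R) ^ 2) ≤ ENNReal.ofReal (R ^ 2) :=
        ENNReal.ofReal_le_ofReal (pow_le_pow_left₀ (by positivity) (by nlinarith) 2)
      have e2 : ENNReal.ofReal ((b * R) ^ 2)⁻¹ = i * ENNReal.ofReal (1 / R ^ 2) := by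
        rw [hi, ← ENNReal.ofReal_coe_nnreal, Real.coe_toNNReal _ (by positivity),
          ← ENNReal.ofReal_mul (by positivity), mul_pow, mul_inv, one_div]
      rw [e2] at h2
      set p := ENNReal.ofReal (1 / R ^ 2)
      set q := ENNReal.ofReal (R ^ 2)
      set v := volume (c.cyl M₀ (2 * R))
      set s := ENNReal.ofReal (c.supNorm g (2 * R) ^ 2)
      set t := ENNReal.ofReal (c.tanGradSupNorm g (2 * R) ^ 2)
      calc _ ≤ C₁ * (C₂ * (q * F + i * p * (B + s * v) + D * t * v) + q * F + p * B) :=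
            h1.trans (mul_le_mul' le_rfl (add_le_add (add_le_add (h2.trans (mul_le_mul' le_rfl
              (add_le_add (add_le_add (mul_le_mul' e1 le_rfl)
                (mul_le_mul' le_rfl (add_le_add le_rfl hG1))) hG2))) le_rfl) le_rfl))
        _ ≤ C₁ * (C₂ * (q * F + i * p * (B + s * v) + D * t * v) + q * F + p * B) +
              C₁ * (C₂ * ((i + D) * (q * F) + (1 + D) * (p * B) + (1 + D) * (p * s * v) +
                (1 + i) * (t * v)) + p * s * v + t * v) := le_self_add
        _ = _ := by rw [hC₃]; push_cast; ring)
  rw [← add_assoc] at this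
  exact this

end

theorem theorem5p4 (d m : ℕ) (hd : 2 ≤ d) (hm : 1 ≤ m)
    (κ μ lam τ : ℝ) (hκ : 0 < κ) (hμ : 0 < μ) (hlam : 0 < lam ∧ lam < 1) (hτ : 0 < τ)
    (ω : Set (Eu d)) (hω : InclusionAssumptions ω)
    (Ω : Set (Eu d)) (hΩ : IsLipschitzDomain Ω) (hΩb : Bornology.IsBounded Ω) :
    -- interior estimate
    (∃ C > 0, ∀ A : Eu d → Tensor d m, CoeffAssumptions μ lam τ A →
      ∀ ε δ : ℝ, 0 < ε → ε < 1 → 0 < δ → δ ≤ 1 →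
      ∀ (x₀ : Eu d) (R : ℝ), 4 * ε ≤ R → cube x₀ (2 * R) ⊆ Ω →
      ∀ (f u : Eu d → Eu m) (Du : Eu d → GradSp d m),
        MemLp f 2 (volume.restrict (cube x₀ (2 * R))) →
        IsH1 (cube x₀ (2 * R)) u Du →
        IsWeakSolution Ω ω κ ε δ A (cube x₀ (2 * R)) Du (modSource Ω ω κ ε δ f) →
        ⨍ x in cube x₀ R, ‖Du x‖ ^ 2 ≤
          C * ((1 / R ^ 2) * (⨍ x in cube x₀ (2 * R), ‖u x‖ ^ 2)
            + R ^ 2 * (⨍ x in cube x₀ (2 * R), ‖f x‖ ^ 2))) ∧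
    -- boundary estimate; `K₀` bounds the Lipschitz constants of the boundary graphs
    (∀ (K₀ : ℝ≥0) (M₀ : ℝ), 0 < M₀ →
      ∃ C > 0, ∀ A : Eu d → Tensor d m, CoeffAssumptions μ lam τ A →
      ∀ ε δ : ℝ, 0 < ε → ε < 1 → 0 < δ → δ ≤ 1 →
      ∀ (c : GraphChart d) (R : ℝ), 4 * ε ≤ R → LipschitzWith K₀ c.ψ →
        c.IsBoundaryCyl Ω M₀ (2 * R) →
      ∀ (f u g : Eu d → Eu m) (Du : Eu d → GradSp d m),
        MemLp f 2 (volume.restrict (c.cyl M₀ (2 * R))) →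
        (∃ K, LipschitzOnWith K g (c.base (2 * R))) →
        IsH1 (c.cyl M₀ (2 * R)) u Du →
        IsWeakSolution Ω ω κ ε δ A (c.cyl M₀ (2 * R)) Du (modSource Ω ω κ ε δ f) →
        HasBoundaryValue (c.cyl M₀ (2 * R)) (c.base (2 * R)) u Du g →
        ⨍ x in c.cyl M₀ (3 * R / 2), ‖Du x‖ ^ 2 ≤
          C * ((1 / R ^ 2) * (⨍ x in c.cyl M₀ (2 * R), ‖u x‖ ^ 2)
            + R ^ 2 * (⨍ x in c.cyl M₀ (2 * R), ‖f x‖ ^ 2)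
            + (1 / R ^ 2) * c.supNorm g (2 * R) ^ 2
            + c.tanGradSupNorm g (2 * R) ^ 2)) := by
  have : NeZero d := ⟨by omega⟩
  exact ⟨exists_interior_estimate hμ hlam.1 hω hΩ.isOpen, fun K₀ M₀ hM =>
    exists_boundary_estimate hκ hμ hlam.1 hω hΩ.isOpen hΩb K₀ hM⟩
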